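/- **Model.** Let $G$ be a finite simple undirected graph or a finite directed graph (without multiple arcs) with vertex set $\{0,\dots,n-1\}$ and $m$ edges. The input is given by singly linked adjacency lists, in arbitrary order: one list of neighbours per vertex if $G$ is undirected, and one list of out-neighbours and one list of in-neighbours per vertex if $G$ is directed. In the *implicit model* an algorithm is a fixed program for a word RAM. In unit time it can perform an arithmetic, bitwise or comparison operation on words, go to the first node of a list or to the next node of a list, read the value stored in a node, swap the values stored in two nodes of the same list to which it holds pointers, or write a word to a write-only output stream. The input cannot be changed in any other way. The extra space is the total number of bits of the registers (words and node pointers) used in addition to the input. Write $\lg=\log_2$. Let $s$ be a source vertex and $\ell\ge 0$ an integer such that every vertex of $G$ is at distance at most $\ell$ from $s$ (along directed paths if $G$ is directed). A *BFS order* is a list of the vertices in which each vertex occurs exactly once and the distances from $s$ are non-decreasing. **Theorem.** For undirected graphs, and likewise for directed graphs, there are algorithms in the implicit model which, given $n$, $s$ and the adjacency lists of $G$ (but neither $\ell$ nor $m$), use $O(\lg n)$ extra bits and output the vertices of $G$ in a BFS order - (a) in $O(m+n\ell^2)$ time; - (b) in $O(m+n\ell)$ time if $G$ has no vertex of degree $2$;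 - (c) in $O(m)$ time if every vertex of $G$ has degree at least $2\lg n+3$. For directed graphs, (b) holds if no vertex has out-degree $2$, and also if no vertex has in-degree $2$; (c) holds if all out-degrees are at least $2\lg n+3$, and also if all in-degrees are. The implied constants are absolute: there is a constant $c$ such that on every such input the extra space is at most $c(\lfloor\lg n\rfloor+1)$ bits and the time is at most $c(m+n\ell^2+1)$, $c(m+n\ell+1)$ and $c(m+1)$, respectively. -/

import Mathlib

/-! ## Adjacency lists -/

/-- The list names for a directed graph: every vertex has a list of out-neighbours and a list of
in-neighbours. (An undirected graph has one list per vertex; there the list names are `Unit`.) -/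
inductive Dir
  | outward
  | inward
  deriving DecidableEq

instance : Fintype Dir where
  elems := {Dir.outward, Dir.inward}
  complete := by intro x; cases x <;> simp

/-- A family of singly linked lists of numbers, one for each list name `i : ι` and vertex `v`:
the list `(i, v)` has `len i v` nodes, and the node at position `p < len i v` stores `val i v p`.
Entries at other positions are never accessible. The lengths and the order of the nodes are
read-only; only the stored values can be swapped. -/
structure AdjLists (ι : Type) where
  len : ι → ℕ → ℕ
  val : ι → ℕ → ℕ → ℕ

/-- The number of nodes in all lists of the vertices `0, …, n - 1`. -/
def AdjLists.nodes {ι : Type} [Fintype ι] (A : AdjLists ι) (n : ℕ) : ℕ :=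
  ∑ i, ∑ v ∈ Finset.range n, A.len i v

/-- List `(i, v)` contains every element of `S` exactly once, in some order, and nothing else. -/
def AdjLists.Lists {ι : Type} (A : AdjLists ι) {n : ℕ} (i : ι) (v : Fin n)
    (S : Set (Fin n)) : Prop :=
  Set.BijOn (A.val i v) (Set.Iio (A.len i v)) (Fin.val '' S)

/-- Adjacency-list representation of an undirected graph, the lists being in arbitrary order. -/
def AdjLists.RepresentsGraph (A : AdjLists Unit) {n : ℕ} (G : SimpleGraph (Fin n)) : Prop :=
  ∀ v, A.Lists () v {u | G.Adj v u}

/-- In- and out-adjacency-list representation of a directed graph, the lists being in arbitrary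
order. -/
def AdjLists.RepresentsDigraph (A : AdjLists Dir) {n : ℕ} (G : Digraph (Fin n)) : Prop :=
  ∀ v, A.Lists Dir.outward v {u | G.Adj v u} ∧ A.Lists Dir.inward v {u | G.Adj u v}

/-! ## The implicit model: word RAM programs that may swap elements within a list -/

/-- The arithmetic and bitwise operations on machine words. -/
inductive WordOp
  | add | sub | mul | div | mod | land | lor | xor | shl | shr

/-- On natural numbers; `sub` is truncated, and division by zero yields zero. -/
def WordOp.eval : WordOp → ℕ → ℕ → ℕ
  | .add, a, b => a + b
  | .sub, a, b => a - b
  | .mul, a, b => a * b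
  | .div, a, b => a / b
  | .mod, a, b => a % b
  | .land, a, b => a &&& b
  | .lor, a, b => a ||| b
  | .xor, a, b => a ^^^ b
  | .shl, a, b => a <<< b
  | .shr, a, b => a >>> b

/-- Unit-cost instructions, for a machine with `k` word registers and `j` pointer registers. -/
inductive Instr (ι : Type) (k j : ℕ)
  /-- set word register `x` to the constant `a` -/
  | const (x : Fin k) (a : ℕ)
  /-- copy word register `y` to `x` -/
  | copy (x y : Fin k)
  /-- apply a word operation to `y` and `z`, with the result in `x` -/
  | op (f : WordOp) (x y z : Fin k)
  /-- copy pointer register `q` to `p` -/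
  | copyPtr (p q : Fin j)
  /-- let `p` point to the first node (null if there is none) of the list named `i` of the
  vertex in register `x` -/
  | head (p : Fin j) (i : ι) (x : Fin k)
  /-- let `p` point to the successor (null if there is none) of the node `q` points to -/
  | next (p q : Fin j)
  /-- load the value stored in the node `p` points to -/
  | load (x : Fin k) (p : Fin j)
  /-- swap the values stored in two nodes of the same list -/
  | swap (p q : Fin j)
  /-- append the word in `x` to the output stream -/
  | output (x : Fin k)

/-- Unit-cost tests. -/
inductive Cond (k j : ℕ)
  | eq (x y : Fin k)
  | lt (x y : Fin k)
  | isNull (p : Fin j)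
  | samePtr (p q : Fin j)

/-- Programs: finite texts, which cannot depend on the input; `loop b P` is `while b do P`. -/
inductive Prog (ι : Type) (k j : ℕ)
  | skip
  | instr (a : Instr ι k j)
  | seq (P Q : Prog ι k j)
  | ite (b : Cond k j) (P Q : Prog ι k j)
  | loop (b : Cond k j) (P : Prog ι k j)

/-- Machine states. A pointer is null (`none`) or addresses the node at position `p` of the
list named `i` of vertex `v`, as `some (i, v, p)`. The output stream is write-only. -/
structure MachineState (ι : Type) (k j : ℕ) where
  word : Fin k → ℕ
  ptr : Fin j → Option (ι × ℕ × ℕ)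
  mem : AdjLists ι
  out : List ℕ

/-- Write `a` to word register `x`; impossible if `a` does not fit into `w` bits. -/
def MachineState.setWord {ι : Type} {k j : ℕ} (w : ℕ) (σ : MachineState ι k j) (x : Fin k)
    (a : ℕ) : Option (MachineState ι k j) :=
  if a < 2 ^ w then some { σ with word := Function.update σ.word x a } else none

/-- Write a pointer register. -/
def MachineState.setPtr {ι : Type} {k j : ℕ} (σ : MachineState ι k j) (p : Fin j)
    (a : Option (ι × ℕ × ℕ)) : MachineState ι k j :=
  { σ with ptr := Function.update σ.ptr p a }

/-- The pointer to position `p` of list `(i, v)`, null if the list has no such position. -/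
def AdjLists.nodeAt {ι : Type} (A : AdjLists ι) (i : ι) (v p : ℕ) : Option (ι × ℕ × ℕ) :=
  if p < A.len i v then some (i, v, p) else none

open Classical in
/-- Exchange the values at positions `p` and `q` of list `(i, v)`. -/
noncomputable def AdjLists.swap {ι : Type} (A : AdjLists ι) (i : ι) (v p q : ℕ) : AdjLists ι where
  len := A.len
  val := fun i' v' r =>
    if i' = i ∧ v' = v then A.val i v (Equiv.swap p q r) else A.val i' v' r

open Classical in
/-- Effect of an instruction on an `n`-vertex input with word size `w`; `none` means that the
instruction is not allowed in the given state (overflow, a word that is not a vertex, access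
through the null pointer, a swap between two different lists). -/
noncomputable def Instr.apply {ι : Type} {k j : ℕ} (n w : ℕ) (σ : MachineState ι k j) :
    Instr ι k j → Option (MachineState ι k j)
  | .const x a => σ.setWord w x a
  | .copy x y => σ.setWord w x (σ.word y)
  | .op f x y z => σ.setWord w x (f.eval (σ.word y) (σ.word z))
  | .copyPtr p q => some (σ.setPtr p (σ.ptr q))
  | .head p i x =>
      if σ.word x < n then some (σ.setPtr p (σ.mem.nodeAt i (σ.word x) 0)) else none
  | .next p q =>
      match σ.ptr q with
      | some (i, v, r) => some (σ.setPtr p (σ.mem.nodeAt i v (r + 1)))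
      | none => none
  | .load x p =>
      match σ.ptr p with
      | some (i, v, r) => σ.setWord w x (σ.mem.val i v r)
      | none => none
  | .swap p q =>
      match σ.ptr p, σ.ptr q with
      | some (i, v, r), some (i', v', r') =>
          if i = i' ∧ v = v' then some { σ with mem := σ.mem.swap i v r r' } else none
      | _, _ => none
  | .output x => some { σ with out := σ.out ++ [σ.word x] }

/-- Truth of a test in a state. -/
def Cond.Holds {ι : Type} {k j : ℕ} (σ : MachineState ι k j) : Cond k j → Prop
  | .eq x y => σ.word x = σ.word y
  | .lt x y => σ.word x < σ.word y
  | .isNull p => σ.ptr p = none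
  | .samePtr p q => σ.ptr p = σ.ptr q

/-- `Exec n w P σ σ' t`: on an `n`-vertex input with word size `w`, program `P` started in
state `σ` halts in state `σ'`, after `t` instructions and tests, all of them allowed. -/
inductive Exec {ι : Type} {k j : ℕ} (n w : ℕ) :
    Prog ι k j → MachineState ι k j → MachineState ι k j → ℕ → Prop
  | skip (σ) : Exec n w .skip σ σ 0
  | instr {a σ σ'} : a.apply n w σ = some σ' → Exec n w (.instr a) σ σ' 1
  | seq {P Q σ₁ σ₂ σ₃ t₁ t₂} : Exec n w P σ₁ σ₂ t₁ → Exec n w Q σ₂ σ₃ t₂ →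
      Exec n w (.seq P Q) σ₁ σ₃ (t₁ + t₂)
  | iteTrue {b P Q σ σ' t} : b.Holds σ → Exec n w P σ σ' t →
      Exec n w (.ite b P Q) σ σ' (t + 1)
  | iteFalse {b P Q σ σ' t} : ¬ b.Holds σ → Exec n w Q σ σ' t →
      Exec n w (.ite b P Q) σ σ' (t + 1)
  | loopFalse {b P σ} : ¬ b.Holds σ → Exec n w (.loop b P) σ σ 1
  | loopTrue {b P σ₁ σ₂ σ₃ t₁ t₂} : b.Holds σ₁ → Exec n w P σ₁ σ₂ t₁ →
      Exec n w (.loop b P) σ₂ σ₃ t₂ → Exec n w (.loop b P) σ₁ σ₃ (t₁ + t₂ + 1)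

/-- The initial state: word register `0` holds the number `n` of vertices, word register `1` the
source, all other registers are zero or null, and nothing has been output. -/
def MachineState.init {ι : Type} (k j : ℕ) (A : AdjLists ι) {n : ℕ} (s : Fin n) :
    MachineState ι k j where
  word := fun x => if x.val = 0 then n else if x.val = 1 then s.val else 0
  ptr := fun _ => none
  mem := A
  out := []

/-- The number of extra bits: `k` registers of `w` bits each, and `j` registers each holding
null or a pointer to one of `N` nodes. -/
def extraBits (k j w N : ℕ) : ℕ := k * w + j * Nat.size N

/-! ## Breadth-first search -/

/-- There is a directed walk of length `k` from `u` to `v`. -/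
def Digraph.StepsTo {V : Type} (G : Digraph V) : ℕ → V → V → Prop
  | 0, u, v => u = v
  | k + 1, u, v => ∃ x, G.StepsTo k u x ∧ G.Adj x v

/-- The length of a shortest directed path from `u` to `v`, and `⊤` if there is none. -/
noncomputable def Digraph.edist {V : Type} (G : Digraph V) (u v : V) : ℕ∞ :=
  ⨅ (k : ℕ) (_ : G.StepsTo k u v), (k : ℕ∞)

/-- Given the distances `d` of all vertices from the source, `l` is a BFS order: each vertex that
is reachable from the source occurs exactly once, no other vertex occurs, and the vertices come
level by level. -/
def IsBFSOrder {V : Type} (d : V → ℕ∞) (l : List V) : Prop :=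
  l.Nodup ∧ (∀ v, v ∈ l ↔ d v ≠ ⊤) ∧ l.Pairwise fun u v => d u ≤ d v

/-- Program `P`, run on the adjacency lists `A` and source `s` with a word size in which `n` fits,
halts within time `T` using at most `B` extra bits, and outputs a BFS order of the vertices,
where `d` gives the distances from the source. -/
def Prog.OutputsBFS {ι : Type} [Fintype ι] {k j : ℕ} (P : Prog ι k j) (A : AdjLists ι) {n : ℕ}
    (s : Fin n) (d : Fin n → ℕ∞) (T B : ℕ) : Prop :=
  ∃ (w t : ℕ) (σ : MachineState ι k j) (l : List (Fin n)),
    n < 2 ^ w ∧ extraBits k j w (A.nodes n) ≤ B ∧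
    Exec n w P (MachineState.init k j A s) σ t ∧ t ≤ T ∧
    σ.out = l.map Fin.val ∧ IsBFSOrder d l

/-- Number of edges of a directed graph. -/
noncomputable def Digraph.numEdges {V : Type} (G : Digraph V) : ℕ :=
  {e : V × V | G.Adj e.1 e.2}.ncard

/-- Out-degree. -/
noncomputable def Digraph.outDeg {V : Type} (G : Digraph V) (v : V) : ℕ := {u | G.Adj v u}.ncard

/-- In-degree. -/
noncomputable def Digraph.inDeg {V : Type} (G : Digraph V) (v : V) : ℕ := {u | G.Adj u v}.ncard

/-! Every adjacency list serves as a small memory. Its values are distinct, so the order of two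
adjacent values encodes a bit that a swap flips, and the value swapped to the front encodes the
choice of one neighbour. Two algorithms use this memory.

The search by levels (`Code.bfs`) takes time O(m + nℓ) on every graph, which gives (a) and (b). Let
`a` be the lists of successors and `b` those of predecessors; they are the same lists if the graph
is undirected. A discovered vertex keeps its parent in a search tree at the front of its list `b`, a
discovery bit at positions 3, 4 of that list, and an activity bit at positions `off`, `off + 1` of
its list `a`. With `off = 0` if `a ≠ b` and `off = 1` if `a = b`, these places never overlap. A
vertex with fewer than five predecessors has no discovery bit. Whether it has been discovered is
found by following parent pointers (`runs_walk`); this takes O(d) steps on level `d`, but is needed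
for at most four edges per vertex.

There is no queue, so a phase has to find the vertices of its level `d` by other means. Call the
source and the vertices with room for an activity bit roots. A vertex that is not a root has at most
one child (`Layout.chainTree`); hence these vertices form chains that hang from roots and have at
most one vertex on each level. A phase runs through all vertices and treats the source and the
active roots. A root on level `d` is output and its successors are examined; from a root higher up,
the chains are followed down to level `d` (`runs_serve`). A root becomes active on discovery and
inactive when none of its chains reaches the present level. A chain skips no level, so it is never
needed again.

The time is charged as follows. Computing the level of an active vertex costs O(d), charged to the
source or to a vertex on level `d - 1`, `d` or `d + 1`. Following the chains costs O(n) per phase,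
because they are disjoint. The chains below a root are found quickly because its children that are
not roots are grouped once within its list (`runs_group`). Moving a parent to the front of a long
list happens once per vertex and is paid for by a potential. `Layout.sum_levelCost_le` adds
everything up.

For (c), the lists have room for a visited bit and ⌈lg n⌉ further bits, so each vertex can store the
number of another one. The vertices of the present and of the next level then form linked stacks
(`runs_stackBfs`). The O(lg n) time per vertex is absorbed by the degree bound. For directed graphs,
a preliminary pass decides whether the out-lists or the in-lists serve as storage. -/

open Set

infixr:60 " ;; " => Prog.seq

/-- Program `P`, started in `σ`, halts in a state `σ'` after `t` steps such that `Q σ' t`. -/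
def Runs {ι : Type} {k j : ℕ} (n w : ℕ) (P : Prog ι k j) (σ : MachineState ι k j)
    (Q : MachineState ι k j → ℕ → Prop) : Prop :=
  ∃ σ' t, Exec n w P σ σ' t ∧ Q σ' t

/-! ### A program logic with exact running times. -/

section Rules

variable {ι : Type} {k j n w : ℕ} {P P' : Prog ι k j} {σ : MachineState ι k j}
  {Q Q' : MachineState ι k j → ℕ → Prop}

theorem Runs.mono (h : Runs n w P σ Q) (hQ : ∀ σ' t, Q σ' t → Q' σ' t) : Runs n w P σ Q' := by
  obtain ⟨σ', t, he, hq⟩ := h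
  exact ⟨σ', t, he, hQ _ _ hq⟩

theorem Runs.seq (h : Runs n w P σ Q)
    (h' : ∀ σ' t, Q σ' t → Runs n w P' σ' fun σ'' t' => Q' σ'' (t + t')) :
    Runs n w (P ;; P') σ Q' := by
  obtain ⟨σ', t, he, hq⟩ := h
  obtain ⟨σ'', t', he', hq'⟩ := h' _ _ hq
  exact ⟨σ'', _, .seq he he', hq'⟩

/-- As an equivalence, like the rules for single instructions, it lets `rw` execute a program
symbolically; `Runs.seq` is for steps with a chosen intermediate assertion. -/
theorem runs_seq : Runs n w (P ;; P') σ Q ↔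
    Runs n w P σ fun σ' t => Runs n w P' σ' fun σ'' t' => Q σ'' (t + t') := by
  constructor
  · rintro ⟨σ', t, he, hq⟩
    cases he with
    | seq h1 h2 => exact ⟨_, _, h1, _, _, h2, hq⟩
  · rintro ⟨σ', t, he, σ'', t', he', hq⟩
    exact ⟨_, _, .seq he he', hq⟩

theorem runs_skip : Runs n w (.skip : Prog ι k j) σ Q ↔ Q σ 0 := by
  constructor
  · rintro ⟨σ', t, he, hq⟩
    cases he; exact hq
  · exact fun h => ⟨_, _, .skip _, h⟩

theorem runs_instr {a : Instr ι k j} :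
    Runs n w (.instr a) σ Q ↔ ∃ σ', a.apply n w σ = some σ' ∧ Q σ' 1 := by
  constructor
  · rintro ⟨σ', t, he, hq⟩
    cases he with
    | instr h => exact ⟨_, h, hq⟩
  · rintro ⟨σ', h, hq⟩
    exact ⟨_, _, .instr h, hq⟩

theorem runs_const {x : Fin k} {a : ℕ} : Runs n w (.instr (.const x a) : Prog ι k j) σ Q ↔
    a < 2 ^ w ∧ Q { σ with word := Function.update σ.word x a } 1 := by
  simp [runs_instr, Instr.apply, MachineState.setWord]

theorem runs_copy {x y : Fin k} : Runs n w (.instr (.copy x y) : Prog ι k j) σ Q ↔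
    σ.word y < 2 ^ w ∧ Q { σ with word := Function.update σ.word x (σ.word y) } 1 := by
  simp [runs_instr, Instr.apply, MachineState.setWord]

theorem runs_op {f : WordOp} {x y z : Fin k} : Runs n w (.instr (.op f x y z) : Prog ι k j) σ Q ↔
    f.eval (σ.word y) (σ.word z) < 2 ^ w ∧
      Q { σ with word := Function.update σ.word x (f.eval (σ.word y) (σ.word z)) } 1 := by
  simp [runs_instr, Instr.apply, MachineState.setWord]

theorem runs_copyPtr {p q : Fin j} : Runs n w (.instr (.copyPtr p q) : Prog ι k j) σ Q ↔
    Q { σ with ptr := Function.update σ.ptr p (σ.ptr q) } 1 := by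
  simp [runs_instr, Instr.apply, MachineState.setPtr]

theorem runs_head {p : Fin j} {i : ι} {x : Fin k} :
    Runs n w (.instr (.head p i x) : Prog ι k j) σ Q ↔ σ.word x < n ∧
      Q { σ with ptr := Function.update σ.ptr p (σ.mem.nodeAt i (σ.word x) 0) } 1 := by
  simp [runs_instr, Instr.apply, MachineState.setPtr]

theorem runs_next {p q : Fin j} : Runs n w (.instr (.next p q) : Prog ι k j) σ Q ↔
    ∃ i v r, σ.ptr q = some (i, v, r) ∧
      Q { σ with ptr := Function.update σ.ptr p (σ.mem.nodeAt i v (r + 1)) } 1 := by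
  rw [runs_instr]
  rcases h : σ.ptr q with _ | ⟨i, v, r⟩
  · simp [Instr.apply, h]
  · simp [Instr.apply, h, MachineState.setPtr]

theorem runs_load {x : Fin k} {p : Fin j} : Runs n w (.instr (.load x p) : Prog ι k j) σ Q ↔
    ∃ i v r, σ.ptr p = some (i, v, r) ∧ σ.mem.val i v r < 2 ^ w ∧
      Q { σ with word := Function.update σ.word x (σ.mem.val i v r) } 1 := by
  rw [runs_instr]
  rcases h : σ.ptr p with _ | ⟨i, v, r⟩
  · simp [Instr.apply, h]
  · simp [Instr.apply, h, MachineState.setWord]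

theorem Runs.swap {p q : Fin j} {i : ι} {v r r' : ℕ} (hp : σ.ptr p = some (i, v, r))
    (hq : σ.ptr q = some (i, v, r')) (h : Q { σ with mem := σ.mem.swap i v r r' } 1) :
    Runs n w (.instr (.swap p q) : Prog ι k j) σ Q := by
  rw [runs_instr]
  exact ⟨_, by simp [Instr.apply, hp, hq], h⟩

theorem runs_output {x : Fin k} : Runs n w (.instr (.output x) : Prog ι k j) σ Q ↔
    Q { σ with out := σ.out ++ [σ.word x] } 1 := by
  simp [runs_instr, Instr.apply]

theorem runs_ite {b : Cond k j} : Runs n w (.ite b P P') σ Q ↔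
    (b.Holds σ → Runs n w P σ fun σ' t => Q σ' (t + 1)) ∧
    (¬ b.Holds σ → Runs n w P' σ fun σ' t => Q σ' (t + 1)) := by
  constructor
  · rintro ⟨σ', t, he, hq⟩
    cases he with
    | iteTrue hb h => exact ⟨fun _ => ⟨_, _, h, hq⟩, fun h => absurd hb h⟩
    | iteFalse hb h => exact ⟨fun h => absurd h hb, fun _ => ⟨_, _, h, hq⟩⟩
  · rintro ⟨h1, h2⟩
    by_cases hb : b.Holds σ
    · obtain ⟨σ', t, he, hq⟩ := h1 hb
      exact ⟨_, _, .iteTrue hb he, hq⟩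
    · obtain ⟨σ', t, he, hq⟩ := h2 hb
      exact ⟨_, _, .iteFalse hb he, hq⟩

theorem Runs.iteTrue {b : Cond k j} (hb : b.Holds σ)
    (h : Runs n w P σ fun σ' t => Q σ' (t + 1)) : Runs n w (.ite b P P') σ Q :=
  runs_ite.2 ⟨fun _ => h, fun hn => absurd hb hn⟩

theorem Runs.iteFalse {b : Cond k j} (hb : ¬ b.Holds σ)
    (h : Runs n w P' σ fun σ' t => Q σ' (t + 1)) : Runs n w (.ite b P P') σ Q :=
  runs_ite.2 ⟨fun hn => absurd hn hb, fun _ => h⟩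

/-- Partial-correctness invariant `I` (of the state and the time spent) with variant `μ`. -/
theorem Runs.loop {b : Cond k j} (I : MachineState ι k j → ℕ → Prop)
    (μ : MachineState ι k j → ℕ) (h0 : I σ 0)
    (step : ∀ σ t, I σ t → b.Holds σ →
      Runs n w P σ fun σ' t' => I σ' (t + t' + 1) ∧ μ σ' < μ σ) :
    Runs n w (.loop b P) σ fun σ' t => ∃ t₁, t = t₁ + 1 ∧ I σ' t₁ ∧ ¬ b.Holds σ' := by
  -- The time already spent is generalised, because the invariant speaks of the total time since the
  -- start of the loop.
  suffices H : ∀ m σ t, μ σ ≤ m → I σ t →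
      Runs n w (.loop b P) σ fun σ' t' => ∃ t₁, t + t' = t₁ + 1 ∧ I σ' t₁ ∧ ¬ b.Holds σ' by
    simpa using H _ σ 0 le_rfl h0
  intro m
  induction m with
  | zero =>
    intro σ t hm hI
    by_cases hb : b.Holds σ
    · obtain ⟨σ', t', _, _, h⟩ := step σ t hI hb
      omega
    · exact ⟨_, _, .loopFalse hb, t, rfl, hI, hb⟩
  | succ m ih =>
    intro σ t hm hI
    by_cases hb : b.Holds σ
    · obtain ⟨σ', t', he, hI', h⟩ := step σ t hI hb
      obtain ⟨σ'', t'', he', t₁, h1, h2⟩ := ih σ' (t + t' + 1) (by omega) hI'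
      exact ⟨_, _, .loopTrue hb he he', t₁, by omega, h2⟩
    · exact ⟨_, _, .loopFalse hb, t, rfl, hI, hb⟩

/-- A loop with `N` iterations. -/
theorem Runs.count {b : Cond k j} (N : ℕ) (I : ℕ → MachineState ι k j → ℕ → Prop)
    (h0 : I 0 σ 0)
    (step : ∀ r < N, ∀ σ t, I r σ t → b.Holds σ ∧
      Runs n w P σ fun σ' t' => I (r + 1) σ' (t + t' + 1))
    (halt : ∀ σ t, I N σ t → ¬ b.Holds σ) :
    Runs n w (.loop b P) σ fun σ' t => ∃ t₁, t = t₁ + 1 ∧ I N σ' t₁ := by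
  suffices H : ∀ m r σ t, r + m = N → I r σ t →
      Runs n w (.loop b P) σ fun σ' t' => ∃ t₁, t + t' = t₁ + 1 ∧ I N σ' t₁ by
    simpa using H N 0 σ 0 (by simp) h0
  intro m
  induction m with
  | zero =>
    intro r σ t hm hI
    obtain rfl : r = N := by omega
    exact ⟨_, _, .loopFalse (halt _ _ hI), t, rfl, hI⟩
  | succ m ih =>
    intro r σ t hm hI
    obtain ⟨hb, σ', t', he, hI'⟩ := step r (by omega) σ t hI
    obtain ⟨σ'', t'', he', t₁, h1, h2⟩ := ih (r + 1) σ' (t + t' + 1) (by omega) hI'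
    exact ⟨_, _, .loopTrue hb he he', t₁, by omega, h2⟩

end Rules

/-! ### Programs with 24 word registers and 8 pointer registers -/

abbrev Code (ι : Type) := Prog ι 24 8

abbrev Mach (ι : Type) := MachineState ι 24 8

/-- The word registers below `lo`, the pointer registers below `plo` and the output agree. -/
structure Keeps {ι : Type} (lo plo : ℕ) (σ σ' : Mach ι) : Prop where
  word : ∀ x : Fin 24, x.val < lo → σ'.word x = σ.word x
  ptr : ∀ p : Fin 8, p.val < plo → σ'.ptr p = σ.ptr p
  out : σ'.out = σ.out

section Keeps

variable {ι : Type} {lo plo lo' plo' : ℕ} {σ σ' σ'' : Mach ι}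

theorem Keeps.refl (σ : Mach ι) : Keeps lo plo σ σ := ⟨fun _ _ => rfl, fun _ _ => rfl, rfl⟩

theorem Keeps.trans (h : Keeps lo plo σ σ') (h' : Keeps lo plo σ' σ'') : Keeps lo plo σ σ'' :=
  ⟨fun x hx => (h'.word x hx).trans (h.word x hx), fun x hx => (h'.ptr x hx).trans (h.ptr x hx),
    h'.out.trans h.out⟩

theorem Keeps.mono (h : Keeps lo' plo' σ σ') (h1 : lo ≤ lo') (h2 : plo ≤ plo') :
    Keeps lo plo σ σ' :=
  ⟨fun x hx => h.word x (hx.trans_le h1), fun x hx => h.ptr x (hx.trans_le h2), h.out⟩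

theorem Keeps.setWord (h : Keeps lo plo σ σ') {x : Fin 24} {a : ℕ} (hx : lo ≤ x.val) :
    Keeps lo plo σ { σ' with word := Function.update σ'.word x a } := by
  refine ⟨fun y hy => ?_, h.ptr, h.out⟩
  have : y ≠ x := by rintro rfl; omega
  simp only [Function.update_of_ne this]
  exact h.word y hy

theorem Keeps.setPtr (h : Keeps lo plo σ σ') {x : Fin 8} {a} (hx : plo ≤ x.val) :
    Keeps lo plo σ { σ' with ptr := Function.update σ'.ptr x a } := by
  refine ⟨h.word, fun y hy => ?_, h.out⟩
  have : y ≠ x := by rintro rfl; omega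
  simp only [Function.update_of_ne this]
  exact h.ptr y hy

theorem Keeps.setMem (h : Keeps lo plo σ σ') {m : AdjLists ι} :
    Keeps lo plo σ { σ' with mem := m } :=
  ⟨h.word, h.ptr, h.out⟩

end Keeps

/-! ### Traversing a list. -/

/-- Set the flag `f` to `1` if pointer `p` is not null, and to `0` otherwise. -/
def Code.flag {ι : Type} (p : Fin 8) (f : Fin 24) : Code ι :=
  .ite (.isNull p) (.instr (.const f 0)) (.instr (.const f 1))

/-- Run `body` with `p` pointing to the successive nodes of the list `i` of the vertex in `x`,
until the list ends or `body` clears the flag `f`. Register `2` must contain `1`. -/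
def Code.scan {ι : Type} (i : ι) (x : Fin 24) (p : Fin 8) (f : Fin 24) (body : Code ι) : Code ι :=
  .instr (.head p i x) ;; Code.flag p f ;;
    .loop (.eq f 2) (body ;; .ite (.eq f 2) (.instr (.next p p) ;; Code.flag p f) .skip)

section Scan

variable {ι : Type} {n w : ℕ} {σ : Mach ι}

theorem runs_flag {p : Fin 8} {f : Fin 24} {Q : Mach ι → ℕ → Prop} (hw : 1 < 2 ^ w)
    (h : Q { σ with word := Function.update σ.word f (if σ.ptr p = none then 0 else 1) } 2) :
    Runs n w (Code.flag p f) σ Q := by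
  rw [Code.flag, runs_ite]
  constructor
  · intro hp
    simp only [Cond.Holds] at hp
    rw [runs_const]
    rw [if_pos hp] at h
    exact ⟨by omega, h⟩
  · intro hp
    simp only [Cond.Holds] at hp
    rw [runs_const]
    rw [if_neg hp] at h
    exact ⟨by omega, h⟩

/-- `I r` is the invariant after `r` nodes and `J` the final assertion, which may also be reached
early. Before the loop, `head` and the flag cost 3. A full round costs 5 beyond the body: two tests,
`next` and the flag. A round that clears the flag costs 3: two tests, and the one that ends the
loop. By `hI` the invariant must not depend on the pointer `p` and the flag `f`, which the traversal
itself overwrites. -/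
theorem runs_scan {i : ι} {x : Fin 24} {p : Fin 8} {f : Fin 24} {body : Code ι} (v N : ℕ)
    (I : ℕ → Mach ι → ℕ → Prop) (J : Mach ι → ℕ → Prop) (hw : 1 < 2 ^ w) (hf : f ≠ 2)
    (hx : σ.word x = v) (hv : v < n) (h2 : σ.word 2 = 1) (hN : σ.mem.len i v = N)
    (hI : ∀ r σ τ a c, I r σ τ →
      I r { σ with ptr := Function.update σ.ptr p a, word := Function.update σ.word f c } τ)
    (h0 : I 0 σ 3)
    (step : ∀ r < N, ∀ σ τ, I r σ τ → σ.ptr p = some (i, v, r) → σ.word f = 1 → σ.word 2 = 1 →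
      σ.mem.len i v = N → Runs n w body σ fun σ' t => σ'.word 2 = 1 ∧ σ'.mem.len i v = N ∧
        ((σ'.ptr p = some (i, v, r) ∧ σ'.word f = 1 ∧ I (r + 1) σ' (τ + t + 5)) ∨
          (σ'.word f ≠ 1 ∧ J σ' (τ + t + 3))))
    (halt : ∀ σ τ, I N σ τ → J σ (τ + 1)) :
    Runs n w (Code.scan i x p f body) σ J := by
  rw [Code.scan, runs_seq, runs_head]
  refine ⟨by omega, ?_⟩
  rw [runs_seq]
  apply runs_flag hw
  simp only [hx, Function.update_self]
  set σ₁ : Mach ι := _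
  change Runs n w _ σ₁ _
  let Inv : Mach ι → ℕ → Prop := fun σ' t => σ'.word 2 = 1 ∧ σ'.mem.len i v = N ∧
    ((∃ r ≤ N, I r σ' (t + 3) ∧ σ'.ptr p = (if r < N then some (i, v, r) else none) ∧
      σ'.word f = (if r < N then 1 else 0)) ∨ (σ'.word f ≠ 1 ∧ J σ' (t + 4)))
  let μ : Mach ι → ℕ := fun σ' => if σ'.word f = 1 then
    (match σ'.ptr p with | none => 0 | some (_, _, r) => N - r + 1) else 0
  have hpt : ∀ (M : AdjLists ι) r, M.len i v = N → M.nodeAt i v r =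
      if r < N then some (i, v, r) else none := by
    intro M r h
    simp [AdjLists.nodeAt, h]
  have h01 : ∀ r, (if ((if r < N then some (i, v, r) else none : Option (ι × ℕ × ℕ)) = none)
      then 0 else 1) = if r < N then 1 else 0 := by
    intro r; split_ifs <;> simp_all
  refine (Runs.loop (b := .eq f 2) Inv μ ?_ ?_).mono ?_
  · refine ⟨?_, hN, Or.inl ⟨0, by omega, ?_, ?_, ?_⟩⟩
    · simp [σ₁, Function.update_of_ne hf.symm, h2]
    · exact hI _ _ _ _ _ h0
    · simp only [σ₁, Function.update_self, hpt _ _ hN]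
    · simp only [σ₁, Function.update_self, hpt _ _ hN, h01]
  · rintro σ' t ⟨h2', hN', h | ⟨h, -⟩⟩ hb
    swap
    · exact absurd (by simpa [Cond.Holds, h2'] using hb) h
    obtain ⟨r, hr, hI', hp, hf'⟩ := h
    have hrN : r < N := by
      by_contra hn
      simp [Cond.Holds, h2', hf', hn] at hb
    rw [if_pos hrN] at hp hf'
    refine (step r hrN σ' _ hI' hp hf' h2' hN').seq ?_
    rintro σ'' t' ⟨h2'', hN'', ⟨hp'', hf'', hI''⟩ | ⟨hf'', hJ⟩⟩
    · apply Runs.iteTrue (by simp [Cond.Holds, h2'', hf''])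
      rw [runs_seq, runs_next]
      refine ⟨i, v, r, hp'', ?_⟩
      apply runs_flag hw
      simp only [Function.update_self, hpt _ _ hN'', h01]
      refine ⟨⟨?_, hN'', Or.inl ⟨r + 1, hrN, ?_, ?_, ?_⟩⟩, ?_⟩
      · simp [Function.update_of_ne hf.symm, h2'']
      · have := hI _ _ _ (if r + 1 < N then some (i, v, r + 1) else none)
          (if r + 1 < N then 1 else 0) hI''
        convert this using 1
        ring
      · simp
      · simp
      · simp only [μ, Function.update_self, hp, hf', if_true]
        split_ifs <;> simp_all
        omega
    · apply Runs.iteFalse (by simp [Cond.Holds, h2'', hf''])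
      rw [runs_skip]
      refine ⟨⟨h2'', hN'', Or.inr ⟨hf'', ?_⟩⟩, ?_⟩
      · convert hJ using 1
        ring
      · simp [μ, hf'', hf', hp]
  · rintro σ' t ⟨t₁, rfl, ⟨h2', hN', h | ⟨h, hJ⟩⟩, hb⟩
    · obtain ⟨r, hr, hI', hp, hf'⟩ := h
      have : r = N := by
        by_contra hne
        have : r < N := by omega
        simp [Cond.Holds, h2', hf', this] at hb
      subst this
      convert halt _ _ hI' using 1
      ring
    · convert hJ using 1
      ring

end Scan

/-! ### Bits encoded by the order of adjacent values. -/

namespace AdjLists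

variable {ι : Type} {M : AdjLists ι} {i i' : ι} {v v' p q r : ℕ}

@[simp] theorem swap_len : (M.swap i v p q).len = M.len := rfl

theorem swap_val_ne (h : i' ≠ i ∨ v' ≠ v) : (M.swap i v p q).val i' v' = M.val i' v' := by
  funext r
  simp only [AdjLists.swap]
  rw [if_neg (by tauto)]

theorem swap_val_self : (M.swap i v p q).val i v r = M.val i v (Equiv.swap p q r) := by
  simp [AdjLists.swap]

theorem swap_val_of_ne_ne (hp : r ≠ p) (hq : r ≠ q) :
    (M.swap i v p q).val i v r = M.val i v r := by
  rw [swap_val_self, Equiv.swap_apply_of_ne_of_ne hp hq]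

/-- A swap inside a list composes its value function with a permutation of the positions, so the
list still represents the same neighbours. This allows the input to be used as storage. -/
theorem bijOn_swap {S : Set ℕ} (h : BijOn (M.val i' v') (Iio (M.len i' v')) S)
    (hp : p < M.len i v) (hq : q < M.len i v) :
    BijOn ((M.swap i v p q).val i' v') (Iio (M.len i' v')) S := by
  by_cases hiv : i' = i ∧ v' = v
  · obtain ⟨rfl, rfl⟩ := hiv
    have : (M.swap i' v' p q).val i' v' = M.val i' v' ∘ Equiv.swap p q := by
      funext r
      rw [swap_val_self, Function.comp]
    rw [this]
    refine h.comp ⟨?_, (Equiv.injective _).injOn, ?_⟩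
    · intro r hr
      rw [Equiv.swap_apply_def]
      simp only [mem_Iio] at *
      split_ifs <;> omega
    · intro r hr
      refine ⟨Equiv.swap p q r, ?_, by simp⟩
      rw [Equiv.swap_apply_def]
      simp only [mem_Iio] at *
      split_ifs <;> omega
  · rw [swap_val_ne (by tauto)]
    exact h

/-- The bit represented by the order of the values at positions `p` and `p + 1` of list `(i, v)`;
`2` if there are no such positions. -/
def pairState (M : AdjLists ι) (i : ι) (v p : ℕ) : ℕ :=
  if p + 1 < M.len i v then if M.val i v p < M.val i v (p + 1) then 1 else 0 else 2

/-- Make the order of the values at positions `p` and `p + 1` of list `(i, v)` represent the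
bit `β`. -/
noncomputable def setPair (M : AdjLists ι) (i : ι) (v p β : ℕ) : AdjLists ι :=
  -- A missing pair has state `2`, which differs from `1 - β`, and is left alone.
  if M.pairState i v p = 1 - β then M.swap i v p (p + 1) else M

theorem pairState_le : M.pairState i v p ≤ 2 := by
  unfold pairState; split_ifs <;> omega

theorem pairState_eq_two : M.pairState i v p = 2 ↔ M.len i v ≤ p + 1 := by
  unfold pairState; split_ifs <;> simp <;> omega

theorem pairState_congr {M' : AdjLists ι} (hl : M'.len i v = M.len i v)
    (h0 : M'.val i v p = M.val i v p) (h1 : M'.val i v (p + 1) = M.val i v (p + 1)) :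
    M'.pairState i v p = M.pairState i v p := by
  simp only [pairState, hl, h0, h1]

@[simp] theorem setPair_len {β : ℕ} : (M.setPair i v p β).len = M.len := by
  unfold setPair; split_ifs <;> rfl

theorem setPair_val_ne {β : ℕ} (h : i' ≠ i ∨ v' ≠ v) :
    (M.setPair i v p β).val i' v' = M.val i' v' := by
  unfold setPair; split_ifs
  · exact swap_val_ne h
  · rfl

theorem setPair_val_of_ne_ne {β : ℕ} (hp : r ≠ p) (hq : r ≠ p + 1) :
    (M.setPair i v p β).val i v r = M.val i v r := by
  unfold setPair; split_ifs
  · exact swap_val_of_ne_ne hp hq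
  · rfl

theorem bijOn_setPair {S : Set ℕ} {β : ℕ} (h : BijOn (M.val i' v') (Iio (M.len i' v')) S) :
    BijOn ((M.setPair i v p β).val i' v') (Iio (M.len i' v')) S := by
  unfold setPair
  split_ifs with hc
  · have : p + 1 < M.len i v := by
      by_contra hn
      rw [pairState, if_neg hn] at hc
      omega
    exact bijOn_swap h (by omega) this
  · exact h

/-- Disjoint pairs of positions carry independent bits. -/
theorem pairState_setPair_ne {β p' : ℕ}
    (h : i' ≠ i ∨ v' ≠ v ∨ p' + 1 < p ∨ p + 1 < p') :
    (M.setPair i v p β).pairState i' v' p' = M.pairState i' v' p' := by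
  by_cases hiv : i' = i ∧ v' = v
  · obtain ⟨rfl, rfl⟩ := hiv
    have h' : p' + 1 < p ∨ p + 1 < p' := by simpa using h
    apply pairState_congr (by simp)
    · exact setPair_val_of_ne_ne (by omega) (by omega)
    · exact setPair_val_of_ne_ne (by omega) (by omega)
  · have := setPair_val_ne (M := M) (i := i) (v := v) (p := p) (β := β) (i' := i') (v' := v')
      (by tauto)
    exact pairState_congr (by simp) (by rw [this]) (by rw [this])

/-- The values in a list are distinct, so exactly one order of the pair is increasing, and a swap
flips the bit. -/
theorem pairState_setPair {β : ℕ} (hβ : β ≤ 1) (hp : p + 1 < M.len i v)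
    (hinj : InjOn (M.val i v) (Iio (M.len i v))) :
    (M.setPair i v p β).pairState i v p = β := by
  have hne : M.val i v p ≠ M.val i v (p + 1) := by
    intro h
    have := hinj (show p < M.len i v by omega) hp h
    omega
  have h1 : ∀ N : AdjLists ι, N.len i v = M.len i v →
      N.pairState i v p = if N.val i v p < N.val i v (p + 1) then 1 else 0 := by
    intro N hN
    rw [pairState, if_pos (by omega)]
  unfold setPair
  split_ifs with hc
  · rw [h1 M rfl] at hc
    rw [h1 (M.swap i v p (p + 1)) rfl, swap_val_self, swap_val_self,
      Equiv.swap_apply_left, Equiv.swap_apply_right]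
    split_ifs at hc ⊢ <;> omega
  · rw [h1 _ rfl] at hc ⊢
    split_ifs at hc ⊢ <;> omega

end AdjLists

/-! ### Basic subroutines

They get their arguments in registers `16` and `17`, return their result in register `18`, and use
only word registers from `16` and pointer registers from `4` on. -/

namespace Code

variable {ι : Type}

/-- Let pointer `4` point to position `m` of the list `i` of the vertex in register `16`. -/
def nth (i : ι) : ℕ → Code ι
  | 0 => .instr (.head 4 i 16)
  | m + 1 => nth i m ;; .ite (.isNull 4) .skip (.instr (.next 4 4))

/-- Compute the bit at positions `p`, `p + 1` of the list `i` of the vertex in register `16`. -/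
def testPair (i : ι) (p : ℕ) : Code ι :=
  nth i p ;; .instr (.const 18 2) ;; .ite (.isNull 4) .skip
    (.instr (.next 5 4) ;; .ite (.isNull 5) .skip
      (.instr (.load 19 4) ;; .instr (.load 20 5) ;;
        .ite (.lt 19 20) (.instr (.const 18 1)) (.instr (.const 18 0))))

/-- Set the bit at positions `p`, `p + 1` of the list `i` of the vertex in register `16`. -/
def setPair (i : ι) (p β : ℕ) : Code ι :=
  testPair i p ;; .instr (.const 19 (1 - β)) ;; .ite (.eq 18 19) (.instr (.swap 4 5)) .skip

/-- Exchange the value in register `17` with the first value of the list `i` of the vertex in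
register `16`. -/
def toFront (i : ι) : Code ι :=
  scan i 16 5 20 (.instr (.load 19 5) ;; .ite (.eq 19 17) (.instr (.copyPtr 6 5)) .skip) ;;
    .instr (.head 4 i 16) ;; .instr (.swap 4 6)

end Code

section Basic

variable {ι : Type} {n w : ℕ} {σ : Mach ι}

/-- Past the end of the list the pointer stays null, in agreement with `nodeAt`. -/
theorem runs_nth {i : ι} (m : ℕ) (hv : σ.word 16 < n) :
    Runs n w (Code.nth i m) σ fun σ' t =>
      σ' = { σ with ptr := Function.update σ.ptr 4 (σ.mem.nodeAt i (σ.word 16) m) } ∧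
        t ≤ 2 * m + 1 := by
  induction m with
  | zero => rw [Code.nth, runs_head]; exact ⟨hv, rfl, le_rfl⟩
  | succ m ih =>
    refine ih.seq ?_
    rintro _ t ⟨rfl, ht⟩
    rw [runs_ite]
    by_cases h : m < σ.mem.len i (σ.word 16)
    · simp only [Cond.Holds, Function.update_self, AdjLists.nodeAt, if_pos h, reduceCtorEq,
        IsEmpty.forall_iff, not_false_eq_true, forall_const, true_and, runs_next,
        Option.some.injEq, Prod.mk.injEq]
      refine ⟨_, _, _, ⟨rfl, rfl, rfl⟩, ?_, by omega⟩
      simp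
    · simp only [Cond.Holds, Function.update_self, AdjLists.nodeAt, if_neg h, not_true_eq_false,
        IsEmpty.forall_iff, forall_const, and_true, runs_skip]
      refine ⟨?_, by omega⟩
      rw [if_neg (by omega)]

/-- The two pointers are left on the pair, so that `Code.setPair` can swap it without a second
search. -/
theorem runs_testPair {i : ι} {p v : ℕ} (hw : 2 < 2 ^ w) (h16 : σ.word 16 = v) (hv : v < n)
    (hval : ∀ r < σ.mem.len i v, σ.mem.val i v r < 2 ^ w) :
    Runs n w (Code.testPair i p) σ fun σ' t => Keeps 18 4 σ σ' ∧ σ'.mem = σ.mem ∧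
      σ'.word 18 = σ.mem.pairState i v p ∧ (p + 1 < σ.mem.len i v →
        σ'.ptr 4 = some (i, v, p) ∧ σ'.ptr 5 = some (i, v, p + 1)) ∧ t ≤ 2 * p + 10 := by
  subst h16
  refine (runs_nth p hv).seq ?_
  rintro _ t ⟨rfl, ht⟩
  have k0 := Keeps.refl (lo := 18) (plo := 4) σ
  have k1 := (k0.setPtr (x := 4) (a := σ.mem.nodeAt i (σ.word 16) p) (by decide)).setWord
    (x := 18) (a := 2) (by decide)
  rw [runs_seq, runs_const]
  refine ⟨hw, ?_⟩
  by_cases h : p < σ.mem.len i (σ.word 16)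
  swap
  · apply Runs.iteTrue (by simp [Cond.Holds, AdjLists.nodeAt, h])
    rw [runs_skip]
    refine ⟨k1, rfl, ?_, fun h => by omega, by omega⟩
    simp only [Function.update_self]
    exact (AdjLists.pairState_eq_two.2 (by omega)).symm
  have hp4 : σ.mem.nodeAt i (σ.word 16) p = some (i, σ.word 16, p) := by
    simp [AdjLists.nodeAt, h]
  apply Runs.iteFalse (by simp [Cond.Holds, hp4])
  rw [runs_seq, runs_next]
  refine ⟨i, σ.word 16, p, by simpa using hp4, ?_⟩
  have k2 := k1.setPtr (x := 5) (a := σ.mem.nodeAt i (σ.word 16) (p + 1)) (by decide)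
  by_cases h' : p + 1 < σ.mem.len i (σ.word 16)
  swap
  · apply Runs.iteTrue (by simp [Cond.Holds, AdjLists.nodeAt, h'])
    rw [runs_skip]
    refine ⟨k2, rfl, ?_, fun h => by omega, by omega⟩
    simp only [Function.update_self]
    exact (AdjLists.pairState_eq_two.2 (by omega)).symm
  have hp5 : σ.mem.nodeAt i (σ.word 16) (p + 1) = some (i, σ.word 16, p + 1) := by
    simp [AdjLists.nodeAt, h']
  apply Runs.iteFalse (by simp [Cond.Holds, hp5])
  rw [runs_seq, runs_load]
  refine ⟨i, σ.word 16, p, by simpa using hp4, hval _ h, ?_⟩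
  rw [runs_seq, runs_load]
  refine ⟨i, σ.word 16, p + 1, by simpa using hp5, hval _ h', ?_⟩
  have k3 := (k2.setWord (x := 19) (a := σ.mem.val i (σ.word 16) p) (by decide)).setWord (x := 20)
    (a := σ.mem.val i (σ.word 16) (p + 1)) (by decide)
  rw [runs_ite]
  constructor
  · intro hc
    rw [runs_const]
    refine ⟨by omega, k3.setWord (by decide), rfl, ?_, fun _ => ?_, by omega⟩
    · simp [Cond.Holds] at hc
      simp [AdjLists.pairState, h', hc]
    · simp [hp4, hp5]
  · intro hc
    rw [runs_const]
    refine ⟨by omega, k3.setWord (by decide), rfl, ?_, fun _ => ?_, by omega⟩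
    · simp [Cond.Holds] at hc
      simp [AdjLists.pairState, h', hc]
    · simp [hp4, hp5]

theorem runs_setPair {i : ι} {p v β : ℕ} (hw : 2 < 2 ^ w) (hβ : β ≤ 1) (h16 : σ.word 16 = v)
    (hv : v < n) (hval : ∀ r < σ.mem.len i v, σ.mem.val i v r < 2 ^ w) :
    Runs n w (Code.setPair i p β) σ fun σ' t => Keeps 18 4 σ σ' ∧
      σ'.mem = σ.mem.setPair i v p β ∧ t ≤ 2 * p + 13 := by
  refine (runs_testPair (p := p) hw h16 hv hval).seq ?_
  rintro σ₁ t ⟨hk, hm, h18, hp, ht⟩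
  rw [runs_seq, runs_const]
  refine ⟨by omega, ?_⟩
  have k1 := hk.setWord (x := 19) (a := 1 - β) (by decide)
  by_cases hc : σ.mem.pairState i v p = 1 - β
  · apply Runs.iteTrue (by simp [Cond.Holds, h18, hc])
    have hlen : p + 1 < σ.mem.len i v := by
      by_contra hn
      have := AdjLists.pairState_eq_two.2 (Nat.le_of_not_lt hn)
      omega
    obtain ⟨h4, h5⟩ := hp hlen
    refine Runs.swap (i := i) (v := v) (r := p) (r' := p + 1) h4 h5 ?_
    refine ⟨k1.setMem, ?_, by omega⟩
    simp [AdjLists.setPair, hc, hm]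
  · apply Runs.iteFalse (by simp [Cond.Holds, h18, hc])
    rw [runs_skip]
    refine ⟨k1, ?_, by omega⟩
    simp [AdjLists.setPair, hc, hm]

theorem runs_toFront {i : ι} {v r : ℕ} (hw : 2 < 2 ^ w) (h16 : σ.word 16 = v) (hv : v < n)
    (hval : ∀ r < σ.mem.len i v, σ.mem.val i v r < 2 ^ w) (h2 : σ.word 2 = 1)
    (hinj : InjOn (σ.mem.val i v) (Iio (σ.mem.len i v))) (hr : r < σ.mem.len i v)
    (h17 : σ.word 17 = σ.mem.val i v r) :
    Runs n w (Code.toFront i) σ fun σ' t => Keeps 18 4 σ σ' ∧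
      σ'.mem = σ.mem.swap i v 0 r ∧ t ≤ 8 * σ.mem.len i v + 6 := by
  let I : ℕ → Mach ι → ℕ → Prop := fun m σ' τ => Keeps 18 4 σ σ' ∧ σ'.mem = σ.mem ∧
    (r < m → σ'.ptr 6 = some (i, v, r)) ∧ τ ≤ 8 * m + 3
  let J : Mach ι → ℕ → Prop := fun σ' τ => Keeps 18 4 σ σ' ∧ σ'.mem = σ.mem ∧
    σ'.ptr 6 = some (i, v, r) ∧ τ ≤ 8 * σ.mem.len i v + 4
  refine (runs_scan (J := J) v (σ.mem.len i v) I (lt_trans one_lt_two hw) (by decide) h16 hv h2 rfl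
    ?_ ?_ ?_ ?_).seq ?_
  · rintro m σ' τ a c ⟨hk, hm, h6, hτ⟩
    exact ⟨(hk.setPtr (by decide)).setWord (by decide), hm, by simpa using h6, hτ⟩
  · exact ⟨Keeps.refl _, rfl, by simp, by simp⟩
  · rintro m hm σ' τ ⟨hk, hmem, h6, hτ⟩ h5 hf h2' hlen
    rw [runs_seq, runs_load]
    refine ⟨i, v, m, h5, by rw [hmem]; exact hval _ hm, ?_⟩
    have h17' : σ'.word 17 = σ.mem.val i v r := by rw [hk.word 17 (by decide), h17]
    have k1 := hk.setWord (x := 19) (a := σ'.mem.val i v m) (by decide)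
    by_cases hc : m = r
    · apply Runs.iteTrue (by simp [Cond.Holds, h17', hmem, hc])
      rw [runs_copyPtr]
      refine ⟨by simpa, hlen, Or.inl ⟨by simpa using h5, by simpa using hf,
        k1.setPtr (by decide), hmem, fun _ => ?_, by omega⟩⟩
      simp [h5, hc]
    · apply Runs.iteFalse
      · simp only [Cond.Holds, Function.update_self, hmem]
        intro h
        rw [Function.update_of_ne (by decide), h17'] at h
        exact hc (hinj hm hr h)
      rw [runs_skip]
      refine ⟨by simpa, hlen, Or.inl ⟨by simpa using h5, by simpa using hf,
        k1, hmem, fun hrm => h6 (by omega), by omega⟩⟩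
  · rintro σ' τ ⟨hk, hm, h6, hτ⟩
    exact ⟨hk, hm, h6 hr, by omega⟩
  · rintro σ' τ ⟨hk, hm, h6, hτ⟩
    rw [runs_seq, runs_head, hk.word 16 (by decide), h16]
    refine ⟨hv, ?_⟩
    refine Runs.swap (i := i) (v := v) (r := 0) (r' := r) ?_ (by simpa using h6) ?_
    · simp only [Function.update_self, hm, AdjLists.nodeAt]
      rw [if_pos (by omega)]
    · refine ⟨(hk.setPtr (by decide)).setMem, by rw [← hm], by omega⟩

end Basic

/-! ### Rearranged adjacency lists and distances. -/

/-- The adjacency lists `a` (successors) and `b` (predecessors) of a graph on `{0, …, n - 1}` with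
edge relation `E`, in which `δ` gives the distances from the source `s`. -/
structure Layout {ι : Type} (A : AdjLists ι) (a b : ι) (n s : ℕ) (E : ℕ → ℕ → Prop)
    (δ : ℕ → ℕ) : Prop where
  source_lt : s < n
  edge_lt : ∀ {u v}, E u v → u < n ∧ v < n
  out : ∀ u < n, BijOn (A.val a u) (Iio (A.len a u)) {v | E u v}
  inn : ∀ v < n, BijOn (A.val b v) (Iio (A.len b v)) {u | E u v}
  dist_source : δ s = 0
  dist_edge : ∀ {u v}, E u v → δ v ≤ δ u + 1
  dist_pred : ∀ v < n, v ≠ s → ∃ u, E u v ∧ δ v = δ u + 1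

/-- The lists `M` arise from `A` by permuting the values within each list. -/
structure Arranged {ι : Type} (A M : AdjLists ι) (a b : ι) (n : ℕ) (E : ℕ → ℕ → Prop) :
    Prop where
  len : M.len = A.len
  out : ∀ u < n, BijOn (M.val a u) (Iio (A.len a u)) {v | E u v}
  inn : ∀ v < n, BijOn (M.val b v) (Iio (A.len b v)) {u | E u v}

section Layout

variable {ι : Type} {A M : AdjLists ι} {a b : ι} {n s : ℕ} {E : ℕ → ℕ → Prop} {δ : ℕ → ℕ}

theorem Layout.arranged (L : Layout A a b n s E δ) : Arranged A A a b n E := ⟨rfl, L.out, L.inn⟩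

theorem Layout.eq_source (L : Layout A a b n s E δ) {v : ℕ} (hv : v < n) (h : δ v = 0) :
    v = s := by
  by_contra hne
  obtain ⟨u, -, hu⟩ := L.dist_pred v hv hne
  omega

theorem Layout.len_pos (L : Layout A a b n s E δ) {v : ℕ} (hv : v < n) (hs : v ≠ s) :
    0 < A.len b v := by
  obtain ⟨u, hu, -⟩ := L.dist_pred v hv hs
  obtain ⟨p, hp, -⟩ := (L.inn v hv).surjOn hu
  exact (Nat.zero_le p).trans_lt hp

/-- Going back along predecessors, all the distances `0, …, δ v` occur, so there are at least `δ v +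
1` vertices. -/
theorem Layout.dist_lt (L : Layout A a b n s E δ) {v : ℕ} (hv : v < n) : δ v < n := by
  have key : ∀ m, ∀ v < n, δ v = m → Finset.range (m + 1) ⊆ (Finset.range n).image δ := by
    intro m
    induction m with
    | zero =>
      intro v hv h k hk
      have : k = 0 := by simpa using hk
      exact Finset.mem_image.2 ⟨v, by simpa using hv, by omega⟩
    | succ m ih =>
      intro v hv h k hk
      have hs : v ≠ s := by rintro rfl; rw [L.dist_source] at h; omega
      obtain ⟨u, hu, hd⟩ := L.dist_pred v hv hs
      rcases Nat.lt_succ_iff_lt_or_eq.1 (Finset.mem_range.1 hk) with h' | rfl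
      · exact ih u (L.edge_lt hu).1 (by omega) (Finset.mem_range.2 h')
      · exact Finset.mem_image.2 ⟨v, by simpa using hv, h⟩
  have := Finset.card_le_card (key _ v hv rfl)
  have h2 := Finset.card_image_le (s := Finset.range n) (f := δ)
  simp only [Finset.card_range] at this h2
  omega

theorem Arranged.out_mem (R : Arranged A M a b n E) {u p : ℕ} (hu : u < n)
    (hp : p < M.len a u) : E u (M.val a u p) :=
  (R.out u hu).mapsTo (show p < A.len a u by rwa [← R.len])

theorem Arranged.inn_mem (R : Arranged A M a b n E) {v p : ℕ} (hv : v < n)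
    (hp : p < M.len b v) : E (M.val b v p) v :=
  (R.inn v hv).mapsTo (show p < A.len b v by rwa [← R.len])

theorem Arranged.out_inj (R : Arranged A M a b n E) {u : ℕ} (hu : u < n) :
    InjOn (M.val a u) (Iio (M.len a u)) := by
  rw [R.len]; exact (R.out u hu).injOn

theorem Arranged.inn_inj (R : Arranged A M a b n E) {u : ℕ} (hu : u < n) :
    InjOn (M.val b u) (Iio (M.len b u)) := by
  rw [R.len]; exact (R.inn u hu).injOn

theorem Arranged.out_val_lt (R : Arranged A M a b n E) (L : Layout A a b n s E δ) {u p : ℕ}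
    (hu : u < n) (hp : p < M.len a u) : M.val a u p < n :=
  (L.edge_lt (R.out_mem hu hp)).2

theorem Arranged.inn_val_lt (R : Arranged A M a b n E) (L : Layout A a b n s E δ) {v p : ℕ}
    (hv : v < n) (hp : p < M.len b v) : M.val b v p < n :=
  (L.edge_lt (R.inn_mem hv hp)).1

theorem Arranged.swap (R : Arranged A M a b n E) {i : ι} {v p q : ℕ} (hp : p < M.len i v)
    (hq : q < M.len i v) : Arranged A (M.swap i v p q) a b n E where
  len := R.len
  out u hu := by
    have := R.out u hu
    rw [← R.len] at this ⊢
    exact AdjLists.bijOn_swap this hp hq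
  inn u hu := by
    have := R.inn u hu
    rw [← R.len] at this ⊢
    exact AdjLists.bijOn_swap this hp hq

theorem Arranged.setPair (R : Arranged A M a b n E) {i : ι} {v p β : ℕ} :
    Arranged A (M.setPair i v p β) a b n E where
  len := by rw [AdjLists.setPair_len, R.len]
  out u hu := by
    have := R.out u hu
    rw [← R.len] at this ⊢
    exact AdjLists.bijOn_setPair this
  inn u hu := by
    have := R.inn u hu
    rw [← R.len] at this ⊢
    exact AdjLists.bijOn_setPair this

open Classical in
-- Costs arise node by node during a traversal. Turning them into sums over vertices makes double
-- counting of edges possible, and does not depend on the present order of the list.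
theorem sum_positions {f : ℕ → ℕ} {N : ℕ} {S : Set ℕ} (h : BijOn f (Iio N) S)
    (hS : ∀ v ∈ S, v < n) (g : ℕ → ℕ) :
    ∑ q ∈ Finset.range N, g (f q) = ∑ v ∈ Finset.range n, if v ∈ S then g v else 0 := by
  rw [← Finset.sum_filter]
  refine Finset.sum_bij (fun q _ => f q) ?_ ?_ ?_ fun _ _ => rfl
  · intro q hq
    have : f q ∈ S := h.mapsTo (Finset.mem_range.1 hq)
    simp [this, hS _ this]
  · intro q hq q' hq' he
    exact h.injOn (Finset.mem_range.1 hq) (Finset.mem_range.1 hq') he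
  · intro v hv
    obtain ⟨q, hq, he⟩ := h.surjOn (Finset.mem_filter.1 hv).2
    exact ⟨q, Finset.mem_range.2 hq, he⟩

end Layout

/-! ### Distances from parent pointers

The parent of a vertex in the search tree is stored at the front of its list `b`. -/

/-- Register `0` contains the number of vertices, register `1` the source, register `2` the
constant one, and the registers `7` and `3` contain `d` and `d + 1`. -/
structure Globals {ι : Type} (n s d : ℕ) (σ : Mach ι) : Prop where
  w0 : σ.word 0 = n
  w1 : σ.word 1 = s
  w2 : σ.word 2 = 1
  w3 : σ.word 3 = d + 1
  w7 : σ.word 7 = d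

theorem Globals.keep {ι : Type} {n s d lo plo : ℕ} {σ σ' : Mach ι} (h : Globals n s d σ)
    (hk : Keeps lo plo σ σ') (hlo : 8 ≤ lo := by decide) : Globals n s d σ' := by
  have : ∀ x : Fin 24, x.val < 8 → σ'.word x = σ.word x := fun x hx => hk.word x (by omega)
  exact ⟨by rw [this 0 (by decide), h.w0], by rw [this 1 (by decide), h.w1],
    by rw [this 2 (by decide), h.w2], by rw [this 3 (by decide), h.w3],
    by rw [this 7 (by decide), h.w7]⟩

/-- Follow the parent pointers from the vertex in register `16` for at most as many steps as
register `3` says; count the steps until the source is reached. -/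
def Code.walk {ι : Type} (b : ι) : Code ι :=
  .instr (.const 18 0) ;; .instr (.const 19 0) ;;
    .loop (.lt 19 3) (.ite (.eq 16 1) .skip
      (.instr (.head 4 b 16) ;; .instr (.load 16 4) ;; .instr (.op .add 18 18 2)) ;;
      .instr (.op .add 19 19 2))

section Walk

variable {ι : Type} {A : AdjLists ι} {a b : ι} {n s w d : ℕ} {E : ℕ → ℕ → Prop} {δ : ℕ → ℕ}

/-- If `δ y ≤ d`, all parents on the way are correct and the source is reached after exactly `δ y`
steps. Otherwise the walk may follow arbitrary front values, but each of them is a predecessor and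
so lies at most one level higher. Hence the source cannot be reached in fewer than `δ y` steps, and
the count is `d + 1` when the loop ends. -/
theorem runs_walk (L : Layout A a b n s E δ) {σ : Mach ι} {y : ℕ} (hw : 16 * n + 16 ≤ 2 ^ w)
    (hg : Globals n s d σ) (hd : d < n) (hR : Arranged A σ.mem a b n E)
    (hpar : ∀ y < n, y ≠ s → δ y ≤ d → δ (σ.mem.val b y 0) + 1 = δ y)
    (h16 : σ.word 16 = y) (hy : y < n) :
    Runs n w (Code.walk b) σ fun σ' t => Keeps 16 4 σ σ' ∧ σ'.mem = σ.mem ∧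
      σ'.word 18 = min (δ y) (d + 1) ∧ t ≤ 6 * d + 9 := by
  rw [Code.walk, runs_seq, runs_const]
  refine ⟨by omega, ?_⟩
  rw [runs_seq, runs_const]
  refine ⟨by omega, ?_⟩
  let I : ℕ → Mach ι → ℕ → Prop := fun r σ' τ => Keeps 16 4 σ σ' ∧ σ'.mem = σ.mem ∧
    σ'.word 19 = r ∧ τ ≤ 6 * r ∧ σ'.word 16 < n ∧ σ'.word 18 ≤ r ∧
    δ y ≤ σ'.word 18 + δ (σ'.word 16) ∧ (δ y ≤ d → σ'.word 18 + δ (σ'.word 16) = δ y) ∧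
    (σ'.word 16 = s ∨ σ'.word 18 = r)
  refine (Runs.count (d + 1) I ?_ ?_ ?_).mono ?_
  · refine ⟨((Keeps.refl _).setWord (by decide)).setWord (by decide), rfl, ?_⟩
    simp [h16, hy]
  · rintro r hr σ' τ ⟨hk, hm, h19, hτ, hz, h18, hle, heq, hor⟩
    have hg' := hg.keep hk
    refine ⟨by simpa [Cond.Holds, h19, hg'.w3] using hr, ?_⟩
    rw [runs_seq, runs_ite]
    constructor
    · intro hs
      rw [runs_skip, runs_op]
      simp only [Cond.Holds, hg'.w1] at hs
      refine ⟨by simp [WordOp.eval, h19, hg'.w2]; omega, hk.setWord (by decide), hm, ?_⟩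
      simp only [Function.update_self, WordOp.eval, hg'.w2, h19]
      simp [hs] at *
      omega
    · intro hs
      simp only [Cond.Holds, hg'.w1] at hs
      have hlen : 0 < σ'.mem.len b (σ'.word 16) := by
        rw [hm, hR.len]; exact L.len_pos hz hs
      have hnode : σ'.mem.nodeAt b (σ'.word 16) 0 = some (b, σ'.word 16, 0) := by
        simp [AdjLists.nodeAt, hlen]
      have hR' : Arranged A σ'.mem a b n E := hm ▸ hR
      have hE := hR'.inn_mem hz hlen
      have hlt := hR'.inn_val_lt L hz hlen
      have hde := L.dist_edge hE
      rw [runs_seq, runs_head]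
      refine ⟨hz, ?_⟩
      rw [runs_seq, runs_load]
      refine ⟨b, σ'.word 16, 0, by simpa using hnode, by simp only; omega, ?_⟩
      rw [runs_op]
      refine ⟨by simp [WordOp.eval, hg'.w2]; omega, ?_⟩
      rw [runs_op]
      refine ⟨by simp [WordOp.eval, hg'.w2, h19]; omega, ?_⟩
      refine ⟨(((hk.setPtr (by decide)).setWord (by decide)).setWord (by decide)).setWord
        (by decide), hm, ?_⟩
      have hpar' := hpar _ hz hs
      rw [← hm] at hpar'
      simp [WordOp.eval, hg'.w2, h19]
      omega
  · rintro σ' τ ⟨hk, hm, h19, -⟩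
    simp [Cond.Holds, h19, (hg.keep hk).w3]
  · rintro σ' t ⟨t₁, rfl, hk, hm, h19, hτ, hz, h18, hle, heq, hor⟩
    refine ⟨hk, hm, ?_, by omega⟩
    rcases hor with h | h
    · rw [h, L.dist_source] at hle heq
      omega
    · omega

end Walk

/-! ### Expanding a vertex

The bit at positions `3`, `4` of the list `b` of a vertex tells whether the vertex has been
discovered, and the bit at positions `off`, `off + 1` of the list `a` whether it is active. -/

/-- Make the vertex in register `17` the parent of the vertex in register `16`, and mark the latter
as discovered and active. -/
def Code.adopt {ι : Type} (a b : ι) (off : ℕ) : Code ι :=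
  Code.toFront b ;; Code.setPair b 3 1 ;; Code.setPair a off 1

/-- The successors of the vertex in register `13` that have not been discovered become its
children. -/
def Code.expand {ι : Type} (a b : ι) (off : ℕ) : Code ι :=
  Code.scan a 13 2 15 (.instr (.load 14 2) ;; .ite (.eq 14 1) .skip
    (.instr (.copy 16 14) ;; .instr (.copy 17 13) ;; Code.testPair b 3 ;; .instr (.const 21 0) ;;
      .ite (.eq 18 21) (Code.adopt a b off) (.ite (.eq 18 2) .skip
        (Code.walk b ;; .ite (.lt 18 3) .skip
          (.instr (.copy 16 14) ;; .instr (.copy 17 13) ;; Code.adopt a b off)))))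

/-- `M'` results from `M` by making `x` the parent of `v`. -/
structure Adopted {ι : Type} (A M M' : AdjLists ι) (a b : ι) (off n : ℕ) (E : ℕ → ℕ → Prop)
    (v x : ℕ) : Prop where
  arranged : Arranged A M' a b n E
  other : ∀ u, u ≠ v → ∀ i, M'.val i u = M.val i u
  parent : M'.val b v 0 = x
  found : 5 ≤ A.len b v → M'.pairState b v 3 = 1
  active : off + 1 < A.len a v → M'.pairState a v off = 1

/-- The state of the search while the vertices at distance `d` are being expanded: the edges to
the vertices in `T` have been treated. -/
structure Searching {ι : Type} (A M : AdjLists ι) (a b : ι) (off n s : ℕ) (E : ℕ → ℕ → Prop)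
    (δ : ℕ → ℕ) (d : ℕ) (T : ℕ → Prop) : Prop where
  arranged : Arranged A M a b n E
  parent : ∀ v < n, v ≠ s → δ v ≤ d ∨ T v → δ (M.val b v 0) + 1 = δ v
  found : ∀ v < n, v ≠ s → 5 ≤ A.len b v → (M.pairState b v 3 = 1 ↔ δ v ≤ d ∨ T v)
  active : ∀ v < n, v ≠ s → off + 1 < A.len a v → T v → δ v = d + 1 → M.pairState a v off = 1
  quiet : ∀ v < n, v ≠ s → d < δ v → M.pairState a v off = 1 → T v

/-- The lists of the vertices up to distance `d` agree. -/
def SameUpTo {ι : Type} (δ : ℕ → ℕ) (d : ℕ) (M M' : AdjLists ι) : Prop :=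
  ∀ v, δ v ≤ d → ∀ i, M'.val i v = M.val i v

/-- The number of nodes in the lists `b` of the undiscovered vertices. -/
def AdjLists.potential {ι : Type} (M : AdjLists ι) (b : ι) (n : ℕ) : ℕ :=
  ∑ v ∈ Finset.range n, if M.pairState b v 3 = 0 then M.len b v else 0

open Classical in
/-- Bound on the time to expand `x` at level `d`. -/
noncomputable def expandCost {ι : Type} (A : AdjLists ι) (b : ι) (n : ℕ) (E : ℕ → ℕ → Prop)
    (d x : ℕ) : ℕ :=
  ∑ v ∈ Finset.range n, (if E x v then (if A.len b v < 5 then 6 * d + 200 else 200) else 0) + 4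

section Expand

variable {ι : Type} {A M M' : AdjLists ι} {a b : ι} {off n s w d : ℕ} {E : ℕ → ℕ → Prop}
  {δ : ℕ → ℕ} {T : ℕ → Prop}

theorem SameUpTo.refl : SameUpTo δ d M M := fun _ _ _ => rfl

theorem SameUpTo.trans {M'' : AdjLists ι} (h : SameUpTo δ d M M') (h' : SameUpTo δ d M' M'') :
    SameUpTo δ d M M'' := fun v hv i => (h' v hv i).trans (h v hv i)

theorem Adopted.pairState {v x : ℕ} (h : Adopted A M M' a b off n E v x)
    (hR : Arranged A M a b n E) {u : ℕ} (hu : u ≠ v) (i : ι) (p : ℕ) :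
    M'.pairState i u p = M.pairState i u p :=
  AdjLists.pairState_congr (by rw [h.arranged.len, hR.len]) (by rw [h.other u hu])
    (by rw [h.other u hu])

/-- The list of an adopted vertex leaves the potential; this pays for searching it for the parent.
Lists too short for a discovery bit have state `2` and never count. -/
theorem Adopted.potential {v x : ℕ} (h : Adopted A M M' a b off n E v x)
    (hR : Arranged A M a b n E) (hv : v < n) :
    M'.potential b n + (if M.pairState b v 3 = 0 then A.len b v else 0) = M.potential b n := by
  have hmem : v ∈ Finset.range n := Finset.mem_range.2 hv
  rw [AdjLists.potential, AdjLists.potential, ← Finset.add_sum_erase _ _ hmem,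
    ← Finset.add_sum_erase _ _ hmem]
  have h1 : M'.pairState b v 3 ≠ 0 := by
    intro h0
    have : 5 ≤ A.len b v := by
      by_contra hn
      have : M'.pairState b v 3 = 2 := AdjLists.pairState_eq_two.2 (by rw [h.arranged.len]; omega)
      omega
    have := h.found this
    omega
  rw [if_neg h1, hR.len]
  have h2 : ∀ u ∈ (Finset.range n).erase v,
      (if M'.pairState b u 3 = 0 then M'.len b u else 0) =
        if M.pairState b u 3 = 0 then A.len b u else 0 := by
    intro u hu
    rw [h.pairState hR (Finset.ne_of_mem_erase hu), h.arranged.len]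
  rw [Finset.sum_congr rfl h2]
  omega

theorem Searching.adopt (L : Layout A a b n s E δ) (h : Searching A M a b off n s E δ d T)
    {v x : ℕ} (hx : δ x = d) (hv : δ v = d + 1) (ha : Adopted A M M' a b off n E v x) :
    Searching A M' a b off n s E δ d fun u => T u ∨ u = v := by
  have hvs : v ≠ s := by rintro rfl; rw [L.dist_source] at hv; omega
  refine ⟨ha.arranged, fun u hu hus hd => ?_, fun u hu hus hl => ?_, fun u hu hus hl hT hd => ?_,
    fun u hu hus hd hact => ?_⟩
  · by_cases huv : u = v
    · rw [huv, ha.parent, hx, hv]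
    · rw [ha.other u huv]
      exact h.parent u hu hus (by tauto)
  · by_cases huv : u = v
    · subst huv
      simp [ha.found hl]
    · rw [ha.pairState h.arranged huv, h.found u hu hus hl]
      tauto
  · by_cases huv : u = v
    · subst huv
      exact ha.active hl
    · rw [ha.pairState h.arranged huv]
      exact h.active u hu hus hl (by tauto) hd
  · by_cases huv : u = v
    · exact Or.inr huv
    · rw [ha.pairState h.arranged huv] at hact
      exact Or.inl (h.quiet u hu hus hd hact)

/-- Edges to the source or to levels up to `d` have no effect on the search, so their endpoints may
be added to `T` freely. -/
theorem Searching.congr {T' : ℕ → Prop} (h : Searching A M a b off n s E δ d T)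
    (hT : ∀ u < n, u ≠ s → (T' u ↔ T u ∨ (T' u ∧ δ u ≤ d))) :
    Searching A M a b off n s E δ d T' := by
  refine ⟨h.arranged, fun u hu hus hd => ?_, fun u hu hus hl => ?_, fun u hu hus hl hT' hd => ?_,
    fun u hu hus hd hact => ?_⟩
  · have := hT u hu hus
    exact h.parent u hu hus (by tauto)
  · have := hT u hu hus
    rw [h.found u hu hus hl]
    tauto
  · have := (hT u hu hus).1 hT'
    exact h.active u hu hus hl (this.resolve_right fun h => by omega) hd
  · exact (hT u hu hus).2 (Or.inl (h.quiet u hu hus hd hact))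

/-- Moving the parent to the front may displace values that belong to either bit of `v`, so both
bits are written afterwards. By `hoff` the front, the discovery pair and the activity pair do not
overlap, so the later writes preserve what is already stored. -/
theorem runs_adopt (hoff : a ≠ b ∧ off = 0 ∨ a = b ∧ off = 1) (L : Layout A a b n s E δ)
    {σ : Mach ι} {v x : ℕ} (hw : 16 * n + 16 ≤ 2 ^ w) (hR : Arranged A σ.mem a b n E)
    (h16 : σ.word 16 = v) (h17 : σ.word 17 = x) (h2 : σ.word 2 = 1) (hE : E x v) :
    Runs n w (Code.adopt a b off) σ fun σ' t => Keeps 18 4 σ σ' ∧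
      Adopted A σ.mem σ'.mem a b off n E v x ∧ t ≤ 8 * A.len b v + 40 := by
  have hv := (L.edge_lt hE).2
  have valb : ∀ {M : AdjLists ι}, Arranged A M a b n E → ∀ r < M.len b v, M.val b v r < 2 ^ w := by
    intro M hM r hr
    have := hM.inn_val_lt L hv hr
    omega
  have vala : ∀ {M : AdjLists ι}, Arranged A M a b n E → ∀ r < M.len a v, M.val a v r < 2 ^ w := by
    intro M hM r hr
    have := hM.out_val_lt L hv hr
    omega
  obtain ⟨r, hr, hrx⟩ := (hR.inn v hv).surjOn hE
  have hr : r < σ.mem.len b v := by rw [hR.len]; exact hr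
  refine (runs_toFront (i := b) (by omega) h16 hv (valb hR) h2 (hR.inn_inj hv) hr
    (h17.trans hrx.symm)).seq ?_
  rintro σ₁ t₁ ⟨hk₁, hm₁, ht₁⟩
  have hR₁ : Arranged A σ₁.mem a b n E := by rw [hm₁]; exact hR.swap (by omega) hr
  refine (runs_setPair (i := b) (p := 3) (β := 1) (by omega) le_rfl
    ((hk₁.word 16 (by decide)).trans h16) hv (valb hR₁)).seq ?_
  rintro σ₂ t₂ ⟨hk₂, hm₂, ht₂⟩
  have hR₂ : Arranged A σ₂.mem a b n E := by rw [hm₂]; exact hR₁.setPair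
  have hk₁₂ := hk₁.trans hk₂
  refine (runs_setPair (i := a) (p := off) (β := 1) (by omega) le_rfl
    ((hk₁₂.word 16 (by decide)).trans h16) hv (vala hR₂)).mono ?_
  rintro σ₃ t₃ ⟨hk₃, hm₃, ht₃⟩
  have hR₃ : Arranged A σ₃.mem a b n E := by rw [hm₃]; exact hR₂.setPair
  refine ⟨hk₁₂.trans hk₃, ⟨hR₃, fun u hu i => ?_, ?_, fun hl => ?_, fun hl => ?_⟩, ?_⟩
  · rw [hm₃, AdjLists.setPair_val_ne (Or.inr hu), hm₂, AdjLists.setPair_val_ne (Or.inr hu), hm₁,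
      AdjLists.swap_val_ne (Or.inr hu)]
  · have h3 : σ₃.mem.val b v 0 = σ₂.mem.val b v 0 := by
      rw [hm₃]
      rcases hoff with ⟨hab, -⟩ | ⟨hab, h1⟩
      · rw [AdjLists.setPair_val_ne (Or.inl hab.symm)]
      · rw [hab, AdjLists.setPair_val_of_ne_ne (by omega) (by omega)]
    rw [h3, hm₂, AdjLists.setPair_val_of_ne_ne (by omega) (by omega), hm₁, AdjLists.swap_val_self,
      Equiv.swap_apply_left, hrx]
  · have h3 : σ₃.mem.pairState b v 3 = σ₂.mem.pairState b v 3 := by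
      rw [hm₃]
      apply AdjLists.pairState_setPair_ne
      rcases hoff with ⟨hab, -⟩ | ⟨hab, h1⟩
      · exact Or.inl hab.symm
      · omega
    rw [h3, hm₂]
    exact AdjLists.pairState_setPair le_rfl (by rw [hR₁.len]; omega) (hR₁.inn_inj hv)
  · rw [hm₃]
    exact AdjLists.pairState_setPair le_rfl (by rw [hR₂.len]; omega) (hR₂.out_inj hv)
  · rw [hR.len] at ht₁
    omega

/-- The discovery bit decides at once for predecessor lists with at least five nodes, and an
adoption is then paid for by the potential. Only shorter lists need a walk, whose cost `6 * d`
enters `expandCost`. All adopted vertices have level `d + 1`, which is why the lists up to level `d`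
stay as they are. -/
theorem runs_expand (hoff : a ≠ b ∧ off = 0 ∨ a = b ∧ off = 1) (L : Layout A a b n s E δ)
    {σ : Mach ι} {x : ℕ} (hw : 16 * n + 16 ≤ 2 ^ w) (hg : Globals n s d σ)
    (hS : Searching A σ.mem a b off n s E δ d T) (h13 : σ.word 13 = x) (hx : x < n)
    (hxd : δ x = d) :
    Runs n w (Code.expand a b off) σ fun σ' t => Keeps 13 2 σ σ' ∧
      Searching A σ'.mem a b off n s E δ d (fun v => T v ∨ E x v) ∧
      SameUpTo δ d σ.mem σ'.mem ∧
      t + 8 * σ'.mem.potential b n ≤ 8 * σ.mem.potential b n + expandCost A b n E d x := by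
  have hdn : d < n := hxd ▸ L.dist_lt hx
  set N := σ.mem.len a x with hN
  let c : ℕ → ℕ := fun v => if A.len b v < 5 then 6 * d + 200 else 200
  let F : ℕ → ℕ := fun r => ∑ q ∈ Finset.range r, c (σ.mem.val a x q)
  let I : ℕ → Mach ι → ℕ → Prop := fun r σ' τ => Keeps 14 2 σ σ' ∧
    Searching A σ'.mem a b off n s E δ d (fun v => T v ∨ ∃ q < r, σ.mem.val a x q = v) ∧
    SameUpTo δ d σ.mem σ'.mem ∧
    τ + 8 * σ'.mem.potential b n ≤ 8 * σ.mem.potential b n + F r + 3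
  let J : Mach ι → ℕ → Prop := fun σ' τ => ∃ τ', τ = τ' + 1 ∧ I N σ' τ'
  refine (runs_scan (J := J) x N I (by omega) (by decide) h13 hx hg.w2 rfl ?_ ?_ ?_ ?_).mono ?_
  · rintro r σ' τ p f ⟨hk, hs, hu, ht⟩
    exact ⟨(hk.setPtr (by decide)).setWord (by decide), hs, hu, ht⟩
  · refine ⟨Keeps.refl _, ?_, SameUpTo.refl, by simp [F]; omega⟩
    exact hS.congr fun u _ _ => by simp; tauto
  · rintro r hr σ₁ τ ⟨hk, hs, hu, hτ⟩ hp hf h2 hlen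
    have hg₁ := hg.keep hk
    set v := σ.mem.val a x r with hv
    have hv₁ : σ₁.mem.val a x r = v := by rw [hu x hxd.le]
    have hE : E x v := hS.arranged.out_mem hx hr
    have hvn := (L.edge_lt hE).2
    have hde := L.dist_edge hE
    have hF : F (r + 1) = F r + c v := Finset.sum_range_succ _ _
    have hc : 200 ≤ c v := by simp only [c]; split_ifs <;> omega
    -- the invariant after an iteration that changes nothing, or makes `x` the parent of `v`
    have skipped : (δ v ≤ d ∨ (v ≠ s → T v ∨ ∃ q < r, σ.mem.val a x q = v)) →
        Searching A σ₁.mem a b off n s E δ d (fun v => T v ∨ ∃ q < r + 1, σ.mem.val a x q = v) := by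
      intro h
      refine hs.congr fun u _ hus => ?_
      simp only [Nat.lt_succ_iff_lt_or_eq]
      constructor
      · rintro (h1 | ⟨q, h1 | rfl, h2⟩)
        · exact Or.inl (Or.inl h1)
        · exact Or.inl (Or.inr ⟨q, h1, h2⟩)
        · rw [← hv] at h2
          subst h2
          rcases h with h | h
          · exact Or.inr ⟨Or.inr ⟨q, Or.inr rfl, rfl⟩, h⟩
          · exact Or.inl (h hus)
      · rintro ((h1 | ⟨q, h1, h2⟩) | ⟨h1, -⟩)
        · exact Or.inl h1
        · exact Or.inr ⟨q, Or.inl h1, h2⟩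
        · exact h1
    have adopted : ∀ σ₂ : Mach ι, ∀ t, δ v = d + 1 → Keeps 14 2 σ σ₂ → σ₂.word 15 = 1 →
        σ₂.ptr 2 = some (a, x, r) → σ₂.mem = σ₁.mem → σ₂.word 16 = v → σ₂.word 17 = x →
        (t + (if σ₁.mem.pairState b v 3 = 0 then 0 else 8 * A.len b v) + 45 ≤ c v) →
        Runs n w (Code.adopt a b off) σ₂ fun σ' t' => σ'.word 2 = 1 ∧ σ'.mem.len a x = N ∧
          ((σ'.ptr 2 = some (a, x, r) ∧ σ'.word 15 = 1 ∧ I (r + 1) σ' (τ + (t + t') + 5)) ∨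
          (σ'.word 15 ≠ 1 ∧ J σ' (τ + (t + t') + 3))) := by
      intro σ₂ t hvd hk₂ h15 hp2 hm2 h16 h17 hle
      refine (runs_adopt hoff L hw (hm2 ▸ hs.arranged) h16 h17 (hg.keep hk₂).w2 hE).mono ?_
      rintro σ₃ t₃ ⟨hk₃, ha, ht₃⟩
      rw [hm2] at ha
      refine ⟨(hg.keep (hk₂.trans (hk₃.mono (by decide) (by decide)))).w2, ?_, Or.inl ⟨?_, ?_, ?_⟩⟩
      · rw [ha.arranged.len, hN, hS.arranged.len]
      · rw [hk₃.ptr 2 (by decide), hp2]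
      · rw [hk₃.word 15 (by decide), h15]
      · refine ⟨hk₂.trans (hk₃.mono (by decide) (by decide)), ?_, ?_, ?_⟩
        · refine (hs.adopt L hxd hvd ha).congr fun u _ _ => ?_
          simp only [Nat.lt_succ_iff_lt_or_eq]
          constructor
          · rintro (h1 | ⟨q, h1 | rfl, h2⟩)
            · exact Or.inl (Or.inl (Or.inl h1))
            · exact Or.inl (Or.inl (Or.inr ⟨q, h1, h2⟩))
            · exact Or.inl (Or.inr h2.symm)
          · rintro (((h1 | ⟨q, h1, h2⟩) | h1) | ⟨h1, -⟩)
            · exact Or.inl h1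
            · exact Or.inr ⟨q, Or.inl h1, h2⟩
            · exact Or.inr ⟨r, Or.inr rfl, h1.symm⟩
            · exact h1
        · refine hu.trans fun u hud i => ha.other u ?_ i
          rintro rfl
          omega
        · have := ha.potential hs.arranged hvn
          rw [hF]
          split_ifs at this hle <;> omega
    have nochange : ∀ σ₂ : Mach ι, ∀ t,
        (δ v ≤ d ∨ (v ≠ s → T v ∨ ∃ q < r, σ.mem.val a x q = v)) → Keeps 14 2 σ σ₂ →
        σ₂.word 15 = 1 → σ₂.ptr 2 = some (a, x, r) → σ₂.mem = σ₁.mem → t + 5 ≤ c v →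
        σ₂.word 2 = 1 ∧ σ₂.mem.len a x = N ∧
          ((σ₂.ptr 2 = some (a, x, r) ∧ σ₂.word 15 = 1 ∧ I (r + 1) σ₂ (τ + t + 5)) ∨
          (σ₂.word 15 ≠ 1 ∧ J σ₂ (τ + t + 3))) := by
      intro σ₂ t hv' hk₂ h15 hp2 hm2 hle
      refine ⟨(hg.keep hk₂).w2, by rw [hm2, hlen], Or.inl ⟨hp2, h15, hk₂, ?_, ?_, ?_⟩⟩
      · rw [hm2]; exact skipped hv'
      · rw [hm2]; exact hu
      · rw [hm2, hF]; omega
    rw [runs_seq, runs_load]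
    refine ⟨a, x, r, hp, by rw [hv₁]; omega, ?_⟩
    have k1 := hk.setWord (x := 14) (a := σ₁.mem.val a x r) (by decide)
    rw [hv₁] at k1 ⊢
    by_cases hsv : v = s
    · apply Runs.iteTrue (by simp [Cond.Holds, hg₁.w1, hsv])
      rw [runs_skip]
      exact nochange _ _ (Or.inr fun h => absurd hsv h) k1 (by simpa using hf) hp rfl (by omega)
    apply Runs.iteFalse (by simp [Cond.Holds, hg₁.w1, hsv])
    rw [runs_seq, runs_copy]
    refine ⟨by simp; omega, ?_⟩
    rw [runs_seq, runs_copy]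
    have h13' : σ₁.word 13 = x := by rw [hk.word 13 (by decide), h13]
    refine ⟨by simp [h13']; omega, ?_⟩
    have k2 := (k1.setWord (x := 16) (a := v) (by decide)).setWord (x := 17) (a := x) (by decide)
    set σ₂ : Mach ι := ⟨Function.update (Function.update (Function.update σ₁.word 14 v) 16 v) 17 x,
      σ₁.ptr, σ₁.mem, σ₁.out⟩ with hσ₂
    have hσ₂' : (⟨Function.update (Function.update (Function.update σ₁.word 14 v) 16
        (Function.update σ₁.word 14 v 14)) 17 (Function.update (Function.update σ₁.word 14 v) 16
        (Function.update σ₁.word 14 v 14) 13), σ₁.ptr, σ₁.mem, σ₁.out⟩ : Mach ι) = σ₂ := by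
      simp [hσ₂, h13']
    simp only [hσ₂']
    have valb : ∀ r < σ₁.mem.len b v, σ₁.mem.val b v r < 2 ^ w := by
      intro r hr
      have := hs.arranged.inn_val_lt L hvn hr
      omega
    refine (runs_testPair (σ := σ₂) (i := b) (p := 3) (v := v) (by omega) (by simp [hσ₂]) hvn
      valb).seq ?_
    rintro σ₃ t₃ ⟨hk₃, hm₃, h18, -, ht₃⟩
    rw [runs_seq, runs_const]
    refine ⟨by omega, ?_⟩
    have k3 := (k2.trans (hk₃.mono (by decide) (by decide))).setWord (x := 21) (a := 0) (by decide)
    have h18' : σ₃.word 18 = σ₁.mem.pairState b v 3 := h18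
    have hle := AdjLists.pairState_le (M := σ₁.mem) (i := b) (v := v) (p := 3)
    have hmem₃ : σ₃.mem = σ₁.mem := hm₃
    have h15 : σ₃.word 15 = 1 := by rw [hk₃.word 15 (by decide)]; simpa [hσ₂] using hf
    have hp₃ : σ₃.ptr 2 = some (a, x, r) := by rw [hk₃.ptr 2 (by decide)]; exact hp
    have h14₃ : σ₃.word 14 = v := by rw [hk₃.word 14 (by decide)]; simp [hσ₂]
    have h13₃ : σ₃.word 13 = x := by rw [hk₃.word 13 (by decide)]; simp [hσ₂, h13']
    have hvis : 5 ≤ A.len b v → (σ₁.mem.pairState b v 3 = 1 ↔ δ v ≤ d ∨ _) :=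
      hs.found v hvn hsv
    have hst : σ₁.mem.pairState b v 3 = 2 ↔ A.len b v < 5 := by
      rw [AdjLists.pairState_eq_two, hs.arranged.len]; omega
    by_cases h0 : σ₁.mem.pairState b v 3 = 0
    · apply Runs.iteTrue (by simp [Cond.Holds, h18', h0])
      have hnv : ¬ δ v ≤ d := by
        intro hd
        have := (hvis (by omega)).2 (Or.inl hd)
        omega
      refine (adopted _ (1 + (1 + (1 + (t₃ + 1 + 1))) + 1) (by omega) k3 (by simpa using h15) hp₃
        hmem₃ ?_ ?_ ?_).mono ?_
      · simp [hk₃.word 16 (by decide), hσ₂]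
      · simp [hk₃.word 17 (by decide), hσ₂]
      · rw [if_pos h0]; omega
      · intro σ' t' h
        convert h using 3 <;> ring_nf
    apply Runs.iteFalse (by simp [Cond.Holds, h18', h0])
    by_cases h1 : σ₁.mem.pairState b v 3 = 1
    · apply Runs.iteTrue (by simp [Cond.Holds, h18', h1, hk₃.word 2 (by decide),
        hσ₂, h2])
      rw [runs_skip]
      refine nochange _ _ ?_ k3 (by simpa using h15) hp₃ hmem₃ (by omega)
      rcases (hvis (by omega)).1 h1 with h | h
      · exact Or.inl h
      · exact Or.inr fun _ => h
    apply Runs.iteFalse (by simp [Cond.Holds, h18', h1, hk₃.word 2 (by decide),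
        hσ₂, h2])
    have hcv : c v = 6 * d + 200 := by
      simp only [c]; rw [if_pos (hst.1 (by omega))]
    refine (runs_walk L hw (hg.keep k3) hdn (y := v) (by rw [hmem₃]; exact hs.arranged) ?_ ?_
      hvn).seq ?_
    · intro y hy hys hyd
      rw [hmem₃]
      exact hs.parent y hy hys (Or.inl hyd)
    · simp [hk₃.word 16 (by decide), hσ₂]
    rintro σ₄ t₄ ⟨hk₄, hm₄, h18₄, ht₄⟩
    have k4 := k3.trans (hk₄.mono (by decide) (by decide))
    have h15₄ : σ₄.word 15 = 1 := by rw [hk₄.word 15 (by decide)]; simpa using h15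
    have hp₄ : σ₄.ptr 2 = some (a, x, r) := by rw [hk₄.ptr 2 (by decide)]; exact hp₃
    have hm₄' : σ₄.mem = σ₁.mem := by rw [hm₄]; exact hmem₃
    by_cases hd : δ v ≤ d
    · apply Runs.iteTrue (by simp [Cond.Holds, h18₄, (hg.keep k4).w3]; omega)
      rw [runs_skip]
      exact nochange _ _ (Or.inl hd) k4 h15₄ hp₄ hm₄' (by omega)
    -- The walk does not see whether `v` was already adopted in this phase. If so, it is adopted
    -- again and its parent is replaced by `x`, which also has level `d`.
    · apply Runs.iteFalse (by simp [Cond.Holds, h18₄, (hg.keep k4).w3]; omega)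
      have h14₄ : σ₄.word 14 = v := by rw [hk₄.word 14 (by decide)]; simpa using h14₃
      have h13₄ : σ₄.word 13 = x := by rw [hk₄.word 13 (by decide)]; simpa using h13₃
      rw [runs_seq, runs_copy]
      refine ⟨by rw [h14₄]; omega, ?_⟩
      rw [runs_seq, runs_copy]
      refine ⟨by simp [h13₄]; omega, ?_⟩
      refine (adopted _ (1 + (1 + (1 + (t₃ + (1 + (t₄ + (1 + (1)) + 1) + 1) + 1))) + 1) (by omega)
        ((k4.setWord (by decide)).setWord (by decide)) (by simpa using h15₄) hp₄ hm₄' ?_ ?_ ?_).mono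
        ?_
      · simp [h14₄]
      · simp [h13₄]
      · rw [if_neg h0, hcv]
        have := hst.1 (by omega)
        omega
      · intro σ' t' h
        convert h using 3 <;> ring_nf
  · exact fun σ' τ h => ⟨τ, rfl, h⟩
  · rintro σ' _ ⟨τ, rfl, hk, hs, hu, hτ⟩
    refine ⟨hk.mono (by decide) (by decide), ?_, hu, ?_⟩
    · have : (fun v => T v ∨ E x v) = fun v => T v ∨ ∃ q < N, σ.mem.val a x q = v := by
        funext v
        have : E x v ↔ ∃ q < N, σ.mem.val a x q = v := by
          constructor
          · intro h
            obtain ⟨q, hq, h⟩ := (hS.arranged.out x hx).surjOn h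
            exact ⟨q, by rw [hN, hS.arranged.len]; exact hq, h⟩
          · rintro ⟨q, hq, rfl⟩
            exact hS.arranged.out_mem hx hq
        rw [this]
      rw [this]
      exact hs
    · have h := sum_positions (hS.arranged.out x hx) (n := n) (fun v hv => (L.edge_lt hv).2) c
      have hFN : F N = expandCost A b n E d x - 4 := by
        simp only [F, hN, expandCost, hS.arranged.len, h, Nat.add_sub_cancel]
        rfl
      have : 4 ≤ expandCost A b n E d x := by rw [expandCost]; omega
      omega

end Expand

/-! ### Chains

A forest with parent function `h`, in which every vertex without the property `R` has at most one
child. The vertices without this property form chains. -/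

/-- Up to distance `d` from the root `s`, the function `h` is the parent function of a tree in
which all vertices that do not satisfy `R` have at most one child. -/
structure ChainTree (R : ℕ → Prop) (h : ℕ → ℕ) (n s d : ℕ) (δ : ℕ → ℕ) : Prop where
  lt : ∀ {y}, y < n → y ≠ s → δ y ≤ d → h y < n
  parent : ∀ {y}, y < n → y ≠ s → δ y ≤ d → δ (h y) + 1 = δ y
  source : R s
  unique : ∀ {y z}, y < n → z < n → y ≠ s → z ≠ s → δ y ≤ d → δ z ≤ d → ¬ R (h y) → h y = h z →
    y = z

open Classical in
/-- The topmost vertex of the chain through `y` that is reached within `k` steps. -/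
noncomputable def chainTop (R : ℕ → Prop) (h : ℕ → ℕ) : ℕ → ℕ → ℕ
  | 0, y => y
  | k + 1, y => if R (h y) then y else chainTop R h k (h y)

/-- The topmost vertex of the chain through `y`. -/
noncomputable def chainStart (R : ℕ → Prop) (h δ : ℕ → ℕ) (y : ℕ) : ℕ := chainTop R h (δ y) y

open Classical in
/-- The vertex with property `R` to which the chain through `y` is attached. -/
noncomputable def chainOwner (R : ℕ → Prop) (h δ : ℕ → ℕ) (y : ℕ) : ℕ :=
  if R y then y else h (chainStart R h δ y)

open Classical in
/-- The number of vertices up to level `d` of the chain that starts with `c`. -/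
noncomputable def chainSize (R : ℕ → Prop) (h δ : ℕ → ℕ) (n d c : ℕ) : ℕ :=
  {y ∈ Finset.range n | ¬ R y ∧ chainStart R h δ y = c ∧ δ y ≤ d}.card

namespace ChainTree

variable {R : ℕ → Prop} {h δ : ℕ → ℕ} {n s d y z c : ℕ}

theorem ne_source (H : ChainTree R h n s d δ) (hR : ¬ R y) : y ≠ s := by
  rintro rfl; exact hR H.source

theorem start_of_root (H : ChainTree R h n s d δ) (hy : y < n) (hs : y ≠ s) (hd : δ y ≤ d)
    (hp : R (h y)) : chainStart R h δ y = y := by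
  have := H.parent hy hs hd
  rw [chainStart, ← this, chainTop, if_pos hp]

theorem start_of_not_root (H : ChainTree R h n s d δ) (hy : y < n) (hs : y ≠ s) (hd : δ y ≤ d)
    (hp : ¬ R (h y)) : chainStart R h δ y = chainStart R h δ (h y) := by
  have := H.parent hy hs hd
  rw [chainStart, ← this, chainTop, if_neg hp, chainStart]

/-- Induction on the level: as long as the parent is not a root, the parent lies on the same chain
one level higher; the source is a root, so the ascent stops in time. -/
theorem start_spec (H : ChainTree R h n s d δ) (hy : y < n) (hR : ¬ R y) (hd : δ y ≤ d) :
    chainStart R h δ y < n ∧ ¬ R (chainStart R h δ y) ∧ R (h (chainStart R h δ y)) ∧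
      δ (chainStart R h δ y) ≤ δ y := by
  induction hk : δ y generalizing y with
  | zero =>
    have := H.parent hy (H.ne_source hR) hd
    omega
  | succ k ih =>
    have hs := H.ne_source hR
    have hpar := H.parent hy hs hd
    by_cases hp : R (h y)
    · rw [H.start_of_root hy hs hd hp]
      exact ⟨hy, hR, hp, hk.le⟩
    · rw [H.start_of_not_root hy hs hd hp]
      obtain ⟨h1, h2, h3, h4⟩ := ih (H.lt hy hs hd) hp (by omega) (by omega)
      exact ⟨h1, h2, h3, by omega⟩

/-- A chain skips no level between its start and any of its vertices. -/
theorem exists_ancestor (H : ChainTree R h n s d δ) (hy : y < n) (hR : ¬ R y) (hd : δ y ≤ d)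
    {k : ℕ} (h1 : δ (chainStart R h δ y) ≤ k) (h2 : k ≤ δ y) :
    ∃ z < n, ¬ R z ∧ chainStart R h δ z = chainStart R h δ y ∧ δ z = k := by
  induction hj : δ y generalizing y with
  | zero => exact ⟨y, hy, hR, rfl, by omega⟩
  | succ j ih =>
    by_cases hk : k = δ y
    · exact ⟨y, hy, hR, rfl, hk.symm⟩
    have hs := H.ne_source hR
    have hpar := H.parent hy hs hd
    by_cases hp : R (h y)
    · rw [H.start_of_root hy hs hd hp] at h1
      omega
    · rw [H.start_of_not_root hy hs hd hp] at h1 ⊢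
      exact ih (H.lt hy hs hd) hp (by omega) h1 (by omega) (by omega)

/-- A chain has at most one vertex on each level: two vertices of the same level have parents on the
same chain, which agree by induction, and a vertex that is not a root has only one child. -/
theorem eq_of_start_eq (H : ChainTree R h n s d δ) (hy : y < n) (hz : z < n) (hRy : ¬ R y)
    (hRz : ¬ R z) (hd : δ y ≤ d) (hyz : δ y = δ z)
    (hst : chainStart R h δ y = chainStart R h δ z) : y = z := by
  induction hj : δ y generalizing y z with
  | zero =>
    have := H.parent hy (H.ne_source hRy) hd
    omega
  | succ j ih =>
    have hsy := H.ne_source hRy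
    have hsz := H.ne_source hRz
    have hpy := H.parent hy hsy hd
    have hpz := H.parent hz hsz (hyz ▸ hd)
    by_cases h1 : R (h y) <;> by_cases h2 : R (h z)
    · rwa [H.start_of_root hy hsy hd h1, H.start_of_root hz hsz (hyz ▸ hd) h2] at hst
    · rw [H.start_of_root hy hsy hd h1, H.start_of_not_root hz hsz (hyz ▸ hd) h2] at hst
      have := (H.start_spec (H.lt hz hsz (hyz ▸ hd)) h2 (by omega)).2.2.2
      rw [← hst] at this
      omega
    · rw [H.start_of_root hz hsz (hyz ▸ hd) h2, H.start_of_not_root hy hsy hd h1] at hst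
      have := (H.start_spec (H.lt hy hsy hd) h1 (by omega)).2.2.2
      rw [hst] at this
      omega
    · have hlt := H.lt hy hsy hd
      refine H.unique hy hz hsy hsz hd (hyz ▸ hd) h1
        (ih hlt (H.lt hz hsz (hyz ▸ hd)) h1 h2 (by omega) (by omega) ?_ (by omega))
      rw [← H.start_of_not_root hy hsy hd h1, hst, H.start_of_not_root hz hsz (hyz ▸ hd) h2]

/-- The ancestor of `y` one level below `x` lies on the same chain, and its parent is the only chain
vertex on the level of `x`. So when no child of `x` is found, the chain ends at `x`. -/
theorem exists_child (H : ChainTree R h n s d δ) {x : ℕ} (hy : y < n) (hx : x < n) (hRy : ¬ R y)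
    (hRx : ¬ R x) (hd : δ y ≤ d) (hlt : δ x < δ y)
    (hst : chainStart R h δ y = chainStart R h δ x) :
    ∃ z < n, ¬ R z ∧ h z = x ∧ δ z = δ x + 1 ∧ chainStart R h δ z = chainStart R h δ x := by
  have hxs := H.start_spec hx hRx (by omega)
  obtain ⟨z, hz, hRz, hzs, hzd⟩ := H.exists_ancestor hy hRy hd (k := δ x + 1)
    (by rw [hst]; omega) (by omega)
  have hs := H.ne_source hRz
  have hpz := H.parent hz hs (by omega)
  have hp : ¬ R (h z) := by
    intro hp
    have := H.start_of_root hz hs (by omega) hp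
    rw [hzs, hst] at this
    rw [this] at hxs
    omega
  refine ⟨z, hz, hRz, ?_, hzd, hzs.trans hst⟩
  refine H.eq_of_start_eq (H.lt hz hs (by omega)) hx hp hRx (by omega) (by omega) ?_
  rw [← H.start_of_not_root hz hs (by omega) hp, hzs, hst]

theorem start_child (H : ChainTree R h n s d δ) {x : ℕ} (hz : z < n) (hRz : ¬ R z)
    (hRx : ¬ R x) (hd : δ z ≤ d) (hzx : h z = x) :
    chainStart R h δ z = chainStart R h δ x := by
  rw [H.start_of_not_root hz (H.ne_source hRz) hd (hzx ▸ hRx), hzx]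

end ChainTree

/-- The vertices that have an activity bit, and the source. -/
def IsRoot {ι : Type} (A : AdjLists ι) (a : ι) (off s v : ℕ) : Prop :=
  v = s ∨ off + 1 < A.len a v

/-- Put `1` into register `18` if the vertex in register `16` is not a root and the vertex in
register `17` is its parent, and `0` otherwise. -/
def Code.isChild {ι : Type} (a b : ι) (off : ℕ) : Code ι :=
  .ite (.eq 16 1) (.instr (.const 18 0))
    (Code.testPair a off ;; .instr (.const 19 2) ;;
      .ite (.eq 18 19) (.instr (.head 4 b 16) ;; .instr (.load 18 4) ;;
        .ite (.eq 18 17) (.instr (.const 18 1)) (.instr (.const 18 0))) (.instr (.const 18 0)))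

/-- Put the last child that is not a root of the vertex in register `11` into register `13`;
the number of vertices if there is none. -/
def Code.findChild {ι : Type} (a b : ι) (off : ℕ) : Code ι :=
  .instr (.copy 13 0) ;; Code.scan a 11 2 15 (.instr (.load 14 2) ;; .instr (.copy 16 14) ;;
    .instr (.copy 17 11) ;; Code.isChild a b off ;; .ite (.eq 18 2) (.instr (.copy 13 14)) .skip)

/-- Follow the chain from the vertex in register `11`, whose level is in register `12`, down to the
level in register `7`. -/
def Code.descend {ι : Type} (a b : ι) (off : ℕ) : Code ι :=
  .loop (.lt 12 7) (Code.findChild a b off ;; .instr (.copy 11 13) ;;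
    .ite (.eq 11 0) (.instr (.copy 12 7)) (.instr (.op .add 12 12 2)))

section Chain

variable {ι : Type} {A M : AdjLists ι} {a b : ι} {off n s w d : ℕ} {E : ℕ → ℕ → Prop}
  {δ : ℕ → ℕ}

/-- A vertex `x` that is not a root has at most `off + 1` successors. If `off = 0`, there is only
one. If `off = 1`, the lists coincide and one of the at most two neighbours is the parent of `x`,
which leaves one for a child. -/
theorem Layout.chainTree (hoff : a ≠ b ∧ off = 0 ∨ a = b ∧ off = 1) (L : Layout A a b n s E δ)
    (hR : Arranged A M a b n E)
    (hpar : ∀ y < n, y ≠ s → δ y ≤ d → δ (M.val b y 0) + 1 = δ y) :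
    ChainTree (IsRoot A a off s) (fun y => M.val b y 0) n s d δ := by
  have hmem : ∀ {y}, y < n → y ≠ s → E (M.val b y 0) y := fun hy hs =>
    hR.inn_mem hy (by rw [hR.len]; exact L.len_pos hy hs)
  refine ⟨fun hy hs _ => (L.edge_lt (hmem hy hs)).1, fun hy hs hd => hpar _ hy hs hd, Or.inl rfl,
    fun {y z} hy hz hys hzs hyd hzd hRt he => ?_⟩
  have he : M.val b y 0 = M.val b z 0 := he
  have hRt : ¬ IsRoot A a off s (M.val b y 0) := hRt
  set x := M.val b y 0 with hx
  have hEy : E x y := hmem hy hys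
  have hEz : E x z := by rw [he]; exact hmem hz hzs
  have hxn := (L.edge_lt hEy).1
  have hxs : x ≠ s := fun h => hRt (Or.inl h)
  have hlen : A.len a x ≤ off + 1 := by
    by_contra hn
    exact hRt (Or.inr (by omega))
  obtain ⟨p, hp, hpy⟩ := (L.out x hxn).surjOn hEy
  obtain ⟨q, hq, hqz⟩ := (L.out x hxn).surjOn hEz
  have hp : p < A.len a x := hp
  have hq : q < A.len a x := hq
  rcases hoff with ⟨-, h0⟩ | ⟨hab, h1⟩
  · have : p = q := by omega
    rw [← hpy, ← hqz, this]
  · subst hab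
    have hEu := hmem hxn hxs
    set u := M.val a x 0 with hu
    have hyd' := hpar y hy hys hyd
    have hzd' := hpar z hz hzs hzd
    rw [← hx] at hyd'
    rw [← he] at hzd'
    have hxd := hpar x hxn hxs (by omega)
    rw [← hu] at hxd
    obtain ⟨r, hr, hru⟩ := (L.inn x hxn).surjOn hEu
    have hr : r < A.len a x := hr
    -- The parent `u` of `x` and the child `y` differ by two levels, so they occupy different
    -- positions of the list of `x`.
    have h1 : r ≠ p := by
      rintro rfl
      have : δ u = δ y := by rw [← hru, ← hpy]
      omega
    have h2 : r ≠ q := by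
      rintro rfl
      have : δ u = δ z := by rw [← hru, ← hqz]
      omega
    have : p = q := by omega
    rw [← hpy, ← hqz, this]

open Classical in
theorem runs_isChild (hoff : off ≤ 1) (L : Layout A a b n s E δ) {σ : Mach ι} {c r : ℕ}
    (hw : 16 * n + 16 ≤ 2 ^ w) (hR : Arranged A σ.mem a b n E) (h1 : σ.word 1 = s)
    (h16 : σ.word 16 = c) (h17 : σ.word 17 = r) (hc : c < n) :
    Runs n w (Code.isChild a b off) σ fun σ' t => Keeps 18 4 σ σ' ∧ σ'.mem = σ.mem ∧
      σ'.word 18 = (if ¬ IsRoot A a off s c ∧ σ.mem.val b c 0 = r then 1 else 0) ∧ t ≤ 22 := by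
  have k0 := Keeps.refl (lo := 18) (plo := 4) σ
  by_cases hcs : c = s
  · apply Runs.iteTrue (by simp [Cond.Holds, h16, h1, hcs])
    rw [runs_const]
    refine ⟨by omega, k0.setWord (by decide), rfl, ?_, by omega⟩
    simp [IsRoot, hcs]
  apply Runs.iteFalse (by simp [Cond.Holds, h16, h1, hcs])
  refine (runs_testPair (i := a) (p := off) (by omega) h16 hc fun p hp => ?_).seq ?_
  · have := hR.out_val_lt L hc hp
    omega
  rintro σ₁ t₁ ⟨hk, hm, h18, -, ht⟩
  rw [runs_seq, runs_const]
  refine ⟨by omega, ?_⟩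
  have k1 := hk.setWord (x := 19) (a := 2) (by decide)
  -- State `2` says that there is no room for an activity bit; the source has been dealt with, so
  -- this identifies the vertices that are not roots.
  by_cases h2 : σ.mem.pairState a c off = 2
  · apply Runs.iteTrue (by simp [Cond.Holds, h18, h2])
    have hnr : ¬ IsRoot A a off s c := by
      rintro (h | h)
      · exact hcs h
      · rw [AdjLists.pairState_eq_two, hR.len] at h2
        omega
    have hlen : 0 < σ₁.mem.len b c := by rw [hm, hR.len]; exact L.len_pos hc hcs
    have hlt : σ₁.mem.val b c 0 < n := by
      rw [hm] at hlen ⊢; exact hR.inn_val_lt L hc hlen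
    have h16' : σ₁.word 16 = c := (hk.word 16 (by decide)).trans h16
    rw [runs_seq, runs_head]
    refine ⟨by simpa [h16'] using hc, ?_⟩
    rw [runs_seq, runs_load]
    refine ⟨b, c, 0, by simp [h16', AdjLists.nodeAt, hlen], by simp only; omega, ?_⟩
    have k2 := (k1.setPtr (x := 4) (a := σ₁.mem.nodeAt b c 0) (by decide)).setWord (x := 18)
      (a := σ₁.mem.val b c 0) (by decide)
    have h17' : σ₁.word 17 = r := (hk.word 17 (by decide)).trans h17
    by_cases hr : σ.mem.val b c 0 = r
    · apply Runs.iteTrue (by simp [Cond.Holds, h17', hm, hr])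
      rw [runs_const]
      refine ⟨by omega, ?_, hm, by simp [hnr, hr], by omega⟩
      simpa [h16'] using k2.setWord (x := 18) (a := 1) (by decide)
    · apply Runs.iteFalse (by simp [Cond.Holds, h17', hm, hr])
      rw [runs_const]
      refine ⟨by omega, ?_, hm, by simp [hr], by omega⟩
      simpa [h16'] using k2.setWord (x := 18) (a := 0) (by decide)
  · apply Runs.iteFalse (by simp [Cond.Holds, h18, h2])
    rw [runs_const]
    refine ⟨by omega, k1.setWord (by decide), hm, ?_, by omega⟩
    have : IsRoot A a off s c := by
      right
      rw [AdjLists.pairState_eq_two, hR.len] at h2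
      omega
    simp [this]

/-- The time is constant because a vertex that is not a root has at most two nodes in its list. The
value `n` in register `13` means that there is no child. -/
theorem runs_findChild (hoff : a ≠ b ∧ off = 0 ∨ a = b ∧ off = 1) (L : Layout A a b n s E δ)
    {σ : Mach ι} {x : ℕ} (hw : 16 * n + 16 ≤ 2 ^ w) (hR : Arranged A σ.mem a b n E)
    (h0 : σ.word 0 = n) (h1 : σ.word 1 = s) (h2 : σ.word 2 = 1) (h11 : σ.word 11 = x) (hx : x < n)
    (hxR : ¬ IsRoot A a off s x) :
    Runs n w (Code.findChild a b off) σ fun σ' t => Keeps 13 2 σ σ' ∧ σ'.mem = σ.mem ∧ t ≤ 80 ∧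
      ((σ'.word 13 < n ∧ E x (σ'.word 13) ∧ ¬ IsRoot A a off s (σ'.word 13) ∧
        σ.mem.val b (σ'.word 13) 0 = x) ∨
      (σ'.word 13 = n ∧ ∀ c < n, ¬ IsRoot A a off s c → σ.mem.val b c 0 ≠ x)) := by
  have hlen : σ.mem.len a x ≤ 2 := by
    rw [hR.len]
    by_contra hn
    exact hxR (Or.inr (by omega))
  rw [Code.findChild, runs_seq, runs_copy]
  refine ⟨by omega, ?_⟩
  let I : ℕ → Mach ι → ℕ → Prop := fun r σ' τ => Keeps 13 2 σ σ' ∧ σ'.mem = σ.mem ∧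
    τ ≤ 3 + 36 * r ∧ ((σ'.word 13 < n ∧ E x (σ'.word 13) ∧ ¬ IsRoot A a off s (σ'.word 13) ∧
        σ.mem.val b (σ'.word 13) 0 = x) ∨
      (σ'.word 13 = n ∧ ∀ q < r, ¬ IsRoot A a off s (σ.mem.val a x q) →
        σ.mem.val b (σ.mem.val a x q) 0 ≠ x))
  let J : Mach ι → ℕ → Prop := fun σ' τ => ∃ τ', τ = τ' + 1 ∧ I (σ.mem.len a x) σ' τ'
  have hw1 : 1 < 2 ^ w := by omega
  refine Runs.mono (Q := J) ?_ ?_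
  refine runs_scan x (σ.mem.len a x) I J hw1 (by decide) (by simpa using h11) hx
    (by simpa using h2) rfl ?_ ?_ ?_ ?_
  · rintro r σ' τ p f ⟨hk, hm, ht, h⟩
    exact ⟨(hk.setPtr (by decide)).setWord (by decide), hm, ht, by simpa using h⟩
  · exact ⟨(Keeps.refl _).setWord (by decide), rfl, le_rfl, Or.inr (by simp [h0])⟩
  · rintro r hr σ₁ τ ⟨hk, hm, hτ, hor⟩ hp hf h2' hl
    have hEv : E x (σ.mem.val a x r) := hR.out_mem hx hr
    set v := σ.mem.val a x r with hv
    have hvn := (L.edge_lt hEv).2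
    rw [runs_seq, runs_load]
    refine ⟨a, x, r, hp, by rw [hm]; omega, ?_⟩
    rw [runs_seq, runs_copy]
    refine ⟨by simp [hm, ← hv]; omega, ?_⟩
    rw [runs_seq, runs_copy]
    have h11' : σ₁.word 11 = x := (hk.word 11 (by decide)).trans h11
    refine ⟨by simp [h11']; omega, ?_⟩
    refine (runs_isChild (by omega) L hw (c := v) (r := x) (by rw [hm]; exact hR) ?_ ?_ ?_
      hvn).seq ?_
    · simpa using (hk.word 1 (by decide)).trans h1
    · simp [hm, ← hv]
    · simp [h11']
    rintro σ₂ t₂ ⟨hk₂, hm₂, h18, ht₂⟩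
    simp only [hm] at hm₂
    have h14 : σ₂.word 14 = v := by rw [hk₂.word 14 (by decide)]; simp [hm, ← hv]
    have h13 : σ₂.word 13 = σ₁.word 13 := by rw [hk₂.word 13 (by decide)]; simp
    have h2₂ : σ₂.word 2 = 1 := by rw [hk₂.word 2 (by decide)]; simpa using h2'
    have h15 : σ₂.word 15 = 1 := by rw [hk₂.word 15 (by decide)]; simpa using hf
    have hp₂ : σ₂.ptr 2 = some (a, x, r) := by rw [hk₂.ptr 2 (by decide)]; simpa using hp
    have k2 : Keeps 13 2 σ σ₂ := (((hk.setWord (by decide)).setWord (by decide)).setWord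
      (by decide)).trans (hk₂.mono (by decide) (by decide))
    by_cases hch : ¬ IsRoot A a off s v ∧ σ.mem.val b v 0 = x
    · rw [if_pos (by rw [hm]; exact hch)] at h18
      apply Runs.iteTrue (by simp [Cond.Holds, h18, h2₂])
      rw [runs_copy]
      refine ⟨by omega, by simpa using h2₂, by simp only; rw [hm₂], Or.inl ⟨hp₂, by simpa using h15,
        k2.setWord (by decide), hm₂, by omega, Or.inl ?_⟩⟩
      simp only [Function.update_self, h14]
      exact ⟨hvn, hEv, hch⟩
    · rw [if_neg (by rw [hm]; exact hch)] at h18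
      apply Runs.iteFalse (by simp [Cond.Holds, h18, h2₂])
      rw [runs_skip]
      refine ⟨h2₂, by rw [hm₂], Or.inl ⟨hp₂, h15, k2, hm₂, by omega, ?_⟩⟩
      rw [h13]
      refine hor.imp_right fun ⟨h3, h4⟩ => ⟨h3, fun q hq hq' => ?_⟩
      rcases Nat.lt_succ_iff_lt_or_eq.1 hq with hq | rfl
      · exact h4 q hq hq'
      · exact fun h => hch ⟨hq', h⟩
  · exact fun σ' τ h => ⟨τ, rfl, h⟩
  · rintro σ' _ ⟨τ, rfl, hk, hm, ht, hor⟩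
    refine ⟨hk, hm, by omega, hor.imp_right fun ⟨h3, h4⟩ => ⟨h3, fun c hc hcR hcx => ?_⟩⟩
    have hEc : E x c := by
      rw [← hcx]
      exact hR.inn_mem hc (by
        rw [hR.len]; exact L.len_pos hc fun h => hcR (Or.inl h))
    obtain ⟨q, hq, hqc⟩ := (hR.out x hx).surjOn hEc
    rw [← hqc] at hcR hcx
    exact h4 q (by rw [hR.len]; exact hq) hcR hcx

open Classical in
-- Every iteration but possibly the last moves to a new vertex of the chain, one level further down,
-- so the time is bounded by the number of chain vertices up to level `d`.
theorem runs_descend (hoff : a ≠ b ∧ off = 0 ∨ a = b ∧ off = 1) (L : Layout A a b n s E δ)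
    {σ : Mach ι} {c : ℕ} (hw : 16 * n + 16 ≤ 2 ^ w) (hg : Globals n s d σ)
    (hR : Arranged A σ.mem a b n E)
    (hpar : ∀ y < n, y ≠ s → δ y ≤ d → δ (σ.mem.val b y 0) + 1 = δ y) (hdn : d < n)
    (h11 : σ.word 11 = c) (h12 : σ.word 12 = δ c) (hc : c < n) (hcR : ¬ IsRoot A a off s c)
    (hcp : IsRoot A a off s (σ.mem.val b c 0)) (hcd : δ c ≤ d) :
    Runs n w (Code.descend a b off) σ fun σ' t => Keeps 11 2 σ σ' ∧ σ'.mem = σ.mem ∧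
      t ≤ 84 * chainSize (IsRoot A a off s) (fun y => σ.mem.val b y 0) δ n d c + 1 ∧
      ((σ'.word 11 < n ∧ ¬ IsRoot A a off s (σ'.word 11) ∧ δ (σ'.word 11) = d ∧
        chainStart (IsRoot A a off s) (fun y => σ.mem.val b y 0) δ (σ'.word 11) = c) ∨
      (σ'.word 11 = n ∧ ∀ y < n, ¬ IsRoot A a off s y →
        chainStart (IsRoot A a off s) (fun y => σ.mem.val b y 0) δ y = c → δ y ≠ d)) := by
  have H := L.chainTree hoff hR hpar
  set R := IsRoot A a off s with hRdef
  set h : ℕ → ℕ := fun y => σ.mem.val b y 0 with hh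
  -- The chain vertices on levels below `k` in number; the iterations so far are charged to them.
  let S : ℕ → Finset ℕ := fun k =>
    {y ∈ Finset.range n | ¬ R y ∧ chainStart R h δ y = c ∧ δ y < k}
  have hS : ∀ {k k'}, k ≤ k' → (S k).card ≤ (S k').card := by
    intro k k' hk
    refine Finset.card_le_card fun y hy => ?_
    simp only [S, Finset.mem_filter] at hy ⊢
    exact ⟨hy.1, hy.2.1, hy.2.2.1, by omega⟩
  let I : Mach ι → ℕ → Prop := fun σ' τ => Keeps 11 2 σ σ' ∧ σ'.mem = σ.mem ∧
    σ'.word 12 ≤ d ∧ τ ≤ 84 * (S (σ'.word 12)).card ∧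
    ((σ'.word 11 < n ∧ ¬ R (σ'.word 11) ∧ δ (σ'.word 11) = σ'.word 12 ∧
        chainStart R h δ (σ'.word 11) = c) ∨
      (σ'.word 11 = n ∧ σ'.word 12 = d ∧
        ∀ y < n, ¬ R y → chainStart R h δ y = c → δ y ≠ d))
  refine (Runs.loop I (fun σ' => d - σ'.word 12) ?_ ?_).mono ?_
  · refine ⟨Keeps.refl _, rfl, by omega, by simp, Or.inl ?_⟩
    rw [h11, h12]
    exact ⟨hc, hcR, rfl, H.start_of_root hc (H.ne_source hcR) hcd hcp⟩
  · rintro σ₁ τ ⟨hk, hm, hle, hτ, hor⟩ hb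
    have hg₁ := hg.keep hk
    simp only [Cond.Holds, hg₁.w7] at hb
    obtain ⟨hxn, hxR, hxd, hxs⟩ := hor.resolve_right (by omega)
    set x := σ₁.word 11 with hx
    set i := σ₁.word 12 with hi
    have hcard : (S i).card + 1 ≤ (S (i + 1)).card := by
      have hxS : x ∉ S i := by simp [S, hxd]
      rw [← Finset.card_insert_of_notMem hxS]
      refine Finset.card_le_card fun y hy => ?_
      simp only [S, Finset.mem_insert, Finset.mem_filter, Finset.mem_range] at hy ⊢
      rcases hy with rfl | hy
      · exact ⟨hxn, hxR, hxs, by omega⟩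
      · exact ⟨hy.1, hy.2.1, hy.2.2.1, by omega⟩
    refine (runs_findChild hoff L hw (x := x) (by rw [hm]; exact hR) hg₁.w0 hg₁.w1 hg₁.w2 rfl hxn
      hxR).seq ?_
    rintro σ₂ t₂ ⟨hk₂, hm₂, ht₂, hor₂⟩
    have hg₂ := hg₁.keep hk₂
    have k2 : Keeps 11 2 σ σ₂ := hk.trans (hk₂.mono (by decide) (by decide))
    have h12₂ : σ₂.word 12 = i := hk₂.word 12 (by decide)
    rw [hm] at hm₂ hor₂
    rw [runs_seq, runs_copy]
    rcases hor₂ with ⟨hzn, hEz, hzR, hzx⟩ | ⟨hzn, hno⟩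
    · refine ⟨by omega, ?_⟩
      apply Runs.iteFalse (by simp [Cond.Holds, hg₂.w0]; omega)
      rw [runs_op]
      simp only [WordOp.eval]
      have e12 : Function.update σ₂.word 11 (σ₂.word 13) 12 = i := by simp [h12₂]
      have e2 : Function.update σ₂.word 11 (σ₂.word 13) 2 = 1 := by simp [hg₂.w2]
      rw [e12, e2]
      have hzd : δ (σ₂.word 13) = i + 1 := by
        have h1 := L.dist_edge hEz
        have h2 := H.parent hzn (H.ne_source hzR) (by omega)
        simp only [hh, hzx] at h2
        omega
      refine ⟨by omega, ⟨(k2.setWord (by decide)).setWord (by decide), hm₂, ?_, ?_, Or.inl ?_⟩, ?_⟩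
      · simp; omega
      · simp; omega
      · simp only [ne_eq, Fin.reduceEq, not_false_eq_true, Function.update_of_ne,
          Function.update_self]
        exact ⟨hzn, hzR, hzd, by rw [H.start_child hzn hzR hxR (by omega) hzx, hxs]⟩
      · simp; omega
    · refine ⟨by omega, ?_⟩
      apply Runs.iteTrue (by simp [Cond.Holds, hg₂.w0, hzn])
      rw [runs_copy]
      have e7 : Function.update σ₂.word 11 (σ₂.word 13) 7 = d := by simp [hg₂.w7]
      simp only [e7]
      have hS' : (S (i + 1)).card ≤ (S d).card := hS (by omega)
      refine ⟨by omega, ⟨(k2.setWord (by decide)).setWord (by decide), hm₂, by simp, ?_,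
        Or.inr ⟨by simp [hzn], by simp, fun y hy hyR hys hyd => ?_⟩⟩, ?_⟩
      · simp; omega
      -- A chain vertex on level `d` would provide a child of `x`, although the search found none.
      -- The level register has been set to `d` only to leave the loop.
      · obtain ⟨z, hz, hzR, hzx, -⟩ := H.exists_child hy hxn hyR hxR hyd.le (by omega)
          (hys.trans hxs.symm)
        exact hno z hz hzR hzx
      · simp; omega
  · rintro σ' _ ⟨τ, rfl, ⟨hk, hm, hle, hτ, hor⟩, hb⟩
    simp only [Cond.Holds, (hg.keep hk).w7] at hb
    have h12' : σ'.word 12 = d := by omega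
    refine ⟨hk, hm, ?_, ?_⟩
    · have : (S (σ'.word 12)).card ≤ chainSize R h δ n d c := by
        refine Finset.card_le_card fun y hy => ?_
        simp only [S, Finset.mem_filter] at hy ⊢
        exact ⟨hy.1, hy.2.1, hy.2.2.1, by omega⟩
      omega
    · rw [h12'] at hor
      exact hor.imp_right fun h => ⟨h.1, h.2.2⟩

end Chain

/-! ### Grouping the children of a vertex -/

/-- `M'` differs from `M` only in the order of the values from position `5` on in list `(a, v)`. -/
structure TailOnly {ι : Type} (M M' : AdjLists ι) (a : ι) (v : ℕ) : Prop where
  other : ∀ i u, i ≠ a ∨ u ≠ v → M'.val i u = M.val i u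
  front : ∀ q < 5, M'.val a v q = M.val a v q

theorem TailOnly.front' {ι : Type} {M M' : AdjLists ι} {a : ι} {v : ℕ} (h : TailOnly M M' a v)
    (i : ι) (u : ℕ) {q : ℕ} (hq : q < 5) : M'.val i u q = M.val i u q := by
  by_cases hiu : i = a ∧ u = v
  · rw [hiu.1, hiu.2, h.front q hq]
  · rw [h.other i u (by tauto)]

/-- From position `5` on, the vertices with property `P` come first in list `(a, v)`. -/
def Grouped {ι : Type} (M : AdjLists ι) (a : ι) (v : ℕ) (P : ℕ → Prop) : Prop :=
  ∀ p q, 5 ≤ p → p < q → q < M.len a v → P (M.val a v q) → P (M.val a v p)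

/-- Among the nodes from position `5` on in the list `a` of the vertex in register `5`, move its
children that are not roots to the front. -/
def Code.group {ι : Type} (a b : ι) (off : ℕ) : Code ι :=
  .instr (.copy 16 5) ;; Code.nth a 5 ;; .instr (.copyPtr 0 4) ;; .instr (.copyPtr 1 4) ;;
    Code.flag 0 10 ;; .loop (.eq 10 2) (.instr (.load 16 0) ;; .instr (.copy 17 5) ;;
      Code.isChild a b off ;;
      .ite (.eq 18 2) (.instr (.swap 0 1) ;; .instr (.next 1 1)) .skip ;;
      .instr (.next 0 0) ;; Code.flag 0 10)

section Group

variable {ι : Type} {A : AdjLists ι} {a b : ι} {off n s w : ℕ} {E : ℕ → ℕ → Prop} {δ : ℕ → ℕ}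

/-- A partition in one pass: pointer `1` stays at the boundary `B` between the children and the
other vertices among the positions read so far, and each new child is swapped there. Positions `0`
to `4` are spared, so the parent and both bits survive. -/
theorem runs_group (hoff : off ≤ 1) (L : Layout A a b n s E δ) {σ : Mach ι} {v : ℕ}
    (hw : 16 * n + 16 ≤ 2 ^ w) (hR : Arranged A σ.mem a b n E) (h1 : σ.word 1 = s)
    (h2 : σ.word 2 = 1) (h5 : σ.word 5 = v) (hv : v < n) :
    Runs n w (Code.group a b off) σ fun σ' t => Keeps 10 0 σ σ' ∧ TailOnly σ.mem σ'.mem a v ∧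
      Arranged A σ'.mem a b n E ∧
      Grouped σ'.mem a v (fun c => ¬ IsRoot A a off s c ∧ σ'.mem.val b c 0 = v) ∧
      t ≤ 40 * A.len a v + 20 := by
  have hw1 : 1 < 2 ^ w := by omega
  set P : ℕ → Prop := fun c => ¬ IsRoot A a off s c ∧ σ.mem.val b c 0 = v with hP
  rw [Code.group, runs_seq, runs_copy]
  refine ⟨by omega, ?_⟩
  refine (runs_nth 5 (by simpa [h5] using hv)).seq ?_
  rintro _ t ⟨rfl, ht⟩
  rw [runs_seq, runs_copyPtr, runs_seq, runs_copyPtr, runs_seq]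
  apply runs_flag hw1
  let I : ℕ → Mach ι → ℕ → Prop := fun r σ₁ τ => Keeps 10 0 σ σ₁ ∧ TailOnly σ.mem σ₁.mem a v ∧
    Arranged A σ₁.mem a b n E ∧ τ ≤ 40 * r ∧
    σ₁.word 10 = (if 5 + r < A.len a v then 1 else 0) ∧
    σ₁.ptr 0 = (if 5 + r < A.len a v then some (a, v, 5 + r) else none) ∧
    ∃ B, 5 ≤ B ∧ B ≤ 5 + r ∧ σ₁.ptr 1 = (if B < A.len a v then some (a, v, B) else none) ∧
      (∀ q, 5 ≤ q → q < B → P (σ₁.mem.val a v q)) ∧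
      (∀ q, B ≤ q → q < 5 + r → ¬ P (σ₁.mem.val a v q))
  have hnode : ∀ {M : AdjLists ι} (r : ℕ), M.len = A.len →
      M.nodeAt a v r = if r < A.len a v then some (a, v, r) else none := by
    intro M r hM
    rw [AdjLists.nodeAt, hM]
  have hflag : ∀ r, (if ((if r < A.len a v then some (a, v, r) else none :
      Option (ι × ℕ × ℕ)) = none) then 0 else 1) = if r < A.len a v then 1 else 0 := by
    intro r; split_ifs <;> simp_all
  -- The subtraction is truncated: a list with at most five nodes needs no iteration.
  refine (Runs.count (A.len a v - 5) I ?_ ?_ ?_).mono ?_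
  · refine ⟨?_, ⟨fun _ _ _ => rfl, fun _ _ => rfl⟩, hR, by simp, ?_, ?_, 5, le_rfl, by simp, ?_,
      fun q h h' => by omega, fun q h h' => by omega⟩
    · exact (((((Keeps.refl _).setWord (by decide)).setPtr (by decide)).setPtr (by decide)).setPtr
        (by decide)).setWord (by decide)
    · simp only [h5, Function.update_self, hnode 5 hR.len]
      simp
      split_ifs <;> omega
    · simp [h5, hnode 5 hR.len]
    · simp [h5, hnode 5 hR.len]
  · rintro r hr σ₁ τ ⟨hk, hto, hR₁, hτ, h10, hp0, B, hB, hBr, hp1, hlow, hhigh⟩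
    have hlt : 5 + r < A.len a v := by omega
    have hBlt : B < A.len a v := by omega
    rw [if_pos hlt] at h10 hp0
    rw [if_pos hBlt] at hp1
    have h2₁ : σ₁.word 2 = 1 := (hk.word 2 (by decide)).trans h2
    have h5₁ : σ₁.word 5 = v := (hk.word 5 (by decide)).trans h5
    refine ⟨by simp [Cond.Holds, h10, h2₁], ?_⟩
    have hlt' : 5 + r < σ₁.mem.len a v := by rw [hR₁.len]; exact hlt
    set c := σ₁.mem.val a v (5 + r) with hc
    have hcn : c < n := hR₁.out_val_lt L hv hlt'
    rw [runs_seq, runs_load]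
    refine ⟨a, v, 5 + r, hp0, by omega, ?_⟩
    rw [runs_seq, runs_copy]
    refine ⟨by simp [h5₁]; omega, ?_⟩
    have k1 := (hk.setWord (x := 16) (a := c) (by decide)).setWord (x := 17) (a := v) (by decide)
    refine (runs_isChild hoff L hw (c := c) (r := v) (by exact hR₁) ?_ ?_ ?_ hcn).seq ?_
    · simpa using (hk.word 1 (by decide)).trans h1
    · simp [← hc]
    · simp [h5₁]
    rintro σ₂ t₂ ⟨hk₂, hm₂, h18, ht₂⟩
    have hm₂ : σ₂.mem = σ₁.mem := hm₂
    have k2 : Keeps 10 0 σ σ₂ :=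
      (((hk.setWord (by decide)).setWord (by decide)).trans (hk₂.mono (by decide) (by decide)))
    have h2₂ : σ₂.word 2 = 1 := (k2.word 2 (by decide)).trans h2
    have hp0₂ : σ₂.ptr 0 = some (a, v, 5 + r) := (hk₂.ptr 0 (by decide)).trans hp0
    have hp1₂ : σ₂.ptr 1 = some (a, v, B) := (hk₂.ptr 1 (by decide)).trans hp1
    -- Front values are not moved, so the property by which the list is partitioned does not change
    -- during the partition.
    have hpar : ∀ u, σ₁.mem.val b u 0 = σ.mem.val b u 0 := fun u => hto.front' b u (by omega)
    rw [runs_seq]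
    by_cases hPc : P c
    · have h18' : σ₂.word 18 = 1 := by
        rw [h18, if_pos]
        exact ⟨hPc.1, (hpar c).trans hPc.2⟩
      apply Runs.iteTrue (by simp [Cond.Holds, h18', h2₂])
      rw [runs_seq]
      refine Runs.swap (i := a) (v := v) (r := 5 + r) (r' := B) hp0₂ hp1₂ ?_
      rw [runs_next]
      refine ⟨a, v, B, hp1₂, ?_⟩
      rw [runs_seq, runs_next]
      refine ⟨a, v, 5 + r, by simpa using hp0₂, ?_⟩
      apply runs_flag hw1
      have hlen₂ : (σ₂.mem.swap a v (5 + r) B).len = A.len := by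
        rw [AdjLists.swap_len, hm₂, hR₁.len]
      simp only [Function.update_self, hnode _ hlen₂, hflag]
      rw [hm₂]
      refine ⟨?_, ⟨fun i u hiu => ?_, fun q hq => ?_⟩, hR₁.swap (by omega)
        (by rw [hR₁.len]; exact hBlt), by omega, by simp [Nat.add_assoc], by simp [Nat.add_assoc],
        B + 1, by omega, by omega, ?_, fun q h1 h2 => ?_, fun q h1 h2 => ?_⟩
      · exact (((k2.setPtr (x := 1) (Nat.zero_le _)).setPtr (x := 0) (Nat.zero_le _)).setWord (x := 10)
          le_rfl).setMem
      · rw [AdjLists.swap_val_ne hiu, hto.other i u hiu]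
      · rw [AdjLists.swap_val_of_ne_ne (by omega) (by omega), hto.front q hq]
      · simp
      · rcases Nat.lt_succ_iff_lt_or_eq.1 h2 with h2 | rfl
        · rw [AdjLists.swap_val_of_ne_ne (by omega) (by omega)]
          exact hlow q h1 h2
        · rw [AdjLists.swap_val_self, Equiv.swap_apply_right]
          exact hPc
      · by_cases hq : q = 5 + r
        · rw [hq, AdjLists.swap_val_self, Equiv.swap_apply_left]
          exact hhigh B le_rfl (by omega)
        · rw [AdjLists.swap_val_of_ne_ne hq (by omega)]
          exact hhigh q (by omega) (by omega)
    · have h18' : σ₂.word 18 = 0 := by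
        rw [h18, if_neg]
        exact fun h => hPc ⟨h.1, (hpar c).symm.trans h.2⟩
      apply Runs.iteFalse (by simp [Cond.Holds, h18', h2₂])
      rw [runs_skip, runs_seq, runs_next]
      refine ⟨a, v, 5 + r, hp0₂, ?_⟩
      apply runs_flag hw1
      have hlen₂ : σ₂.mem.len = A.len := by rw [hm₂, hR₁.len]
      simp only [Function.update_self, hnode _ hlen₂, hflag]
      rw [hm₂]
      refine ⟨?_, hto, hR₁, by omega, by simp [Nat.add_assoc], by simp [Nat.add_assoc],
        B, by omega, by omega, ?_, hlow, fun q h1 h2 => ?_⟩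
      · exact ((k2.setPtr (x := 0) (Nat.zero_le _)).setWord (x := 10) le_rfl).setMem
      · simp [hp1₂, hBlt]
      · rcases Nat.lt_succ_iff_lt_or_eq.1 (show q < (5 + r) + 1 by omega) with h2 | rfl
        · exact hhigh q h1 h2
        · exact hPc
  · rintro σ₁ τ ⟨hk, -, -, -, h10, -⟩
    have h2₁ : σ₁.word 2 = 1 := (hk.word 2 (by decide)).trans h2
    simp [Cond.Holds, h10, h2₁]
    omega
  · rintro σ' _ ⟨τ, rfl, hk, hto, hR', hτ, -, -, B, hB, hBr, -, hlow, hhigh⟩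
    refine ⟨hk, hto, hR', fun p q hp hpq hq hPq => ?_, by omega⟩
    rw [hR'.len] at hq
    have hpar : ∀ u, σ'.mem.val b u 0 = σ.mem.val b u 0 := fun u => hto.front' b u (by omega)
    simp only [hpar] at hPq ⊢
    have hqB : q < B := by
      by_contra hn
      exact hhigh q (by omega) (by omega) hPq
    exact hlow p hp (by omega)

end Group

/-! ### Visiting the chains below a root -/

/-- The vertices `os` have been output and counted in register `4`, and the other registers
below `8` agree. -/
structure Emits {ι : Type} (σ σ' : Mach ι) (os : List ℕ) : Prop where
  word : ∀ x : Fin 24, x.val < 8 → x ≠ 4 → σ'.word x = σ.word x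
  count : σ'.word 4 = σ.word 4 + os.length
  out : σ'.out = σ.out ++ os

section Emits

variable {ι : Type} {n s d lo plo : ℕ} {σ σ' σ'' : Mach ι} {os os' : List ℕ}

theorem Emits.refl (σ : Mach ι) : Emits σ σ [] := ⟨fun _ _ _ => rfl, rfl, by simp⟩

theorem Emits.trans (h : Emits σ σ' os) (h' : Emits σ' σ'' os') : Emits σ σ'' (os ++ os') :=
  ⟨fun x hx h4 => (h'.word x hx h4).trans (h.word x hx h4),
    by rw [h'.count, h.count, List.length_append, Nat.add_assoc],
    by rw [h'.out, h.out, List.append_assoc]⟩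

theorem Keeps.emits (h : Keeps lo plo σ σ') (hlo : 8 ≤ lo := by decide) : Emits σ σ' [] :=
  ⟨fun x hx _ => h.word x (by omega), by simpa using h.word 4 (lt_of_lt_of_le (by decide) hlo),
    by simpa using h.out⟩

theorem Emits.keep (h : Emits σ σ' os) (h' : Keeps lo plo σ' σ'') (hlo : 8 ≤ lo := by decide) :
    Emits σ σ'' os := by
  simpa using h.trans (h'.emits hlo)

theorem Emits.globals (h : Emits σ σ' os) (hg : Globals n s d σ) : Globals n s d σ' :=
  ⟨(h.word 0 (by decide) (by decide)).trans hg.w0, (h.word 1 (by decide) (by decide)).trans hg.w1,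
    (h.word 2 (by decide) (by decide)).trans hg.w2, (h.word 3 (by decide) (by decide)).trans hg.w3,
    (h.word 7 (by decide) (by decide)).trans hg.w7⟩

end Emits

/-- Output the vertex in register `x` and expand it. -/
def Code.emit {ι : Type} (a b : ι) (off : ℕ) (x : Fin 24) : Code ι :=
  .instr (.output x) ;; .instr (.op .add 4 4 2) ;; .instr (.copy 13 x) ;; Code.expand a b off

/-- Treat the vertices of level `d` on the chains below the root in register `5`, whose level is
in register `6`. -/
def Code.serve {ι : Type} (a b : ι) (off : ℕ) : Code ι :=
  .instr (.const 8 0) ;; .instr (.const 9 0) ;; Code.scan a 5 0 10 (.instr (.load 11 0) ;;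
    .instr (.copy 16 11) ;; .instr (.copy 17 5) ;; Code.isChild a b off ;;
    .ite (.eq 18 2)
      (.instr (.op .add 12 6 2) ;; Code.descend a b off ;; .ite (.eq 11 0) .skip
        (.instr (.const 8 1) ;; Code.emit a b off 11))
      (.instr (.const 19 5) ;; .ite (.lt 9 19) .skip (.instr (.const 10 0))) ;;
    .instr (.op .add 9 9 2))

open Classical in
/-- Bound on the time spent on the chains below `r`. -/
noncomputable def serveCost (R : ℕ → Prop) (h δ : ℕ → ℕ) (n d r : ℕ) : ℕ :=
  ∑ c ∈ Finset.range n, if ¬ R c ∧ h c = r ∧ δ c ≤ d then 100 * (1 + chainSize R h δ n d c) else 0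

section Serve

variable {ι : Type} {A M : AdjLists ι} {a b : ι} {off n s w d : ℕ} {E : ℕ → ℕ → Prop}
  {δ : ℕ → ℕ} {T : ℕ → Prop}

/-- The ascent from `y` reads only parents of vertices up to level `d`. Expansions on level `d`
change deeper vertices only, so the chains stay fixed throughout a phase. -/
theorem ChainTree.start_congr {R : ℕ → Prop} {h h' : ℕ → ℕ} (H : ChainTree R h n s d δ)
    (hs : δ s = 0) (hh : ∀ z, δ z ≤ d → h' z = h z) {y : ℕ} (hy : y < n) (hd : δ y ≤ d) :
    chainStart R h' δ y = chainStart R h δ y := by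
  suffices key : ∀ k, ∀ y < n, δ y = k → k ≤ d → chainTop R h' k y = chainTop R h k y from
    key _ y hy rfl hd
  intro k
  induction k with
  | zero => intro y _ _ _; rfl
  | succ k ih =>
    intro y hy hk hd
    have hys : y ≠ s := by rintro rfl; omega
    have hpar := H.parent hy hys (by omega)
    rw [chainTop, chainTop, hh y (by omega)]
    split_ifs
    · rfl
    · exact ih _ (H.lt hy hys (by omega)) (by omega) (by omega)

open Classical in
theorem ChainTree.size_congr {R : ℕ → Prop} {h h' : ℕ → ℕ} (H : ChainTree R h n s d δ)
    (hs : δ s = 0) (hh : ∀ z, δ z ≤ d → h' z = h z) (c : ℕ) :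
    chainSize R h' δ n d c = chainSize R h δ n d c := by
  unfold chainSize
  congr 1
  refine Finset.filter_congr fun y hy => ?_
  by_cases hd : δ y ≤ d
  · rw [H.start_congr hs hh (Finset.mem_range.1 hy) hd]
  · simp [hd]

theorem Layout.len_le (L : Layout A a b n s E δ) {u : ℕ} (hu : u < n) : A.len a u ≤ n := by
  classical
  have h := sum_positions (L.out u hu) (n := n) (fun v hv => (L.edge_lt hv).2) fun _ => 1
  have h2 : (∑ v ∈ Finset.range n, if v ∈ {v | E u v} then 1 else 0) ≤
      ∑ v ∈ Finset.range n, 1 := Finset.sum_le_sum fun v _ => by split_ifs <;> simp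
  simp only [Finset.sum_const, Finset.card_range, smul_eq_mul, mul_one] at h h2
  omega

theorem runs_emit (hoff : a ≠ b ∧ off = 0 ∨ a = b ∧ off = 1) (L : Layout A a b n s E δ)
    {σ : Mach ι} {x : ℕ} {r : Fin 24} (hr : r.val < 13) (hr4 : r ≠ 4) (hw : 16 * n + 16 ≤ 2 ^ w)
    (hg : Globals n s d σ) (h4 : σ.word 4 ≤ 2 * n)
    (hS : Searching A σ.mem a b off n s E δ d T) (h13 : σ.word r = x) (hx : x < n)
    (hxd : δ x = d) :
    Runs n w (Code.emit a b off r) σ fun σ' t => Emits σ σ' [x] ∧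
      (∀ y : Fin 24, y.val < 13 → y ≠ 4 → σ'.word y = σ.word y) ∧
      (∀ y : Fin 8, y.val < 2 → σ'.ptr y = σ.ptr y) ∧
      Searching A σ'.mem a b off n s E δ d (fun v => T v ∨ E x v) ∧
      SameUpTo δ d σ.mem σ'.mem ∧
      t + 8 * σ'.mem.potential b n ≤ 8 * σ.mem.potential b n + expandCost A b n E d x + 3 := by
  have hr13 : r ≠ 13 := by rintro rfl; simp at hr
  rw [Code.emit, runs_seq, runs_output, runs_seq, runs_op]
  simp only [WordOp.eval, hg.w2]
  refine ⟨by omega, ?_⟩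
  rw [runs_seq, runs_copy]
  simp only [Function.update_of_ne hr4, h13]
  refine ⟨by omega, ?_⟩
  refine Runs.mono (runs_expand (d := d) (T := T) (x := x) hoff L hw ?_ (by exact hS) (by simp) hx
    hxd) ?_
  · constructor <;> simp [hg.w0, hg.w1, hg.w2, hg.w3, hg.w7]
  rintro σ' t ⟨hk, hs, hu, ht⟩
  have hword : ∀ y : Fin 24, y.val < 13 → y ≠ 4 → σ'.word y = σ.word y := by
    intro y hy hy4
    have : y ≠ 13 := by rintro rfl; simp at hy
    rw [hk.word y hy]
    simp only [Function.update_of_ne this, Function.update_of_ne hy4]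
  refine ⟨⟨fun y hy => hword y (by omega), ?_, ?_⟩, hword, fun y hy => hk.ptr y hy, hs, hu, ?_⟩
  · rw [hk.word 4 (by decide)]
    simp
  · simpa [h13] using hk.out
  · simp only at ht ⊢
    omega

open Classical in
-- Each chain below `r` is found through its start, a child of `r` that is not a root. The scan may
-- stop at the first node from position `5` on that is no such child, by `hgr`; the positions before
-- are used as bits and are not grouped. So the time depends on the number of chains and their
-- sizes, and not on the degree of `r`.
theorem runs_serve (hoff : a ≠ b ∧ off = 0 ∨ a = b ∧ off = 1) (L : Layout A a b n s E δ)
    {σ : Mach ι} {r : ℕ} (hw : 16 * n + 16 ≤ 2 ^ w) (hg : Globals n s d σ)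
    (h4 : σ.word 4 ≤ n) (hS : Searching A σ.mem a b off n s E δ d T) (hdn : d < n)
    (h5 : σ.word 5 = r) (h6 : σ.word 6 = δ r) (hr : r < n) (hrR : IsRoot A a off s r)
    (hrd : δ r < d) (hgr : Grouped σ.mem a r
      fun c => ¬ IsRoot A a off s c ∧ σ.mem.val b c 0 = r) :
    Runs n w (Code.serve a b off) σ fun σ' t => ∃ os : List ℕ, Emits σ σ' os ∧ os.Nodup ∧
      (∀ y, y ∈ os ↔ y < n ∧ δ y = d ∧ ¬ IsRoot A a off s y ∧
        chainOwner (IsRoot A a off s) (fun y => σ.mem.val b y 0) δ y = r) ∧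
      (σ'.word 8 = if os = [] then 0 else 1) ∧
      Searching A σ'.mem a b off n s E δ d (fun v => T v ∨ ∃ x ∈ os, E x v) ∧
      SameUpTo δ d σ.mem σ'.mem ∧
      t + 8 * σ'.mem.potential b n ≤ 8 * σ.mem.potential b n + (os.map (expandCost A b n E d)).sum +
        serveCost (IsRoot A a off s) (fun y => σ.mem.val b y 0) δ n d r + 700 := by
  have hw1 : 1 < 2 ^ w := by omega
  have hpar : ∀ y < n, y ≠ s → δ y ≤ d → δ (σ.mem.val b y 0) + 1 = δ y :=
    fun y hy hys hyd => hS.parent y hy hys (Or.inl hyd)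
  have H := L.chainTree hoff hS.arranged hpar
  set R := IsRoot A a off s with hRdef
  set h : ℕ → ℕ := fun y => σ.mem.val b y 0 with hh
  set N := σ.mem.len a r with hN
  have hNn : N ≤ n := by rw [hN, hS.arranged.len]; exact L.len_le hr
  let f : ℕ → ℕ := σ.mem.val a r
  let P : ℕ → Prop := fun c => ¬ R c ∧ h c = r
  let c₀ : ℕ → ℕ := fun c => if P c ∧ δ c ≤ d then 100 * (1 + chainSize R h δ n d c) else 0
  let F : ℕ → ℕ := fun p => ∑ q ∈ Finset.range p, c₀ (f q)
  have hF : ∀ {p q}, p ≤ q → F p ≤ F q := fun hpq =>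
    Finset.sum_le_sum_of_subset (Finset.range_mono hpq)
  -- the state after the first `p` nodes
  let I' : ℕ → Mach ι → ℕ → ℕ → Prop := fun p σ₁ τ ex => ∃ os : List ℕ, Emits σ σ₁ os ∧ os.Nodup ∧
    (∀ y, y ∈ os ↔ y < n ∧ δ y = d ∧ ¬ R y ∧ ∃ q < p, P (f q) ∧ chainStart R h δ y = f q) ∧
    (σ₁.word 8 = if os = [] then 0 else 1) ∧
    Searching A σ₁.mem a b off n s E δ d (fun v => T v ∨ ∃ x ∈ os, E x v) ∧
    SameUpTo δ d σ.mem σ₁.mem ∧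
    τ + 8 * σ₁.mem.potential b n ≤ 8 * σ.mem.potential b n + (os.map (expandCost A b n E d)).sum +
      F p + 3 + 100 * ex
  -- A node that starts a chain is paid for by `F`. At most five other nodes are passed, at
  -- positions below `5`; the sixth unit in `J` pays for the node that ends the scan.
  let I : ℕ → Mach ι → ℕ → Prop := fun p σ₁ τ => σ₁.word 9 = p ∧ I' p σ₁ τ (min p 5)
  let J : Mach ι → ℕ → Prop := fun σ₁ τ => I' N σ₁ τ 6
  rw [Code.serve, runs_seq, runs_const]
  refine ⟨by omega, ?_⟩
  rw [runs_seq, runs_const]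
  refine ⟨by omega, ?_⟩
  refine Runs.mono (Q := J) ?_ ?_
  · refine runs_scan r N I J hw1 (by decide) (by simpa using h5) hr (by simpa using hg.w2) rfl
      ?_ ?_ ?_ ?_
    · rintro p σ₁ τ q c ⟨h9, os, he, hrest⟩
      refine ⟨by simpa using h9, os, ?_, hrest.1, hrest.2.1, by simpa using hrest.2.2.1,
        hrest.2.2.2⟩
      exact he.keep (lo := 8) (plo := 0) (((Keeps.refl _).setPtr (x := 0) (Nat.zero_le _)).setWord
        (x := 10) (by decide))
    · refine ⟨by simp, [], ?_, by simp, by simp, by simp, ?_, SameUpTo.refl, by simp; omega⟩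
      · exact (((Keeps.refl (lo := 8) (plo := 0) σ).setWord (x := 8) (by decide)).setWord (x := 9)
          (by decide)).emits
      · simpa using hS
    · rintro p hp σ₁ τ ⟨h9, os, he, hnd, hos, h8, hs₁, hu, hτ⟩ hp0 hf h2 hl
      have hg₁ := he.globals hg
      have hR₁ := hs₁.arranged
      have hosn : os.length ≤ n := by
        have := (List.toFinset_card_of_nodup hnd).symm
        have h2 : os.toFinset ⊆ Finset.range n := fun y hy =>
          Finset.mem_range.2 ((hos y).1 (List.mem_toFinset.1 hy)).1
        have := Finset.card_le_card h2
        simp only [Finset.card_range] at this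
        omega
      set c := f p with hc
      have hEc : E r c := hS.arranged.out_mem hr hp
      have hcn := (L.edge_lt hEc).2
      have hcd : δ c ≤ d := by have := L.dist_edge hEc; omega
      have hval : σ₁.mem.val a r p = c := by rw [hu r hrd.le]
      have hhd : ∀ z, δ z ≤ d → σ₁.mem.val b z 0 = h z := fun z hz => by rw [hu z hz]
      have hF1 : F (p + 1) = F p + c₀ c := Finset.sum_range_succ _ _
      rw [runs_seq, runs_load]
      refine ⟨a, r, p, hp0, by omega, ?_⟩
      rw [runs_seq, runs_copy]
      simp only [hval, Function.update_self]
      refine ⟨by omega, ?_⟩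
      rw [runs_seq, runs_copy]
      have h5₁ : σ₁.word 5 = r := (he.word 5 (by decide) (by decide)).trans h5
      refine ⟨by simp [h5₁]; omega, ?_⟩
      refine Runs.seq (runs_isChild (by omega) L hw (c := c) (r := r) (by exact hR₁) ?_ ?_ ?_ hcn)
        ?_
      · simp [hg₁.w1]
      · simp
      · simp [h5₁]
      rintro σ₂ t₂ ⟨hk₂, hm₂, h18, ht₂⟩
      have hm₂ : σ₂.mem = σ₁.mem := hm₂
      have k2 : Keeps 11 2 σ₁ σ₂ := ((((Keeps.refl (lo := 11) (plo := 2) σ₁).setWord (x := 11)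
        (a := c) (by decide)).setWord (x := 16) (a := c) (by decide)).setWord (x := 17)
        (by decide)).trans (hk₂.mono (by decide) (by decide))
      have he₂ : Emits σ σ₂ os := he.keep k2
      have hg₂ := he₂.globals hg
      have h11₂ : σ₂.word 11 = c := by rw [hk₂.word 11 (by decide)]; simp
      have h9₂ : σ₂.word 9 = p := by rw [k2.word 9 (by decide), h9]
      have h8₂ : σ₂.word 8 = _ := (k2.word 8 (by decide)).trans h8
      have h10₂ : σ₂.word 10 = 1 := by rw [k2.word 10 (by decide), hf]
      have hp0₂ : σ₂.ptr 0 = some (a, r, p) := by rw [k2.ptr 0 (by decide), hp0]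
      have h6₂ : σ₂.word 6 = δ r := by rw [he₂.word 6 (by decide) (by decide), h6]
      -- which vertices are treated in this iteration
      have hnone : (∀ y < n, δ y = d → ¬ R y → P c → chainStart R h δ y ≠ c) →
          ∀ y, y ∈ os ↔ y < n ∧ δ y = d ∧ ¬ R y ∧
            ∃ q < p + 1, P (f q) ∧ chainStart R h δ y = f q := by
        intro hno y
        rw [hos]
        constructor
        · rintro ⟨h1, h2, h3, q, h4, h5⟩
          exact ⟨h1, h2, h3, q, by omega, h5⟩
        · rintro ⟨h1, h2, h3, q, h4, h5, h6⟩
          rcases Nat.lt_succ_iff_lt_or_eq.1 h4 with h4 | rfl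
          · exact ⟨h1, h2, h3, q, h4, h5, h6⟩
          · exact absurd h6 (hno y h1 h2 h3 h5)
      rw [runs_seq]
      by_cases hPc : P c
      · have h18' : σ₂.word 18 = 1 := by
          rw [h18, if_pos]
          exact ⟨hPc.1, (hhd c hcd).trans hPc.2⟩
        have hc₀ : c₀ c = 100 * (1 + chainSize R h δ n d c) := if_pos ⟨hPc, hcd⟩
        have hcp : R (h c) := by rw [hPc.2]; exact hrR
        have hcs : c ≠ s := H.ne_source hPc.1
        have hcδ : δ c = δ r + 1 := by
          have := H.parent hcn hcs hcd
          rw [hPc.2] at this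
          exact this.symm
        apply Runs.iteTrue (by simp [Cond.Holds, h18', hg₂.w2])
        rw [runs_seq, runs_op]
        simp only [WordOp.eval, h6₂, hg₂.w2]
        refine ⟨by omega, ?_⟩
        have H₁ := L.chainTree hoff hR₁ fun y hy hys hyd => hs₁.parent y hy hys (Or.inl hyd)
        rw [runs_seq]
        refine Runs.mono (runs_descend (c := c) hoff L hw (hg₂.keep (lo := 11) (plo := 2)
          ((Keeps.refl _).setWord (by decide))) ?_ ?_ hdn ?_ ?_ hcn hPc.1 ?_ hcd) ?_
        · simp only [hm₂]; exact hR₁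
        · intro y hy hys hyd
          simp only [hm₂]
          exact hs₁.parent y hy hys (Or.inl hyd)
        · simpa using h11₂
        · simp [hcδ]
        · simp only [hm₂, hhd c hcd]; exact hcp
        rintro σ₃ t₃ ⟨hk₃, hm₃, ht₃, hor⟩
        simp only [hm₂] at hm₃ ht₃ hor
        rw [← hRdef, H.size_congr L.dist_source hhd] at ht₃
        have k3 : Keeps 11 2 σ₂ σ₃ := ((Keeps.refl _).setWord (by decide)).trans hk₃
        have he₃ : Emits σ σ₃ os := he₂.keep k3
        have hg₃ := he₃.globals hg
        have h9₃ : σ₃.word 9 = p := by rw [k3.word 9 (by decide), h9₂]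
        have h10₃ : σ₃.word 10 = 1 := by rw [k3.word 10 (by decide), h10₂]
        have hp0₃ : σ₃.ptr 0 = some (a, r, p) := by rw [k3.ptr 0 (by decide), hp0₂]
        rcases hor with ⟨hxn, hxR, hxd, hxs⟩ | ⟨hxn, hno⟩
        · set x := σ₃.word 11 with hx
          have hxs' : chainStart R h δ x = c := by
            rw [← hxs]; exact (H.start_congr L.dist_source hhd hxn hxd.le).symm
          apply Runs.iteFalse (by simp [Cond.Holds, hg₃.w0, ← hx]; omega)
          rw [runs_seq, runs_const]
          refine ⟨hw1, ?_⟩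
          have hg₃' : Globals n s d
              ({ σ₃ with word := Function.update σ₃.word 8 1 } : Mach ι) :=
            hg₃.keep (lo := 8) (plo := 2) ((Keeps.refl _).setWord (by decide))
          refine Runs.mono (runs_emit (r := 11) (x := x) hoff L (by decide) (by decide) hw hg₃' ?_
            ?_ ?_ hxn hxd (T := fun v => T v ∨ ∃ x ∈ os, E x v)) ?_
          · simp [he₃.count]; omega
          · simp only [hm₃]; exact hs₁
          · simp [← hx]
          rintro σ₄ t₄ ⟨he₄, hw₄, hp₄, hs₄, hu₄, ht₄⟩
          simp only [hm₃] at hu₄ ht₄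
          rw [runs_op]
          have h9₄ : σ₄.word 9 = p := by
            rw [hw₄ 9 (by decide) (by decide)]; simpa using h9₃
          have h2₄ : σ₄.word 2 = 1 := (he₄.globals hg₃').w2
          simp only [WordOp.eval, h9₄, h2₄]
          have he₃' : Emits σ ({ σ₃ with word := Function.update σ₃.word 8 1 } : Mach ι) os :=
            he₃.keep (lo := 8) (plo := 2) ((Keeps.refl _).setWord (by decide))
          -- Vertices found earlier belong to chains that start at other positions of the list,
          -- hence at other vertices.
          have hxos : x ∉ os := by
            rw [hos]
            rintro ⟨-, -, -, q, hq, -, hq'⟩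
            have := (hS.arranged.out_inj hr) (show q < σ.mem.len a r by omega) hp
              (hq'.symm.trans hxs')
            omega
          refine ⟨by omega, by simp [h2₄], ?_, Or.inl ⟨?_, ?_, by simp, os ++ [x], ?_, ?_, ?_, ?_,
            ?_, ?_, ?_⟩⟩
          · simp only [hs₄.arranged.len, hN, hS.arranged.len]
          · simp only [hp₄ 0 (by decide), hp0₃]
          · simp [hw₄ 10 (by decide) (by decide), h10₃]
          · exact (he₃'.trans he₄).keep (lo := 8) (plo := 2) ((Keeps.refl _).setWord (by decide))
          · rw [List.nodup_append]
            exact ⟨hnd, by simp, fun y hy z hz => by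
              rintro rfl
              exact hxos (by simp at hz; exact hz ▸ hy)⟩
          · intro y
            rw [List.mem_append, List.mem_singleton, hos]
            constructor
            · rintro (⟨h1, h2, h3, q, h4, h5⟩ | rfl)
              · exact ⟨h1, h2, h3, q, by omega, h5⟩
              · exact ⟨hxn, hxd, hxR, p, by omega, hPc, hxs'⟩
            · rintro ⟨h1, h2, h3, q, h4, h5, h6⟩
              rcases Nat.lt_succ_iff_lt_or_eq.1 h4 with h4 | rfl
              · exact Or.inl ⟨h1, h2, h3, q, h4, h5, h6⟩
              · exact Or.inr (H.eq_of_start_eq h1 hxn h3 hxR h2.le (h2.trans hxd.symm)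
                  (h6.trans hxs'.symm))
          · simp [hw₄ 8 (by decide) (by decide)]
          · have : (fun v => T v ∨ ∃ z ∈ os ++ [x], E z v) =
                fun v => (T v ∨ ∃ z ∈ os, E z v) ∨ E x v := by
              funext v
              simp only [List.mem_append, List.mem_singleton, or_and_right, exists_or,
                exists_eq_left, or_assoc]
            rw [this]
            exact hs₄
          · exact hu.trans hu₄
          · simp only [List.map_append, List.sum_append, List.map_singleton, List.sum_singleton]
            have : min p 5 ≤ min (p + 1) 5 := min_le_min_right _ (by omega)
            omega
        · apply Runs.iteTrue (by simp [Cond.Holds, hg₃.w0, hxn])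
          rw [runs_skip, runs_op]
          simp only [WordOp.eval, h9₃, hg₃.w2]
          refine ⟨by omega, by simp [hg₃.w2], ?_, Or.inl ⟨hp0₃, by simpa using h10₃, by simp, os,
            ?_, hnd, hnone fun y h1 h2 h3 _ h5 => ?_, ?_, ?_, ?_, ?_⟩⟩
          · simp only [hm₃, hl]
          · exact he₃.keep (lo := 8) (plo := 2) ((Keeps.refl _).setWord (by decide))
          · refine hno y h1 h3 ?_ h2
            rw [← h5]
            exact H.start_congr L.dist_source hhd h1 h2.le
          · simpa [k3.word 8 (by decide)] using h8₂
          · simp only [hm₃]; exact hs₁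
          · simp only [hm₃]; exact hu
          · simp only [hm₃]
            have : min p 5 ≤ min (p + 1) 5 := min_le_min_right _ (by omega)
            omega
      · have h18' : σ₂.word 18 = 0 := by
          rw [h18, if_neg]
          exact fun h => hPc ⟨h.1, (hhd c hcd).symm.trans h.2⟩
        apply Runs.iteFalse (by simp [Cond.Holds, h18', hg₂.w2])
        rw [runs_seq, runs_const]
        refine ⟨by omega, ?_⟩
        by_cases hp5 : p < 5
        · apply Runs.iteTrue (by simp [Cond.Holds, h9₂, hp5])
          rw [runs_skip, runs_op]
          have e9 : Function.update σ₂.word 19 5 9 = p := by simp [h9₂]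
          have e2 : Function.update σ₂.word 19 5 2 = 1 := by simp [hg₂.w2]
          simp only [WordOp.eval, e9, e2]
          refine ⟨by omega, by simp [hg₂.w2], ?_, Or.inl ⟨hp0₂, by simpa using h10₂, by simp, os,
            ?_, hnd, hnone fun y h1 h2 h3 h4 h5 => hPc h4, by simpa using h8₂, ?_, ?_, ?_⟩⟩
          · simp only [hm₂, hl]
          · exact he₂.keep (lo := 8) (plo := 2) (((Keeps.refl _).setWord (by decide)).setWord
              (by decide))
          · simp only [hm₂]; exact hs₁
          · simp only [hm₂]; exact hu
          · simp only [hm₂]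
            rw [min_eq_left (by omega)] at hτ ⊢
            omega
        · apply Runs.iteFalse (by simp [Cond.Holds, h9₂]; omega)
          rw [runs_const]
          refine ⟨by omega, ?_⟩
          rw [runs_op]
          have e9 : Function.update (Function.update σ₂.word 19 5) 10 0 9 = p := by simp [h9₂]
          have e2 : Function.update (Function.update σ₂.word 19 5) 10 0 2 = 1 := by simp [hg₂.w2]
          simp only [WordOp.eval, e9, e2]
          refine ⟨by omega, by simp [hg₂.w2], ?_, Or.inr ⟨by simp, os, ?_, hnd, ?_,
            by simpa using h8₂, ?_, ?_, ?_⟩⟩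
          · simp only [hm₂, hl]
          · exact he₂.keep (lo := 8) (plo := 2) ((((Keeps.refl _).setWord (by decide)).setWord
              (by decide)).setWord (by decide))
          · intro y
            rw [hos]
            constructor
            · rintro ⟨h1, h2, h3, q, h4, h5⟩
              exact ⟨h1, h2, h3, q, by omega, h5⟩
            · rintro ⟨h1, h2, h3, q, h4, h5, h6⟩
              by_cases hqp : q < p
              · exact ⟨h1, h2, h3, q, hqp, h5, h6⟩
              · exfalso
                -- The node at position `p ≥ 5` starts no chain, so by the grouping no later node
                -- does.
                rcases (not_lt.1 hqp).eq_or_lt with rfl | hlt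
                · exact hPc h5
                · exact hPc (hgr p q (by omega) hlt h4 h5)
          · simp only [hm₂]; exact hs₁
          · simp only [hm₂]; exact hu
          · simp only [hm₂]
            have := hF hp.le
            rw [min_eq_right (by omega)] at hτ
            omega
    · rintro σ₁ τ ⟨h9, os, he, hnd, hos, h8, hs₁, hu, hτ⟩
      refine ⟨os, he, hnd, hos, h8, hs₁, hu, ?_⟩
      have : min N 5 ≤ 5 := min_le_right _ _
      omega
  · rintro σ' t ⟨os, he, hnd, hos, h8, hs₁, hu, hτ⟩
    refine ⟨os, he, hnd, fun y => ?_, h8, hs₁, hu, ?_⟩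
    · rw [hos]
      refine and_congr_right fun hyn => and_congr_right fun hyd => and_congr_right fun hyR => ?_
      rw [chainOwner, if_neg hyR]
      obtain ⟨hcn, hcR, hcp, -⟩ := H.start_spec hyn hyR hyd.le
      constructor
      · rintro ⟨q, -, hPq, hq⟩
        rw [hq]
        exact hPq.2
      · intro hr'
        have hEc : E r (chainStart R h δ y) := by
          rw [← hr']
          exact hS.arranged.inn_mem hcn (by
            rw [hS.arranged.len]; exact L.len_pos hcn (H.ne_source hcR))
        obtain ⟨q, hq, hqc⟩ := (hS.arranged.out r hr).surjOn hEc
        refine ⟨q, by rw [hN, hS.arranged.len]; exact hq, ?_⟩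
        have hqc' : f q = chainStart R h δ y := hqc
        rw [hqc']
        exact ⟨⟨hcR, hr'⟩, rfl⟩
    · have hsum := sum_positions (hS.arranged.out r hr) (n := n) (fun v hv => (L.edge_lt hv).2) c₀
      have hFN : F N ≤ serveCost R h δ n d r := by
        simp only [F, hN, hS.arranged.len]
        refine hsum.le.trans (Finset.sum_le_sum fun c _ => ?_)
        by_cases h1 : c ∈ {v | E r v}
        · rw [if_pos h1]
          simp only [c₀, P, and_assoc]
          exact le_rfl
        · rw [if_neg h1]
          exact Nat.zero_le _
      omega

end Serve

/-! ### One level of the search -/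

/-- Treat the vertices of level `d` on the vertex in register `5` and the chains below it, if this
vertex is the source or active. -/
def Code.visit {ι : Type} (a b : ι) (off : ℕ) : Code ι :=
  .instr (.copy 16 5) ;; Code.testPair a off ;; .ite (.eq 5 1) (.instr (.const 18 1)) .skip ;;
    .ite (.eq 18 2)
      (.instr (.copy 16 5) ;; Code.walk b ;; .instr (.copy 6 18) ;;
        .ite (.lt 6 3)
          (.ite (.eq 6 7) (Code.emit a b off 5)
            (.instr (.op .add 19 6 2) ;; .ite (.eq 19 7) (Code.group a b off) .skip ;;
              Code.serve a b off ;; .instr (.const 19 0) ;;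
              .ite (.eq 8 19) (.instr (.copy 16 5) ;; Code.setPair a off 0) .skip))
          .skip)
      .skip

/-- The state of the search at level `d`, with the parent function `h` up to level `d`, when all
vertices smaller than `v` have been visited. -/
structure AtLevel {ι : Type} (A : AdjLists ι) (a b : ι) (off n s : ℕ) (E : ℕ → ℕ → Prop)
    (δ : ℕ → ℕ) (d : ℕ) (h : ℕ → ℕ) (v : ℕ) (σ : Mach ι) : Prop where
  globals : Globals n s d σ
  searching : Searching A σ.mem a b off n s E δ d fun u =>
    ∃ x < n, δ x = d ∧ chainOwner (IsRoot A a off s) h δ x < v ∧ E x u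
  parent : ∀ y, δ y ≤ d → σ.mem.val b y 0 = h y
  nodup : σ.out.Nodup
  mem_out : ∀ y, y ∈ σ.out ↔
    y < n ∧ (δ y < d ∨ δ y = d ∧ chainOwner (IsRoot A a off s) h δ y < v)
  sorted : σ.out.Pairwise fun x y => δ x ≤ δ y
  count : σ.word 4 = σ.out.length
  live : ∀ y < n, δ y = d → chainOwner (IsRoot A a off s) h δ y = s ∨
    σ.mem.pairState a (chainOwner (IsRoot A a off s) h δ y) off = 1
  active : ∀ u < n, δ u ≤ d → σ.mem.pairState a u off = 1 →
    (u < v ∧ ∃ y < n, δ y = d ∧ chainOwner (IsRoot A a off s) h δ y = u) ∨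
    (v ≤ u ∧ (δ u = d ∨ ∃ y < n, δ y + 1 = d ∧ chainOwner (IsRoot A a off s) h δ y = u))
  grouped : ∀ u < n, (u = s ∨ σ.mem.pairState a u off = 1) →
    (δ u + 1 < d ∨ δ u + 1 = d ∧ u < v) →
    Grouped σ.mem a u fun c => ¬ IsRoot A a off s c ∧ h c = u

section Visit

variable {ι : Type} {A M M' : AdjLists ι} {a b : ι} {off n s w d v : ℕ} {E : ℕ → ℕ → Prop}
  {δ h : ℕ → ℕ} {T : ℕ → Prop} {σ σ' : Mach ι}

/-- Covers grouping and deactivation: they affect neither the parents nor the discovery bits, nor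
the activity bits beyond level `d`. -/
theorem Searching.transfer (hS : Searching A M a b off n s E δ d T)
    (hR : Arranged A M' a b n E) (h0 : ∀ u, M'.val b u 0 = M.val b u 0)
    (h3 : ∀ u, M'.pairState b u 3 = M.pairState b u 3)
    (ho : ∀ u, d < δ u → M'.pairState a u off = M.pairState a u off) :
    Searching A M' a b off n s E δ d T := by
  refine ⟨hR, fun u hu hus hd => ?_, fun u hu hus hl => ?_, fun u hu hus hl hT hd => ?_,
    fun u hu hus hd hact => ?_⟩
  · rw [h0]; exact hS.parent u hu hus hd
  · rw [h3]; exact hS.found u hu hus hl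
  · rw [ho u (show d < δ u by omega)]; exact hS.active u hu hus hl hT hd
  · rw [ho u hd] at hact; exact hS.quiet u hu hus hd hact

theorem AdjLists.potential_congr (hl : M'.len = M.len)
    (h3 : ∀ u, M'.pairState b u 3 = M.pairState b u 3) : M'.potential b n = M.potential b n := by
  simp only [AdjLists.potential, h3, hl]

theorem TailOnly.pairState (hT : TailOnly M M' a v) (hl : M'.len = M.len) (i : ι) (u : ℕ)
    {p : ℕ} (hp : p ≤ 3) : M'.pairState i u p = M.pairState i u p :=
  AdjLists.pairState_congr (by rw [hl]) (hT.front' i u (q := p) (by omega))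
    (hT.front' i u (q := p + 1) (by omega))

theorem AdjLists.setPair_off (hoff : a ≠ b ∧ off = 0 ∨ a = b ∧ off = 1) (β : ℕ) :
    (∀ u, (M.setPair a v off β).val b u 0 = M.val b u 0) ∧
      (∀ u, (M.setPair a v off β).pairState b u 3 = M.pairState b u 3) := by
  constructor
  · intro u
    by_cases hc : b = a ∧ u = v
    · obtain ⟨rfl, rfl⟩ := hc
      have h1 : off = 1 := by simpa using hoff
      exact AdjLists.setPair_val_of_ne_ne (by omega) (by omega)
    · rw [AdjLists.setPair_val_ne (by tauto)]
  · intro u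
    apply AdjLists.pairState_setPair_ne
    by_cases hc : b = a
    · subst hc
      omega
    · exact Or.inl hc

theorem AtLevel.chainTree (hA : AtLevel A a b off n s E δ d h v σ)
    (hoff : a ≠ b ∧ off = 0 ∨ a = b ∧ off = 1) (L : Layout A a b n s E δ) :
    ChainTree (IsRoot A a off s) h n s d δ := by
  have H := L.chainTree hoff hA.searching.arranged fun y hy hys hyd =>
    hA.searching.parent y hy hys (Or.inl hyd)
  refine ⟨fun hy hys hyd => ?_, fun hy hys hyd => ?_, H.source,
    fun {y z} hy hz hys hzs hyd hzd => ?_⟩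
  · rw [← hA.parent _ hyd]; exact H.lt hy hys hyd
  · rw [← hA.parent _ hyd]; exact H.parent hy hys hyd
  · rw [← hA.parent _ hyd, ← hA.parent _ hzd]
    exact H.unique hy hz hys hzs hyd hzd

theorem ChainTree.owner_congr {R : ℕ → Prop} {h' : ℕ → ℕ} (H : ChainTree R h n s d δ)
    (hs : δ s = 0) (hh : ∀ z, δ z ≤ d → h' z = h z) {y : ℕ} (hy : y < n) (hd : δ y ≤ d) :
    chainOwner R h' δ y = chainOwner R h δ y := by
  by_cases hR : R y
  · simp only [chainOwner, if_pos hR]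
  · have := H.start_spec hy hR hd
    simp only [chainOwner, if_neg hR, H.start_congr hs hh hy hd, hh _ (this.2.2.2.trans hd)]

theorem ChainTree.owner_lt {R : ℕ → Prop} (H : ChainTree R h n s d δ) {y : ℕ} (hy : y < n)
    (hd : δ y ≤ d) : chainOwner R h δ y < n := by
  by_cases hR : R y
  · rwa [chainOwner, if_pos hR]
  · obtain ⟨h1, h2, -, h4⟩ := H.start_spec hy hR hd
    rw [chainOwner, if_neg hR]
    exact H.lt h1 (H.ne_source h2) (h4.trans hd)

/-- A chain hangs strictly below its owner. Hence a root on level `d` contributes only itself to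
this level, and a root further up only vertices of its chains. -/
theorem ChainTree.owner_dist {R : ℕ → Prop} (H : ChainTree R h n s d δ) {y : ℕ} (hy : y < n)
    (hd : δ y ≤ d) (hR : ¬ R y) : δ (chainOwner R h δ y) < δ y := by
  obtain ⟨h1, h2, -, h4⟩ := H.start_spec hy hR hd
  have := H.parent h1 (H.ne_source h2) (h4.trans hd)
  rw [chainOwner, if_neg hR]
  omega

theorem ChainTree.owner_dist_le {R : ℕ → Prop} (H : ChainTree R h n s d δ) {y : ℕ} (hy : y < n)
    (hd : δ y ≤ d) : δ (chainOwner R h δ y) ≤ δ y := by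
  by_cases hR : R y
  · rw [chainOwner, if_pos hR]
  · exact (H.owner_dist hy hd hR).le

/-- The effect of visiting `v`, which outputs the vertices in `os`. -/
theorem AtLevel.step (hA : AtLevel A a b off n s E δ d h v σ)
    (H : ChainTree (IsRoot A a off s) h n s d δ)
    {os : List ℕ} (he : Emits σ σ' os) (hnd : os.Nodup)
    (hos : ∀ y, y ∈ os ↔ y < n ∧ δ y = d ∧ chainOwner (IsRoot A a off s) h δ y = v)
    (hS : Searching A σ'.mem a b off n s E δ d fun u =>
      (∃ x < n, δ x = d ∧ chainOwner (IsRoot A a off s) h δ x < v ∧ E x u) ∨ ∃ x ∈ os, E x u)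
    (hpar : ∀ y, δ y ≤ d → σ'.mem.val b y 0 = σ.mem.val b y 0)
    (hother : ∀ u, δ u ≤ d → u ≠ v → ∀ i, σ'.mem.val i u = σ.mem.val i u)
    (hlive : os ≠ [] → v = s ∨ σ'.mem.pairState a v off = 1)
    (hactive : δ v ≤ d → σ'.mem.pairState a v off = 1 → os ≠ [])
    (hgrouped : v = s ∨ σ'.mem.pairState a v off = 1 → δ v + 1 ≤ d →
      Grouped σ'.mem a v fun c => ¬ IsRoot A a off s c ∧ h c = v) :
    AtLevel A a b off n s E δ d h (v + 1) σ' := by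
  have hlen : σ'.mem.len = σ.mem.len := by rw [hS.arranged.len, hA.searching.arranged.len]
  have hpair : ∀ u, δ u ≤ d → u ≠ v → σ'.mem.pairState a u off = σ.mem.pairState a u off :=
    fun u hu huv => AdjLists.pairState_congr (by rw [hlen]) (by rw [hother u hu huv])
      (by rw [hother u hu huv])
  refine ⟨he.globals hA.globals, ?_, fun y hy => (hpar y hy).trans (hA.parent y hy), ?_,
    fun y => ?_, ?_, ?_, fun y hy hyd => ?_, fun u hu hud hact => ?_, fun u hu hact hud => ?_⟩
  · refine hS.congr fun u _ _ => ?_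
    simp only [hos, Nat.lt_succ_iff_lt_or_eq]
    constructor
    · rintro ⟨x, h1, h2, h3 | h3, h4⟩
      · exact Or.inl (Or.inl ⟨x, h1, h2, h3, h4⟩)
      · exact Or.inl (Or.inr ⟨x, ⟨h1, h2, h3⟩, h4⟩)
    · rintro ((⟨x, h1, h2, h3, h4⟩ | ⟨x, ⟨h1, h2, h3⟩, h4⟩) | ⟨h1, -⟩)
      · exact ⟨x, h1, h2, Or.inl h3, h4⟩
      · exact ⟨x, h1, h2, Or.inr h3, h4⟩
      · exact h1
  · rw [he.out, List.nodup_append]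
    refine ⟨hA.nodup, hnd, fun x hx y hy => ?_⟩
    rintro rfl
    have h1 := ((hA.mem_out x).1 hx).2
    have h2 := (hos x).1 hy
    omega
  · rw [he.out, List.mem_append, hA.mem_out, hos]
    constructor
    · rintro (⟨h1, h2⟩ | ⟨h1, h2, h3⟩)
      · exact ⟨h1, by omega⟩
      · exact ⟨h1, by omega⟩
    · rintro ⟨h1, h2⟩
      by_cases h3 : chainOwner (IsRoot A a off s) h δ y = v ∧ δ y = d
      · exact Or.inr ⟨h1, h3.2, h3.1⟩
      · exact Or.inl ⟨h1, by omega⟩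
  · rw [he.out, List.pairwise_append]
    refine ⟨hA.sorted, ?_, fun x hx y hy => ?_⟩
    · refine List.pairwise_of_forall_mem_list fun x hx y hy => ?_
      have h1 := (hos x).1 hx
      have h2 := (hos y).1 hy
      omega
    · have h1 := (hA.mem_out x).1 hx
      have h2 := (hos y).1 hy
      omega
  · rw [he.count, he.out, List.length_append, hA.count]
  · by_cases hyv : chainOwner (IsRoot A a off s) h δ y = v
    · rw [hyv]
      apply hlive
      intro h0
      have := (hos y).2 ⟨hy, hyd, hyv⟩
      simp [h0] at this
    · refine (hA.live y hy hyd).imp_right fun h1 => ?_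
      rw [hpair _ ((H.owner_dist_le hy hyd.le).trans hyd.le) hyv, h1]
  · by_cases huv : u = v
    · subst huv
      refine Or.inl ⟨by omega, ?_⟩
      obtain ⟨y, hy⟩ := List.exists_mem_of_ne_nil _ (hactive hud hact)
      exact ⟨y, (hos y).1 hy⟩
    · rw [hpair u hud huv] at hact
      rcases hA.active u hu hud hact with ⟨h1, h2⟩ | ⟨h1, h2⟩
      · exact Or.inl ⟨by omega, h2⟩
      · exact Or.inr ⟨by omega, h2⟩
  · by_cases huv : u = v
    · subst huv
      exact hgrouped hact (by omega)
    · rw [hpair u (by omega) huv] at hact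
      have := hA.grouped u hu hact (by omega)
      intro p q hp hpq hq
      rw [hlen] at hq
      simp only [hother u (by omega : δ u ≤ d) huv]
      exact this p q hp hpq hq

theorem AtLevel.count_le (hA : AtLevel A a b off n s E δ d h v σ) : σ.word 4 ≤ n := by
  rw [hA.count]
  have h1 : σ.out.toFinset ⊆ Finset.range n := fun x hx => by
    simpa using ((hA.mem_out x).1 (by simpa using hx)).1
  have h2 := Finset.card_le_card h1
  rwa [List.toFinset_card_of_nodup hA.nodup, Finset.card_range] at h2

theorem AtLevel.congr (hA : AtLevel A a b off n s E δ d h v σ) (hm : σ'.mem = σ.mem)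
    (ho : σ'.out = σ.out) (h0 : σ'.word 0 = σ.word 0) (h1 : σ'.word 1 = σ.word 1)
    (h2 : σ'.word 2 = σ.word 2) (h3 : σ'.word 3 = σ.word 3) (h4 : σ'.word 4 = σ.word 4)
    (h7 : σ'.word 7 = σ.word 7) : AtLevel A a b off n s E δ d h v σ' := by
  obtain ⟨⟨g0, g1, g2, g3, g7⟩, a1, a2, a3, a4, a5, a6, a7, a8, a9⟩ := hA
  refine ⟨⟨h0.trans g0, h1.trans g1, h2.trans g2, h3.trans g3, h7.trans g7⟩, ?_, ?_, ?_, ?_, ?_,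
    ?_, ?_, ?_, ?_⟩
  all_goals first | rw [hm] | rw [h4, ho] | rw [ho]
  all_goals assumption

/-- Only successors of `v` occur in the list. Their levels are at most `δ v + 1`, where the stored
parents and `h` can be compared. -/
theorem Grouped.congr {P Q : ℕ → Prop} (hG : Grouped M a v P) (hR : Arranged A M a b n E)
    (hv : v < n) (hPQ : ∀ c, E v c → (P c ↔ Q c)) : Grouped M a v Q := by
  intro p q hp hpq hq
  rw [← hPQ _ (hR.out_mem hv hq), ← hPQ _ (hR.out_mem hv (hpq.trans hq))]
  exact hG p q hp hpq hq

open Classical in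
/-- Bound on the time to visit `v`. -/
noncomputable def visitCost (A : AdjLists ι) (a b : ι) (off n s : ℕ) (E : ℕ → ℕ → Prop)
    (δ : ℕ → ℕ) (d : ℕ) (h : ℕ → ℕ) (v : ℕ) : ℕ :=
  40 + (if v = s ∨ δ v = d + 1 ∨ δ v = d ∨
      ∃ y < n, δ y + 1 = d ∧ chainOwner (IsRoot A a off s) h δ y = v then 6 * d + 1000 else 0) +
    (∑ x ∈ Finset.range n, if δ x = d ∧ chainOwner (IsRoot A a off s) h δ x = v then
      expandCost A b n E d x else 0) +
    (if δ v + 1 = d then 40 * A.len a v else 0) + serveCost (IsRoot A a off s) h δ n d v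

theorem sum_map_eq {os : List ℕ} (hnd : os.Nodup) {p : ℕ → Prop} [DecidablePred p]
    (hos : ∀ y, y ∈ os ↔ y < n ∧ p y) (f : ℕ → ℕ) :
    (os.map f).sum = ∑ x ∈ Finset.range n, if p x then f x else 0 := by
  rw [← Finset.sum_filter, ← List.sum_toFinset f hnd]
  congr 1
  ext y
  simp [hos]

theorem serveCost_congr {R : ℕ → Prop} {h' : ℕ → ℕ} (H : ChainTree R h n s d δ) (hs : δ s = 0)
    (hh : ∀ z, δ z ≤ d → h' z = h z) {r : ℕ} : serveCost R h' δ n d r = serveCost R h δ n d r := by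
  classical
  refine Finset.sum_congr rfl fun c _ => ?_
  by_cases hc : δ c ≤ d
  · rw [hh c hc, H.size_congr hs hh]
  · rw [if_neg (by tauto), if_neg (by tauto)]

/-- Vertices that are neither the source nor active cost constant time, as they own no vertex of
level `d` (the field `live`). For the others the level is computed first: level `d` means
`Code.emit`, a smaller level `Code.serve`, and a larger one that the vertex waits for the next
phase. -/
theorem runs_visit (hoff : a ≠ b ∧ off = 0 ∨ a = b ∧ off = 1) (L : Layout A a b n s E δ)
    (hw : 16 * n + 16 ≤ 2 ^ w) (hA : AtLevel A a b off n s E δ d h v σ) (hd : d < n)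
    (h5 : σ.word 5 = v) (hv : v < n) :
    Runs n w (Code.visit a b off) σ fun σ' t => AtLevel A a b off n s E δ d h (v + 1) σ' ∧
      σ'.word 5 = v ∧ t + 8 * σ'.mem.potential b n ≤ 8 * σ.mem.potential b n +
        visitCost A a b off n s E δ d h v := by
  classical
  have hg := hA.globals
  have hS := hA.searching
  have H := hA.chainTree hoff L
  have hoff1 : off ≤ 1 := by omega
  have hval : ∀ r < σ.mem.len a v, σ.mem.val a v r < 2 ^ w := fun r hr => by
    have := hS.arranged.out_val_lt L hv hr
    omega
  -- nothing happens
  have nothing : ∀ {σ' : Mach ι}, Keeps 8 0 σ σ' → σ'.mem = σ.mem →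
      (δ v ≤ d → ¬ (v = s ∨ σ.mem.pairState a v off = 1)) →
      AtLevel A a b off n s E δ d h (v + 1) σ' := by
    intro σ' hk hm hna
    refine hA.step H hk.emits List.nodup_nil (fun y => ?_) ?_ (fun y _ => by rw [hm])
      (fun u _ _ i => by rw [hm]) (by simp) (fun hvd h1 => ?_) (fun h1 hvd => ?_)
    · simp only [List.not_mem_nil, false_iff]
      rintro ⟨hy, hyd, rfl⟩
      exact hna ((H.owner_dist_le hy hyd.le).trans hyd.le) (hA.live y hy hyd)
    · rw [hm]
      simpa using hS
    · rw [hm] at h1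
      exact absurd (Or.inr h1) (hna hvd)
    · rw [hm] at h1
      exact absurd h1 (hna (by omega))
  rw [Code.visit, runs_seq, runs_copy]
  refine ⟨by omega, ?_⟩
  refine Runs.seq (runs_testPair (p := off) (v := v) (by omega) (by simpa using h5) hv
    (by simpa using hval)) ?_
  rintro σ₁ t₁ ⟨k1, m1, h18, -, ht1⟩
  have K1 : Keeps 16 4 σ σ₁ := (((Keeps.refl σ).setWord (x := 16) (by decide)).trans
    (k1.mono (by decide) (by decide)))
  simp only at m1 h18
  refine Runs.seq (Q := fun σ₂ t => Keeps 16 4 σ σ₂ ∧ σ₂.mem = σ.mem ∧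
    σ₂.word 18 = (if v = s then 1 else σ.mem.pairState a v off) ∧ t ≤ 2) ?_ ?_
  · have e5 := K1.word 5 (by decide)
    have e1 := K1.word 1 (by decide)
    by_cases hvs : v = s
    · apply Runs.iteTrue (by simp only [Cond.Holds]; rw [e5, e1, h5, hg.w1, hvs])
      rw [runs_const]
      exact ⟨by omega, K1.setWord (by decide), m1, by simp [hvs], le_rfl⟩
    · apply Runs.iteFalse (by simp only [Cond.Holds]; rw [e5, e1, h5, hg.w1]; exact hvs)
      rw [runs_skip]
      exact ⟨K1, m1, by simp [hvs, h18], by omega⟩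
  rintro σ₂ t₂ ⟨K2, m2, h18', ht2⟩
  have hg2 := hg.keep K2
  by_cases hact : v = s ∨ σ.mem.pairState a v off = 1
  swap
  · rw [not_or] at hact
    apply Runs.iteFalse
    · simp only [Cond.Holds]
      rw [h18', hg2.w2, if_neg hact.1]
      exact hact.2
    rw [runs_skip]
    refine ⟨nothing (K2.mono (by decide) (by decide)) m2 fun _ => not_or.2 hact, ?_, ?_⟩
    · rw [K2.word 5 (by decide), h5]
    · rw [m2, visitCost]
      omega
  apply Runs.iteTrue
  · simp only [Cond.Holds]
    rw [h18', hg2.w2]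
    split_ifs with hvs
    · rfl
    · tauto
  have hroot : IsRoot A a off s v := hact.imp_right fun h1 => by
    by_contra hl
    have := AdjLists.pairState_eq_two.2 (show σ.mem.len a v ≤ off + 1 by
      rw [hS.arranged.len]; omega)
    omega
  -- This is where the walk of cost O(d) is charged. An active vertex beyond level `d` was adopted
  -- in this phase, hence has level `d + 1`; otherwise it is on level `d` or still owned a vertex
  -- one level above `d`.
  have hcost : v = s ∨ δ v = d + 1 ∨ δ v = d ∨
      ∃ y < n, δ y + 1 = d ∧ chainOwner (IsRoot A a off s) h δ y = v := by
    by_cases hvs : v = s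
    · exact Or.inl hvs
    have hact := hact.resolve_left hvs
    by_cases hvd : δ v ≤ d
    · rcases hA.active v hv hvd hact with ⟨h1, -⟩ | ⟨-, h1 | h1⟩
      · omega
      · tauto
      · tauto
    · obtain ⟨x, -, hxd, -, hE⟩ := hS.quiet v hv hvs (by omega) hact
      have := L.dist_edge hE
      omega
  have hvc : visitCost A a b off n s E δ d h v = 40 + (6 * d + 1000) +
    (∑ x ∈ Finset.range n, if δ x = d ∧ chainOwner (IsRoot A a off s) h δ x = v then
      expandCost A b n E d x else 0) +
    (if δ v + 1 = d then 40 * A.len a v else 0) + serveCost (IsRoot A a off s) h δ n d v := by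
    rw [visitCost, if_pos hcost]
  rw [hvc]
  clear hvc hcost
  have e5 : σ₂.word 5 = v := (K2.word 5 (by decide)).trans h5
  rw [runs_seq, runs_copy, e5]
  refine ⟨by omega, ?_⟩
  refine Runs.seq (runs_walk (d := d) (y := v) L hw
    (hg2.keep ((Keeps.refl (lo := 16) (plo := 4) σ₂).setWord (x := 16) (by decide))) hd (by simpa [m2] using hS.arranged) (fun y hy hys hyd => ?_) (by simp) hv) ?_
  · simp only [m2]
    exact hS.parent y hy hys (Or.inl hyd)
  rintro σ₃ t₃ ⟨k3, m3, h18w, ht3⟩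
  have K3 : Keeps 16 4 σ σ₃ := K2.trans (((Keeps.refl σ₂).setWord (x := 16) (by decide)).trans k3)
  have m3' : σ₃.mem = σ.mem := m3.trans m2
  rw [runs_seq, runs_copy, h18w]
  refine ⟨by omega, ?_⟩
  set σ₄ : Mach ι := { σ₃ with word := Function.update σ₃.word 6 (min (δ v) (d + 1)) } with hσ₄
  have m4 : σ₄.mem = σ.mem := m3'
  have w4 : ∀ x : Fin 24, x.val < 16 → x ≠ 6 → σ₄.word x = σ.word x := fun x hx h6 => by
    rw [hσ₄]
    simp only [Function.update_of_ne h6]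
    exact K3.word x hx
  have e6 : σ₄.word 6 = min (δ v) (d + 1) := by simp [hσ₄]
  have o4 : σ₄.out = σ.out := K3.out
  have hA4 : AtLevel A a b off n s E δ d h v σ₄ := by
    refine hA.congr m4 o4 ?_ ?_ ?_ ?_ ?_ ?_ <;> exact w4 _ (by decide) (by decide)
  clear_value σ₄
  clear nothing e5 K3 k3 m3 m3' h18w K2 m2 h18' hg2 K1 k1 m1 h18
  -- A vertex adopted earlier in this phase may already be active; the walk reports `d + 1` for it
  -- and it is passed over.
  have nothing : d < δ v → AtLevel A a b off n s E δ d h (v + 1) σ₄ := by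
    intro hvd
    refine hA4.step H (Emits.refl _) List.nodup_nil (fun y => ?_) ?_ (fun y _ => rfl)
      (fun u _ _ i => rfl) (by simp) (fun h _ => by omega) (fun _ h => by omega)
    · simp only [List.not_mem_nil, false_iff]
      rintro ⟨hy, hyd, rfl⟩
      have := H.owner_dist_le hy hyd.le
      omega
    · simpa using hA4.searching
  have hg4 := hA4.globals
  have hcnt := hA4.count_le
  have f5 : σ₄.word 5 = v := (w4 5 (by decide) (by decide)).trans h5
  rw [← m4] at hact ⊢
  clear hS hg hA w4 h5 m4 o4
  by_cases hlt : δ v ≤ d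
  swap
  · apply Runs.iteFalse
    · simp only [Cond.Holds]
      rw [e6, hg4.w3]
      omega
    rw [runs_skip]
    exact ⟨nothing (by omega), f5, by omega⟩
  clear nothing
  rw [min_eq_left (by omega)] at e6
  apply Runs.iteTrue
  · simp only [Cond.Holds]
    rw [e6, hg4.w3]
    omega
  have hS := hA4.searching
  by_cases heq : δ v = d
  · apply Runs.iteTrue
    · simp only [Cond.Holds]
      rw [e6, hg4.w7, heq]
    refine Runs.mono (runs_emit (x := v) hoff L (r := 5) (by decide) (by decide) hw hg4
      (by omega) hS f5 hv heq) ?_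
    rintro σ' t ⟨he, -, -, hS', hup, ht⟩
    have hos : ∀ y, y ∈ [v] ↔ y < n ∧ δ y = d ∧ chainOwner (IsRoot A a off s) h δ y = v := by
      intro y
      rw [List.mem_singleton]
      constructor
      · rintro rfl
        exact ⟨hv, heq, if_pos hroot⟩
      · rintro ⟨hy, hyd, ho⟩
        by_cases hR : IsRoot A a off s y
        · rwa [chainOwner, if_pos hR] at ho
        · have := H.owner_dist hy hyd.le hR
          rw [ho] at this
          omega
    refine ⟨hA4.step H he (by simp) hos (by simpa using hS') (fun y hy => by rw [hup y hy])
      (fun u hu _ i => hup u hu i) (fun _ => ?_) (by simp) (fun _ h => by omega),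
      (he.word 5 (by decide) (by decide)).trans f5, ?_⟩
    · refine hact.imp_right fun h1 => ?_
      rw [← h1]
      exact AdjLists.pairState_congr (by rw [hS'.arranged.len, hS.arranged.len])
        (by rw [hup v hlt]) (by rw [hup v hlt])
    · have := sum_map_eq (p := fun y => δ y = d ∧ chainOwner (IsRoot A a off s) h δ y = v)
        (List.nodup_singleton v) hos (expandCost A b n E d)
      simp only [List.map_cons, List.map_nil, List.sum_cons, List.sum_nil, add_zero] at this
      rw [← this]
      omega
  apply Runs.iteFalse
  · simp only [Cond.Holds]
    rw [e6, hg4.w7]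
    exact heq
  have hvd : δ v < d := by omega
  rw [runs_seq, runs_op]
  simp only [WordOp.eval]
  rw [e6, hg4.w2]
  refine ⟨by omega, ?_⟩
  -- group the children when the first level below them is complete
  refine Runs.seq (Q := fun σ₅ t => Keeps 10 0 σ₄ σ₅ ∧ TailOnly σ₄.mem σ₅.mem a v ∧
    Arranged A σ₅.mem a b n E ∧ Grouped σ₅.mem a v (fun c => ¬ IsRoot A a off s c ∧ h c = v) ∧
    t ≤ (if δ v + 1 = d then 40 * A.len a v else 0) + 21) ?_ ?_
  · have k := (Keeps.refl (lo := 10) (plo := 0) σ₄).setWord (x := 19) (a := δ v + 1) (by decide)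
    by_cases hvd1 : δ v + 1 = d
    · apply Runs.iteTrue
      · simp only [Cond.Holds]
        rw [Function.update_self, Function.update_of_ne (by decide), hg4.w7, hvd1]
      refine Runs.mono (runs_group (v := v) hoff1 L hw (by exact hS.arranged) ?_ ?_ ?_ hv) ?_
      · rw [k.word 1 (by decide), hg4.w1]
      · rw [k.word 2 (by decide), hg4.w2]
      · rw [k.word 5 (by decide), f5]
      rintro σ' t ⟨hk, hT, hR, hG, ht⟩
      refine ⟨k.trans hk, hT, hR, ?_, by rw [if_pos hvd1]; omega⟩
      refine hG.congr hR hv fun c hE => ?_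
      have := L.dist_edge hE
      rw [hT.front' b c (by decide)]
      simp only
      rw [hA4.parent c (by omega)]
    · apply Runs.iteFalse
      · simp only [Cond.Holds]
        rw [Function.update_self, Function.update_of_ne (by decide), hg4.w7]
        exact hvd1
      rw [runs_skip]
      exact ⟨k, ⟨fun _ _ _ => rfl, fun _ _ => rfl⟩, hS.arranged,
        hA4.grouped v hv hact (Or.inl (by omega)), by omega⟩
  rintro σ₅ t₅ ⟨k5, hT5, hR5, hG5, ht5⟩
  have hl5 : σ₅.mem.len = σ₄.mem.len := by rw [hR5.len, hS.arranged.len]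
  have hpair5 : ∀ i u p, p ≤ 3 → σ₅.mem.pairState i u p = σ₄.mem.pairState i u p :=
    fun i u p hp => hT5.pairState hl5 i u hp
  have hS5 := hS.transfer hR5 (fun u => hT5.front' b u (by decide)) (fun u => hpair5 b u 3 le_rfl)
    (fun u _ => hpair5 a u off (by omega))
  have hpot5 : σ₅.mem.potential b n = σ₄.mem.potential b n :=
    AdjLists.potential_congr hl5 fun u => hpair5 b u 3 le_rfl
  have hhead5 : ∀ z, δ z ≤ d → σ₅.mem.val b z 0 = h z := fun z hz => by
    rw [hT5.front' b z (by decide), hA4.parent z hz]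
  refine Runs.seq (runs_serve (r := v) hoff L hw (hg4.keep k5)
    (by rw [k5.word 4 (by decide)]; exact hcnt) hS5 hd (by rw [k5.word 5 (by decide), f5])
    (by rw [k5.word 6 (by decide), e6]) hv hroot hvd ?_) ?_
  · refine hG5.congr hR5 hv fun c hE => ?_
    have := L.dist_edge hE
    rw [hhead5 c (by omega)]
  rintro σ₆ t₆ ⟨os, he, hnd, hos, h8, hS6, hup, ht6⟩
  rw [serveCost_congr H L.dist_source hhead5] at ht6
  have hos' : ∀ y, y ∈ os ↔ y < n ∧ δ y = d ∧ chainOwner (IsRoot A a off s) h δ y = v := by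
    intro y
    rw [hos]
    refine and_congr_right fun hy => and_congr_right fun hyd => ?_
    rw [H.owner_congr L.dist_source hhead5 hy hyd.le]
    constructor
    · exact fun hh => hh.2
    · refine fun hh => ⟨fun hR => ?_, hh⟩
      rw [chainOwner, if_pos hR] at hh
      subst hh
      omega
  have hl6 : σ₆.mem.len = σ₅.mem.len := by rw [hS6.arranged.len, hR5.len]
  have hsum := sum_map_eq (p := fun y => δ y = d ∧ chainOwner (IsRoot A a off s) h δ y = v)
    hnd hos' (expandCost A b n E d)
  rw [hsum] at ht6
  have he' : Emits σ₄ σ₆ os := by simpa using (k5.emits).trans he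
  have hpar6 : ∀ y, δ y ≤ d → σ₆.mem.val b y 0 = σ₄.mem.val b y 0 := fun y hy => by
    rw [hup y hy, hhead5 y hy, hA4.parent y hy]
  have hoth6 : ∀ u, δ u ≤ d → u ≠ v → ∀ i, σ₆.mem.val i u = σ₄.mem.val i u :=
    fun u hu huv i => by rw [hup u hu, hT5.other i u (Or.inr huv)]
  have hp6 : σ₆.mem.pairState a v off = σ₄.mem.pairState a v off := by
    rw [← hpair5 a v off (by omega)]
    exact AdjLists.pairState_congr (by rw [hl6]) (by rw [hup v hlt]) (by rw [hup v hlt])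
  have hG6 : Grouped σ₆.mem a v fun c => ¬ IsRoot A a off s c ∧ h c = v := by
    intro p q
    rw [hl6, hup v hlt]
    exact hG5 p q
  rw [runs_seq, runs_const]
  refine ⟨by omega, ?_⟩
  by_cases hnil : os = []
  swap
  · apply Runs.iteFalse
    · simp [Cond.Holds, h8, hnil]
    rw [runs_skip]
    refine ⟨hA4.step H (he'.keep ((Keeps.refl (lo := 8) (plo := 8) σ₆).setWord (by decide))) hnd
      hos' hS6 hpar6 hoth6 (fun _ => ?_) (fun _ _ => hnil) (fun _ _ => hG6), ?_, ?_⟩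
    · rw [hp6]
      exact hact
    · simpa using (he'.word 5 (by decide) (by decide)).trans f5
    · simp only
      omega
  apply Runs.iteTrue
  · simp [Cond.Holds, h8, hnil]
  have e56 : σ₆.word 5 = v := (he'.word 5 (by decide) (by decide)).trans f5
  rw [runs_seq, runs_copy]
  refine ⟨by simp [e56]; omega, ?_⟩
  refine Runs.mono (runs_setPair (p := off) (β := 0) (v := v) (by omega) (by omega)
    (by simp [e56]) hv fun r hr => ?_) ?_
  · have := hS6.arranged.out_val_lt L hv hr
    simp only
    omega
  rintro σ₇ t₇ ⟨k7, m7, ht7⟩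
  simp only at m7
  obtain ⟨hz0, hz3⟩ := AdjLists.setPair_off (M := σ₆.mem) (v := v) hoff 0
  have hne : ∀ u, u ≠ v → ∀ i, σ₇.mem.val i u = σ₆.mem.val i u := fun u hu i => by
    rw [m7, AdjLists.setPair_val_ne (Or.inr hu)]
  have k7' : Keeps 8 4 σ₆ σ₇ := (((Keeps.refl (lo := 8) (plo := 4) σ₆).setWord (x := 19)
    (by decide)).setWord (x := 16) (by decide)).trans (k7.mono (by decide) (by decide))
  have hS7 := hS6.transfer (M' := σ₇.mem) (by rw [m7]; exact hS6.arranged.setPair)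
    (by rw [m7]; exact hz0) (by rw [m7]; exact hz3) fun u hu => by
      rw [m7, AdjLists.pairState_setPair_ne]
      exact Or.inr (Or.inl (by rintro rfl; omega))
  have hpot7 : σ₇.mem.potential b n = σ₆.mem.potential b n := by
    rw [m7]
    exact AdjLists.potential_congr AdjLists.setPair_len hz3
  -- The bit is now `0`, or there is none, as may happen for the source.
  have hnot : σ₇.mem.pairState a v off ≠ 1 := by
    rw [m7]
    by_cases hl : off + 1 < σ₆.mem.len a v
    · rw [AdjLists.pairState_setPair (by omega) hl]
      · omega
      · exact hS6.arranged.out_inj hv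
    · rw [AdjLists.pairState_eq_two.2 (by rw [AdjLists.setPair_len]; omega)]
      omega
  refine ⟨hA4.step H (he'.keep k7') hnd hos' hS7 (fun y hy => ?_) (fun u hu huv i => ?_)
    (fun hne => absurd hnil hne) (fun _ hh => absurd hh hnot) (fun _ _ => ?_), ?_, ?_⟩
  · rw [m7, hz0, hpar6 y hy]
  · rw [hne u huv, hoth6 u hu huv]
  · intro p q hp hpq hq
    rw [m7, AdjLists.setPair_len] at hq
    have hv' : ∀ r, 5 ≤ r → σ₇.mem.val a v r = σ₆.mem.val a v r := fun r hr => by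
      rw [m7, AdjLists.setPair_val_of_ne_ne (by omega) (by omega)]
    rw [hv' p hp, hv' q (by omega)]
    exact hG6 p q hp hpq hq
  · rw [k7'.word 5 (by decide), e56]
  · omega

end Visit

/-! ### From level to level -/

/-- Treat one level. -/
def Code.phase {ι : Type} (a b : ι) (off : ℕ) : Code ι :=
  .instr (.const 5 0) ;; .loop (.lt 5 0) (Code.visit a b off ;; .instr (.op .add 5 5 2))

section Phase

variable {ι : Type} {A M M' : AdjLists ι} {a b : ι} {off n s w d v : ℕ} {E : ℕ → ℕ → Prop}
  {δ h : ℕ → ℕ} {σ σ' : Mach ι}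

theorem runs_phase (hoff : a ≠ b ∧ off = 0 ∨ a = b ∧ off = 1) (L : Layout A a b n s E δ)
    (hw : 16 * n + 16 ≤ 2 ^ w) (hA : AtLevel A a b off n s E δ d h 0 σ) (hd : d < n) :
    Runs n w (Code.phase a b off) σ fun σ' t => AtLevel A a b off n s E δ d h n σ' ∧
      t + 8 * σ'.mem.potential b n ≤ 8 * σ.mem.potential b n +
        ∑ v ∈ Finset.range n, (visitCost A a b off n s E δ d h v + 2) + 2 := by
  rw [Code.phase, runs_seq, runs_const]
  refine ⟨by omega, ?_⟩
  refine Runs.mono (Runs.count n (fun v σ' t => AtLevel A a b off n s E δ d h v σ' ∧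
    σ'.word 5 = v ∧ t + 8 * σ'.mem.potential b n ≤ 8 * σ.mem.potential b n +
      ∑ v ∈ Finset.range v, (visitCost A a b off n s E δ d h v + 2)) ?_ ?_ ?_) ?_
  · refine ⟨?_, by simp, by simp⟩
    refine hA.congr rfl rfl ?_ ?_ ?_ ?_ ?_ ?_ <;> simp
  · rintro v hv σ₁ t ⟨hA1, h5, ht⟩
    refine ⟨by simp only [Cond.Holds]; rw [h5, hA1.globals.w0]; exact hv, ?_⟩
    refine (runs_visit hoff L hw hA1 hd h5 hv).seq ?_
    rintro σ₂ t₂ ⟨hA2, h5', ht2⟩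
    rw [runs_op]
    simp only [WordOp.eval, h5', hA2.globals.w2]
    refine ⟨by omega, ?_, by simp, ?_⟩
    · refine hA2.congr rfl rfl ?_ ?_ ?_ ?_ ?_ ?_ <;> simp
    · rw [Finset.sum_range_succ]
      omega
  · rintro σ₁ t ⟨hA1, h5, -⟩
    simp only [Cond.Holds]
    rw [h5, hA1.globals.w0]
    omega
  · rintro σ₁ t ⟨t₁, rfl, hA1, -, ht⟩
    exact ⟨hA1, by omega⟩

/-- All owners are less than `n`, so every vertex of level `d` has been expanded and every vertex of
level `d + 1` adopted. Therefore the front values are correct parents up to level `d + 1`, and they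
become the new parent function. -/
theorem AtLevel.next (hoff : a ≠ b ∧ off = 0 ∨ a = b ∧ off = 1) (L : Layout A a b n s E δ)
    (hA : AtLevel A a b off n s E δ d h n σ) (hg : Globals n s (d + 1) σ')
    (hm : σ'.mem = σ.mem) (ho : σ'.out = σ.out) (h4 : σ'.word 4 = σ.word 4) :
    AtLevel A a b off n s E δ (d + 1) (fun y => σ.mem.val b y 0) 0 σ' := by
  have H := hA.chainTree hoff L
  have hS := hA.searching
  have hT : ∀ u, (∃ x < n, δ x = d ∧ chainOwner (IsRoot A a off s) h δ x < n ∧ E x u) ↔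
      ∃ x < n, δ x = d ∧ E x u := fun u =>
    ⟨fun ⟨x, h1, h2, _, h3⟩ => ⟨x, h1, h2, h3⟩,
      fun ⟨x, h1, h2, h3⟩ => ⟨x, h1, h2, H.owner_lt h1 h2.le, h3⟩⟩
  have hT1 : ∀ u < n, δ u = d + 1 →
      ∃ x < n, δ x = d ∧ chainOwner (IsRoot A a off s) h δ x < n ∧ E x u := fun u hu hud => by
    obtain ⟨x, hE, hx⟩ := L.dist_pred u hu (by rintro rfl; rw [L.dist_source] at hud; omega)
    exact (hT u).2 ⟨x, (L.edge_lt hE).1, by omega, hE⟩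
  have hT2 : ∀ u, (∃ x < n, δ x = d ∧ chainOwner (IsRoot A a off s) h δ x < n ∧ E x u) →
      δ u ≤ d + 1 := by
    rintro u ⟨x, -, hx, -, hE⟩
    have := L.dist_edge hE
    omega
  have hpar : ∀ y < n, y ≠ s → δ y ≤ d + 1 → δ (σ.mem.val b y 0) + 1 = δ y :=
    fun y hy hys hyd => hS.parent y hy hys (by
      by_cases hyd' : δ y ≤ d
      · exact Or.inl hyd'
      · exact Or.inr (hT1 y hy (by omega)))
  have H' := L.chainTree hoff hS.arranged hpar
  have hown : ∀ y < n, δ y ≤ d → chainOwner (IsRoot A a off s) (fun y => σ.mem.val b y 0) δ y =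
      chainOwner (IsRoot A a off s) h δ y := fun y hy hyd =>
    H.owner_congr L.dist_source hA.parent hy hyd
  refine ⟨hg, ?_, fun y _ => by rw [hm], by rw [ho]; exact hA.nodup, fun y => ?_,
    by rw [ho]; exact hA.sorted, by rw [h4, ho, hA.count], fun y hy hyd => ?_,
    fun u hu hud hact => ?_, fun u hu hact hud => ?_⟩
  · rw [hm]
    refine ⟨hS.arranged, fun u hu hus hud => ?_, fun u hu hus hl => ?_, fun u hu hus hl hTu => ?_,
      fun u hu hus hud hact => ?_⟩
    · refine hpar u hu hus (hud.resolve_right ?_)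
      rintro ⟨x, -, -, hx, -⟩
      omega
    · rw [hS.found u hu hus hl]
      constructor
      · rintro (h1 | h1)
        · exact Or.inl (by omega)
        · exact Or.inl (hT2 u h1)
      · rintro (h1 | ⟨x, -, -, hx, -⟩)
        · by_cases hud : δ u ≤ d
          · exact Or.inl hud
          · exact Or.inr (hT1 u hu (by omega))
        · omega
    · obtain ⟨x, -, -, hx, -⟩ := hTu
      omega
    · have := hT2 u (hS.quiet u hu hus (by omega) hact)
      omega
  · rw [ho, hA.mem_out]
    constructor
    · rintro ⟨h1, h2⟩
      exact ⟨h1, by omega⟩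
    · rintro ⟨h1, h2⟩
      refine ⟨h1, ?_⟩
      by_cases hyd : δ y = d
      · exact Or.inr ⟨hyd, H.owner_lt h1 hyd.le⟩
      · omega
  · have hys : y ≠ s := by rintro rfl; rw [L.dist_source] at hyd; omega
    rw [hm]
    by_cases hR : IsRoot A a off s y
    · right
      rw [chainOwner, if_pos hR]
      exact hS.active y hy hys (hR.resolve_left hys) (hT1 y hy hyd) hyd
    · have hx : σ.mem.val b y 0 < n := H'.lt hy hys (by omega)
      have hxd : δ (σ.mem.val b y 0) = d := by have := hpar y hy hys (by omega); omega
      -- A vertex that is not a root has the same owner as its parent. The parent lies on level `d`,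
      -- so the owner has just been kept active; this is why deactivation never loses a chain.
      have key : chainOwner (IsRoot A a off s) (fun y => σ.mem.val b y 0) δ y =
          chainOwner (IsRoot A a off s) h δ (σ.mem.val b y 0) := by
        rw [← hown _ hx hxd.le]
        by_cases hRx : IsRoot A a off s (σ.mem.val b y 0)
        · have e1 := H'.start_of_root hy hys hyd.le hRx
          rw [chainOwner, if_neg hR, e1, chainOwner, if_pos hRx]
        · have e1 := H'.start_of_not_root hy hys hyd.le hRx
          rw [chainOwner, if_neg hR, e1, chainOwner, if_neg hRx]
      rw [key]
      exact hA.live _ hx hxd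
  · rw [hm] at hact
    refine Or.inr ⟨Nat.zero_le _, ?_⟩
    by_cases hud' : δ u ≤ d
    · rcases hA.active u hu hud' hact with ⟨-, y, hy, hyd, hyo⟩ | ⟨h1, -⟩
      · exact Or.inr ⟨y, hy, by omega, by rw [hown y hy hyd.le, hyo]⟩
      · omega
    · exact Or.inl (by omega)
  · rw [hm] at hact ⊢
    refine (hA.grouped u hu hact (by omega)).congr hS.arranged hu fun c hE => ?_
    have := L.dist_edge hE
    rw [hA.parent c (by omega)]

end Phase

/-! ### The time for one level -/

section Cost

variable {ι : Type} {A : AdjLists ι} {a b : ι} {off n s d : ℕ} {E : ℕ → ℕ → Prop}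
  {δ h : ℕ → ℕ}

open Classical in
-- Each chain start has one parent, so it is charged to one root; and the chains are disjoint, so
-- their sizes add up to at most `n`.
theorem sum_serveCost_le {R : ℕ → Prop} :
    ∑ r ∈ Finset.range n, serveCost R h δ n d r ≤ 200 * n := by
  have h1 : ∑ r ∈ Finset.range n, serveCost R h δ n d r ≤
      ∑ c ∈ Finset.range n, (100 + 100 * chainSize R h δ n d c) := by
    unfold serveCost
    rw [Finset.sum_comm]
    refine Finset.sum_le_sum fun c _ => ?_
    calc _ ≤ ∑ r ∈ Finset.range n, if h c = r then 100 * (1 + chainSize R h δ n d c) else 0 := by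
          refine Finset.sum_le_sum fun r _ => ?_
          split_ifs <;> omega
      _ ≤ _ := by
          rw [Finset.sum_ite_eq]
          split_ifs <;> omega
  have h2 : ∑ c ∈ Finset.range n, chainSize R h δ n d c ≤ n := by
    have : ∑ c ∈ Finset.range n, chainSize R h δ n d c ≤
        ∑ c ∈ Finset.range n, {y ∈ Finset.range n | chainStart R h δ y = c}.card :=
      Finset.sum_le_sum fun c _ => Finset.card_le_card fun y => by
        simp only [Finset.mem_filter]; tauto
    refine this.trans ?_
    rw [Finset.sum_card_fiberwise_eq_card_filter]
    exact (Finset.card_filter_le _ _).trans (by simp)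
  rw [Finset.sum_add_distrib, ← Finset.mul_sum] at h1
  simp at h1
  omega

open Classical in
/-- The number of vertices at distance `d`. -/
noncomputable def levelSize (δ : ℕ → ℕ) (n d : ℕ) : ℕ := {y ∈ Finset.range n | δ y = d}.card

open Classical in
/-- Bound on the time to treat level `d`. -/
noncomputable def levelCost (A : AdjLists ι) (a b : ι) (n : ℕ) (E : ℕ → ℕ → Prop)
    (δ : ℕ → ℕ) (d : ℕ) : ℕ :=
  240 * n + (6 * d + 1000) * (1 + levelSize δ n (d + 1) + levelSize δ n d +
      {y ∈ Finset.range n | δ y + 1 = d}.card) +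
    (∑ x ∈ Finset.range n, if δ x = d then expandCost A b n E d x else 0) +
    40 * ∑ v ∈ Finset.range n, if δ v + 1 = d then A.len a v else 0

open Classical in
-- The visits that need a walk are counted by the source, by the levels `d` and `d + 1`, and by the
-- image of the level before `d` under `chainOwner`. Each vertex of level `d` has one owner, so its
-- expansion is counted once.
theorem sum_visitCost_le :
    ∑ v ∈ Finset.range n, visitCost A a b off n s E δ d h v ≤ levelCost A a b n E δ d := by
  unfold visitCost levelCost
  simp only [Finset.sum_add_distrib]
  have h1 := sum_serveCost_le (R := IsRoot A a off s) (h := h) (δ := δ) (n := n) (d := d)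
  have h2 : ∑ v ∈ Finset.range n, (if v = s ∨ δ v = d + 1 ∨ δ v = d ∨
      ∃ y < n, δ y + 1 = d ∧ chainOwner (IsRoot A a off s) h δ y = v then 6 * d + 1000 else 0) ≤
      (6 * d + 1000) * (1 + levelSize δ n (d + 1) + levelSize δ n d +
        {y ∈ Finset.range n | δ y + 1 = d}.card) := by
    rw [← Finset.sum_filter, Finset.sum_const, smul_eq_mul, mul_comm]
    refine Nat.mul_le_mul_left _ ?_
    refine (Finset.card_le_card (t := (({s} ∪ {y ∈ Finset.range n | δ y = d + 1}) ∪
      {y ∈ Finset.range n | δ y = d}) ∪ {y ∈ Finset.range n | δ y + 1 = d}.image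
        (chainOwner (IsRoot A a off s) h δ)) fun v => ?_).trans ?_
    · simp only [Finset.mem_filter, Finset.mem_union, Finset.mem_singleton, Finset.mem_image,
        Finset.mem_range]
      rintro ⟨hv, h1 | h1 | h1 | ⟨y, h1, h2, h3⟩⟩
      · tauto
      · tauto
      · tauto
      · exact Or.inr ⟨y, ⟨h1, h2⟩, h3⟩
    · refine (Finset.card_union_le _ _).trans (add_le_add ?_ Finset.card_image_le)
      refine (Finset.card_union_le _ _).trans (add_le_add ?_ le_rfl)
      exact (Finset.card_union_le _ _).trans (add_le_add (by simp) le_rfl)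
  have h3 : ∑ v ∈ Finset.range n, ∑ x ∈ Finset.range n,
      (if δ x = d ∧ chainOwner (IsRoot A a off s) h δ x = v then expandCost A b n E d x else 0) ≤
      ∑ x ∈ Finset.range n, if δ x = d then expandCost A b n E d x else 0 := by
    rw [Finset.sum_comm]
    refine Finset.sum_le_sum fun x _ => ?_
    by_cases hx : δ x = d
    · simp only [hx, true_and, Finset.sum_ite_eq, if_true]
      split_ifs <;> omega
    · simp [hx]
  have h4 : ∑ v ∈ Finset.range n, (if δ v + 1 = d then 40 * A.len a v else 0) =
      40 * ∑ v ∈ Finset.range n, if δ v + 1 = d then A.len a v else 0 := by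
    rw [Finset.mul_sum]
    exact Finset.sum_congr rfl fun v _ => by split_ifs <;> rfl
  rw [h4]
  simp only [Finset.sum_const, Finset.card_range, smul_eq_mul]
  omega

open Classical in
theorem Layout.len_a (L : Layout A a b n s E δ) {u : ℕ} (hu : u < n) :
    A.len a u = ∑ v ∈ Finset.range n, if E u v then 1 else 0 := by
  have := sum_positions (n := n) (L.out u hu) (fun v hv => (L.edge_lt hv).2) fun _ => 1
  simpa using this

open Classical in
theorem Layout.len_b (L : Layout A a b n s E δ) {v : ℕ} (hv : v < n) :
    A.len b v = ∑ u ∈ Finset.range n, if E u v then 1 else 0 := by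
  have := sum_positions (n := n) (L.inn v hv) (fun v hv => (L.edge_lt hv).1) fun _ => 1
  simpa using this

theorem Layout.sum_len (L : Layout A a b n s E δ) :
    ∑ u ∈ Finset.range n, A.len a u = ∑ v ∈ Finset.range n, A.len b v := by
  classical
  rw [Finset.sum_congr rfl fun u hu => L.len_a (Finset.mem_range.1 hu),
    Finset.sum_congr rfl fun u hu => L.len_b (Finset.mem_range.1 hu), Finset.sum_comm]

/-- Walks are made only along edges to vertices with at most four predecessors. Exchanging the sums
bounds them by `4 * (6 * D)` for each vertex, and the other edges cost a constant each. -/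
theorem Layout.sum_expandCost_le (L : Layout A a b n s E δ) {D : ℕ} :
    ∑ x ∈ Finset.range n, expandCost A b n E D x ≤
      200 * ∑ v ∈ Finset.range n, A.len a v + 24 * (n * D) + 4 * n := by
  classical
  unfold expandCost
  rw [Finset.sum_add_distrib, Finset.sum_comm, L.sum_len]
  have : ∑ v ∈ Finset.range n, ∑ x ∈ Finset.range n,
      (if E x v then (if A.len b v < 5 then 6 * D + 200 else 200) else 0) ≤
      ∑ v ∈ Finset.range n, (200 * A.len b v + 24 * D) := by
    refine Finset.sum_le_sum fun v hv => ?_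
    have h1 : ∑ x ∈ Finset.range n,
      (if E x v then (if A.len b v < 5 then 6 * D + 200 else 200) else 0) =
      A.len b v * (if A.len b v < 5 then 6 * D + 200 else 200) := by
      rw [L.len_b (Finset.mem_range.1 hv), Finset.sum_mul]
      exact Finset.sum_congr rfl fun x _ => by split_ifs <;> simp
    rw [h1]
    split_ifs with h
    · have : A.len b v * (6 * D) ≤ 4 * (6 * D) := Nat.mul_le_mul_right _ (by omega)
      rw [mul_add]
      omega
    · omega
  rw [Finset.sum_add_distrib, ← Finset.mul_sum] at this
  simp only [Finset.sum_const, Finset.card_range, smul_eq_mul] at this ⊢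
  have e : n * (24 * D) = 24 * (n * D) := by ring
  omega

theorem expandCost_mono {D x : ℕ} (hd : d ≤ D) :
    expandCost A b n E d x ≤ expandCost A b n E D x := by
  refine Nat.add_le_add_right (Finset.sum_le_sum fun v _ => ?_) _
  split_ifs <;> omega

/-- Every vertex belongs to at most one level, so a sum over all levels is at most one sum over the
vertices. -/
theorem sum_sum_ite_le (P : ℕ → ℕ → Prop) [∀ i, DecidablePred (P i)] (N : ℕ)
    (hP : ∀ i j y, P i y → P j y → i = j) (f : ℕ → ℕ) :
    ∑ i ∈ Finset.range N, ∑ y ∈ Finset.range n, (if P i y then f y else 0) ≤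
      ∑ y ∈ Finset.range n, f y := by
  rw [Finset.sum_comm]
  refine Finset.sum_le_sum fun y _ => ?_
  rw [← Finset.sum_filter, Finset.sum_const, smul_eq_mul]
  refine (Nat.mul_le_mul_right _ (Finset.card_le_one.2 fun i hi j hj => ?_)).trans (one_mul _).le
  exact hP i j y (Finset.mem_filter.1 hi).2 (Finset.mem_filter.1 hj).2

/-- The factor `4 * n` for the walks consists of one visit to the source in each of the `D + 1 ≤ n`
phases and of three families of disjoint levels. The cost of inactive vertices is O(n) per phase,
and the grouping of a list is paid for once. -/
theorem Layout.sum_levelCost_le (L : Layout A a b n s E δ) {D : ℕ} (hD : D < n) :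
    ∑ d ∈ Finset.range (D + 1), levelCost A a b n E δ d ≤
      240 * ∑ v ∈ Finset.range n, A.len a v + 4300 * (n * (D + 1)) := by
  classical
  have h1 : ∀ (P : ℕ → ℕ → Prop) [∀ i, DecidablePred (P i)],
      (∀ i j y, P i y → P j y → i = j) →
      ∑ i ∈ Finset.range (D + 1), {y ∈ Finset.range n | P i y}.card ≤ n := fun P _ hP => by
    have := sum_sum_ite_le (n := n) P (D + 1) hP fun _ => 1
    simpa only [Finset.card_filter, Finset.sum_const, Finset.card_range, smul_eq_mul, mul_one]
      using this
  have h2 : ∑ d ∈ Finset.range (D + 1), (6 * d + 1000) * (1 + levelSize δ n (d + 1) +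
      levelSize δ n d + {y ∈ Finset.range n | δ y + 1 = d}.card) ≤ (6 * D + 1000) * (4 * n) := by
    refine (Finset.sum_le_sum (g := fun d => (6 * D + 1000) * (1 + levelSize δ n (d + 1) +
      levelSize δ n d + {y ∈ Finset.range n | δ y + 1 = d}.card)) fun d hd =>
      Nat.mul_le_mul_right _ ?_).trans ?_
    · have := Finset.mem_range.1 hd
      omega
    rw [← Finset.mul_sum]
    refine Nat.mul_le_mul_left _ ?_
    simp only [Finset.sum_add_distrib, levelSize]
    have e1 := h1 (fun d y => δ y = d + 1) fun i j y hi hj => by omega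
    have e2 := h1 (fun d y => δ y = d) fun i j y hi hj => by omega
    have e3 := h1 (fun d y => δ y + 1 = d) fun i j y hi hj => by omega
    simp only [Finset.sum_const, Finset.card_range, smul_eq_mul, mul_one]
    omega
  have h3 : ∑ d ∈ Finset.range (D + 1), (∑ x ∈ Finset.range n,
      if δ x = d then expandCost A b n E d x else 0) ≤
      ∑ x ∈ Finset.range n, expandCost A b n E D x := by
    refine (Finset.sum_le_sum fun d hd => Finset.sum_le_sum
      (g := fun x => if δ x = d then expandCost A b n E D x else 0) fun x _ => ?_).trans
      (sum_sum_ite_le (fun d x => δ x = d) (D + 1) (fun i j y hi hj => by omega) _)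
    have := Finset.mem_range.1 hd
    split_ifs
    · exact expandCost_mono (by omega)
    · exact le_rfl
  have h4 := sum_sum_ite_le (n := n) (fun d x => δ x + 1 = d) (D + 1)
    (fun i j y hi hj => by omega) (A.len a)
  have h5 := L.sum_expandCost_le (D := D)
  unfold levelCost
  simp only [Finset.sum_add_distrib, ← Finset.mul_sum]
  simp only [Finset.sum_const, Finset.card_range, smul_eq_mul]
  have e1 : (D + 1) * n = n * D + n := by ring
  have e2 : (6 * D + 1000) * (4 * n) = 24 * (n * D) + 4000 * n := by ring
  have e3 : n * (D + 1) = n * D + n := by ring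
  have e4 : (D + 1) * (240 * n) = 240 * (n * D) + 240 * n := by ring
  omega

end Cost

/-! ### Breadth-first search -/

/-- Clear the activity bit and the discovery bit of every vertex. -/
def Code.clear {ι : Type} (a b : ι) (off : ℕ) : Code ι :=
  .instr (.const 5 0) ;; .loop (.lt 5 0)
    (.instr (.copy 16 5) ;; Code.setPair a off 0 ;; Code.setPair b 3 0 ;; .instr (.op .add 5 5 2))

/-- Output the vertices in the order of their distances. A vertex is a root if it has room for an
activity bit; the other vertices have so few successors that they form chains below the roots,
which are followed without the help of such a bit. So no assumption on the degrees is needed. -/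
def Code.bfs {ι : Type} (a b : ι) (off : ℕ) : Code ι :=
  .instr (.const 2 1) ;; Code.clear a b off ;; .instr (.const 3 1) ;; .instr (.const 7 0) ;;
    .instr (.const 4 0) ;;
    .loop (.lt 4 0) (Code.phase a b off ;; .instr (.copy 7 3) ;; .instr (.op .add 3 3 2))

section Main

variable {ι : Type} {A M : AdjLists ι} {a b : ι} {off n s w : ℕ} {E : ℕ → ℕ → Prop}
  {δ : ℕ → ℕ} {σ : Mach ι}

theorem AdjLists.pairState_setPair_zero {i : ι} {v p : ℕ}
    (hinj : InjOn (M.val i v) (Iio (M.len i v))) : (M.setPair i v p 0).pairState i v p ≠ 1 := by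
  by_cases hp : p + 1 < M.len i v
  · rw [AdjLists.pairState_setPair (by omega) hp hinj]
    omega
  · rw [AdjLists.pairState_eq_two.2 (by rw [AdjLists.setPair_len]; omega)]
    omega

theorem runs_clear (hoff : a ≠ b ∧ off = 0 ∨ a = b ∧ off = 1) (L : Layout A a b n s E δ)
    (hw : 16 * n + 16 ≤ 2 ^ w) (hR : Arranged A σ.mem a b n E) (h0 : σ.word 0 = n)
    (h2 : σ.word 2 = 1) :
    Runs n w (Code.clear a b off) σ fun σ' t => Keeps 5 4 σ σ' ∧ Arranged A σ'.mem a b n E ∧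
      (∀ u < n, σ'.mem.pairState a u off ≠ 1 ∧ σ'.mem.pairState b u 3 ≠ 1) ∧ t ≤ 50 * n + 2 := by
  rw [Code.clear, runs_seq, runs_const]
  refine ⟨by omega, ?_⟩
  refine Runs.mono (Runs.count n (fun v σ' t => Keeps 5 4 σ σ' ∧ Arranged A σ'.mem a b n E ∧
    σ'.word 5 = v ∧
    (∀ u < v, σ'.mem.pairState a u off ≠ 1 ∧ σ'.mem.pairState b u 3 ≠ 1) ∧ t ≤ 50 * v)
    ?_ ?_ ?_) ?_
  · exact ⟨(Keeps.refl σ).setWord (by decide), hR, by simp, by simp, by simp⟩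
  · rintro v hv σ₁ t ⟨k1, hR1, h5, hp1, ht⟩
    refine ⟨by simp only [Cond.Holds]; rw [h5, k1.word 0 (by decide), h0]; exact hv, ?_⟩
    rw [runs_seq, runs_copy, h5]
    refine ⟨by omega, ?_⟩
    refine Runs.seq (runs_setPair (p := off) (β := 0) (v := v) (by omega) (by omega) (by simp) hv
      fun r hr => ?_) ?_
    · have := hR1.out_val_lt L hv hr
      simp only
      omega
    rintro σ₂ t₂ ⟨k2, m2, ht2⟩
    simp only at m2
    have hR2 : Arranged A σ₂.mem a b n E := by rw [m2]; exact hR1.setPair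
    refine Runs.seq (runs_setPair (p := 3) (β := 0) (v := v) (by omega) (by omega)
      (by rw [k2.word 16 (by decide)]; simp) hv fun r hr => ?_) ?_
    · have := hR2.inn_val_lt L hv hr
      omega
    rintro σ₃ t₃ ⟨k3, m3, ht3⟩
    have k13 : Keeps 16 4 σ₁ σ₃ := ((Keeps.refl σ₁).setWord (x := 16) (by decide)).trans
      ((k2.mono (by decide) (by decide)).trans (k3.mono (by decide) (by decide)))
    rw [runs_op]
    simp only [WordOp.eval]
    rw [k13.word 5 (by decide), k13.word 2 (by decide), h5, k1.word 2 (by decide), h2]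
    have hR3 : Arranged A σ₃.mem a b n E := by rw [m3]; exact hR2.setPair
    refine ⟨by omega, (k1.trans (k13.mono (by decide) (by decide))).setWord (by decide),
      hR3, by simp, fun u hu => ?_, by omega⟩
    have hdis : a ≠ b ∨ off + 1 < 3 := by rcases hoff with h | h <;> omega
    by_cases huv : u = v
    · subst huv
      constructor
      · rw [m3, AdjLists.pairState_setPair_ne (by tauto), m2]
        exact AdjLists.pairState_setPair_zero (hR1.out_inj hv)
      · rw [m3]
        exact AdjLists.pairState_setPair_zero (hR2.inn_inj hv)
    · rw [m3, AdjLists.pairState_setPair_ne (by tauto), AdjLists.pairState_setPair_ne (by tauto),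
        m2, AdjLists.pairState_setPair_ne (by tauto), AdjLists.pairState_setPair_ne (by tauto)]
      exact hp1 u (by omega)
  · rintro σ₁ t ⟨k1, -, h5, -⟩
    simp only [Cond.Holds]
    rw [h5, k1.word 0 (by decide), h0]
    omega
  · rintro σ₁ t ⟨t₁, rfl, k1, hR1, -, hp, ht⟩
    exact ⟨k1, hR1, hp, by omega⟩

/-- Before the first phase the source is the only vertex on level `0`, and no bit is set. The parent
function is then arbitrary, because no parent of another vertex is ever read on this level. -/
theorem AtLevel.init (L : Layout A a b n s E δ) (hR : Arranged A σ.mem a b n E)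
    (hg : Globals n s 0 σ) (h4 : σ.word 4 = 0) (ho : σ.out = [])
    (hp : ∀ u < n, σ.mem.pairState a u off ≠ 1 ∧ σ.mem.pairState b u 3 ≠ 1) :
    AtLevel A a b off n s E δ 0 (fun y => σ.mem.val b y 0) 0 σ := by
  refine ⟨hg, ⟨hR, ?_, ?_, ?_, ?_⟩, fun _ _ => rfl, by simp [ho], by simp [ho], by simp [ho],
    by simp [ho, h4], fun y hy hyd => ?_, fun u hu _ h => absurd h (hp u hu).1,
    fun u _ _ h => by omega⟩
  · rintro v hv hvs (h | ⟨x, -, -, h, -⟩)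
    · exact absurd (L.eq_source hv (by omega)) hvs
    · omega
  · intro v hv hvs _
    refine ⟨fun h => absurd h (hp v hv).2, ?_⟩
    rintro (h | ⟨x, -, -, h, -⟩)
    · exact absurd (L.eq_source hv (by omega)) hvs
    · omega
  · rintro v hv hvs _ ⟨x, -, -, h, -⟩
    omega
  · exact fun v hv _ _ h => absurd h (hp v hv).1
  · left
    rw [L.eq_source hy hyd, chainOwner, if_pos (show IsRoot A a off s s from Or.inl rfl)]

/-- The program does not know the largest distance `D`. It stops when `n` vertices have been output,
which is after exactly `D + 1` phases. The initial potential is at most the total length of the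
lists. -/
theorem runs_bfs (hoff : a ≠ b ∧ off = 0 ∨ a = b ∧ off = 1) (L : Layout A a b n s E δ)
    (hw : 16 * n + 16 ≤ 2 ^ w) (hm : σ.mem = A) (ho : σ.out = []) (h0 : σ.word 0 = n)
    (h1 : σ.word 1 = s) {D : ℕ} (hD : ∀ y < n, δ y ≤ D) (hD' : ∃ y < n, δ y = D) :
    Runs n w (Code.bfs a b off) σ fun σ' t => σ'.out.Nodup ∧ (∀ y, y ∈ σ'.out ↔ y < n) ∧
      (σ'.out.Pairwise fun x y => δ x ≤ δ y) ∧
      t ≤ 4400 * (∑ u ∈ Finset.range n, A.len a u + n * (D + 1)) := by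
  obtain ⟨y₀, hy₀, hδ₀⟩ := hD'
  have hDn : D < n := hδ₀ ▸ L.dist_lt hy₀
  rw [Code.bfs, runs_seq, runs_const]
  refine ⟨by omega, ?_⟩
  refine Runs.seq (runs_clear hoff L hw (by simp only [hm]; exact L.arranged) (by simpa using h0)
    (by simp)) ?_
  rintro σ₁ t₁ ⟨k1, hR1, hp1, ht1⟩
  rw [runs_seq, runs_const]
  refine ⟨by omega, ?_⟩
  rw [runs_seq, runs_const]
  refine ⟨by omega, ?_⟩
  rw [runs_seq, runs_const]
  refine ⟨by omega, ?_⟩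
  have hpot : σ₁.mem.potential b n ≤ ∑ u ∈ Finset.range n, A.len a u := by
    rw [L.sum_len, AdjLists.potential, hR1.len]
    exact Finset.sum_le_sum fun v _ => by split_ifs <;> omega
  have hcost := L.sum_levelCost_le hDn
  refine Runs.mono (Runs.count (D + 1) (fun d σ' t => ∃ h, AtLevel A a b off n s E δ d h 0 σ' ∧
    t + 8 * σ'.mem.potential b n ≤ 8 * σ₁.mem.potential b n +
      ∑ d ∈ Finset.range d, (levelCost A a b n E δ d + (2 * n + 5))) ?_ ?_ ?_) ?_
  · refine ⟨_, AtLevel.init L hR1 ?_ (by simp) ?_ hp1, by simp⟩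
    · have e0 := k1.word 0 (by decide)
      have e1 := k1.word 1 (by decide)
      have e2 := k1.word 2 (by decide)
      constructor <;> simp [e0, e1, e2, h0, h1]
    · simpa [ho] using k1.out
  · rintro d hd σ₂ t ⟨h, hA, ht⟩
    refine ⟨?_, ?_⟩
    · simp only [Cond.Holds]
      rw [hA.count, hA.globals.w0]
      -- While `d ≤ D`, the vertex `y₀` on level `D` is still missing, so the count is less than
      -- `n`.
      have h1 : σ₂.out.toFinset ⊂ Finset.range n := by
        refine Finset.ssubset_iff_subset_ne.2 ⟨fun x hx => ?_, fun he => ?_⟩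
        · simpa using ((hA.mem_out x).1 (by simpa using hx)).1
        · have : y₀ ∈ σ₂.out.toFinset := he ▸ Finset.mem_range.2 hy₀
          have := ((hA.mem_out y₀).1 (by simpa using this)).2
          omega
      have h2 := Finset.card_lt_card h1
      rwa [List.toFinset_card_of_nodup hA.nodup, Finset.card_range] at h2
    refine (runs_phase hoff L hw hA (by omega)).seq ?_
    rintro σ₃ t₃ ⟨hA3, ht3⟩
    have hg := hA3.globals
    rw [runs_seq, runs_copy, hg.w3]
    refine ⟨by omega, ?_⟩
    rw [runs_op]
    simp only [WordOp.eval]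
    rw [Function.update_of_ne (by decide), Function.update_of_ne (by decide), hg.w2, hg.w3]
    refine ⟨by omega, _, hA3.next hoff L ?_ rfl rfl (by simp), ?_⟩
    · constructor <;> simp [hg.w0, hg.w1, hg.w2]
    · have := sum_visitCost_le (A := A) (a := a) (b := b) (off := off) (n := n) (s := s) (E := E)
        (δ := δ) (h := h) (d := d)
      rw [Finset.sum_range_succ]
      rw [Finset.sum_add_distrib] at ht3
      simp only [Finset.sum_const, Finset.card_range, smul_eq_mul] at ht3
      omega
  · rintro σ₂ t ⟨h, hA, -⟩
    simp only [Cond.Holds]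
    rw [hA.count, hA.globals.w0]
    have h1 : Finset.range n ⊆ σ₂.out.toFinset := fun x hx => by
      have := Finset.mem_range.1 hx
      have := hD x this
      simpa using (hA.mem_out x).2 ⟨by assumption, by omega⟩
    have h2 := Finset.card_le_card h1
    rw [List.toFinset_card_of_nodup hA.nodup, Finset.card_range] at h2
    omega
  · rintro σ₂ t ⟨t₂, rfl, h, hA, ht⟩
    refine ⟨hA.nodup, fun y => ?_, hA.sorted, ?_⟩
    · rw [hA.mem_out]
      exact ⟨fun h => h.1, fun h => ⟨h, by have := hD y h; omega⟩⟩
    · rw [Finset.sum_add_distrib] at ht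
      simp only [Finset.sum_const, Finset.card_range, smul_eq_mul] at ht
      have e1 : (D + 1) * (2 * n + 5) = 2 * (n * (D + 1)) + 5 * D + 5 := by ring
      have e2 : n * (D + 1) = n * D + n := by ring
      omega

end Main

/-! ### Graphs as layouts -/

section Glue

variable {ι : Type} {n : ℕ} {A : AdjLists ι} {a b : ι} {s : Fin n} {d : Fin n → ℕ∞}
  {Adj : Fin n → Fin n → Prop}

/-- A relation on `Fin n` as a relation on natural numbers. -/
def natAdj (Adj : Fin n → Fin n → Prop) (u v : ℕ) : Prop :=
  ∃ (hu : u < n) (hv : v < n), Adj ⟨u, hu⟩ ⟨v, hv⟩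

/-- A distance function on `Fin n` as a function on natural numbers. -/
noncomputable def natDist (d : Fin n → ℕ∞) (v : ℕ) : ℕ :=
  if h : v < n then (d ⟨v, h⟩).toNat else 0

theorem natDist_val (v : Fin n) : natDist d v = (d v).toNat := by
  simp [natDist]

/-- The search uses only local properties of distances: they grow by at most one along an edge, and
some edge into each vertex other than the source attains this. So undirected and directed graphs can
be treated alike. -/
theorem layout_of_lists (ha : ∀ v, A.Lists a v {u | Adj v u}) (hb : ∀ v, A.Lists b v {u | Adj u v})
    (hfin : ∀ v, d v ≠ ⊤) (hs : d s = 0) (hedge : ∀ u v, Adj u v → d v ≤ d u + 1)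
    (hpred : ∀ v, v ≠ s → ∃ u, Adj u v ∧ d u + 1 ≤ d v) :
    Layout A a b n s (natAdj Adj) (natDist d) := by
  have hlift : ∀ u v, d v ≤ d u + 1 ↔ (d v).toNat ≤ (d u).toNat + 1 := fun u v => by
    conv_lhs => rw [← ENat.natCast_toNat (hfin u), ← ENat.natCast_toNat (hfin v)]
    exact_mod_cast Iff.rfl
  have hlift' : ∀ u v, d u + 1 ≤ d v ↔ (d u).toNat + 1 ≤ (d v).toNat := fun u v => by
    conv_lhs => rw [← ENat.natCast_toNat (hfin u), ← ENat.natCast_toNat (hfin v)]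
    exact_mod_cast Iff.rfl
  refine ⟨s.2, fun ⟨hu, hv, _⟩ => ⟨hu, hv⟩, fun u hu => ?_, fun v hv => ?_, ?_, ?_,
    fun v hv hvs => ?_⟩
  · have e : {v | natAdj Adj u v} = Fin.val '' {v | Adj ⟨u, hu⟩ v} := ?_
    · rw [e]; exact ha ⟨u, hu⟩
    ext v
    constructor
    · rintro ⟨_, hv, h⟩
      exact ⟨⟨v, hv⟩, h, rfl⟩
    · rintro ⟨v, h, rfl⟩
      exact ⟨hu, v.2, h⟩
  · have e : {u | natAdj Adj u v} = Fin.val '' {u | Adj u ⟨v, hv⟩} := ?_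
    · rw [e]; exact hb ⟨v, hv⟩
    ext u
    constructor
    · rintro ⟨hu, _, h⟩
      exact ⟨⟨u, hu⟩, h, rfl⟩
    · rintro ⟨u, h, rfl⟩
      exact ⟨u.2, hv, h⟩
  · rw [natDist_val, hs]
    rfl
  · rintro u v ⟨hu, hv, h⟩
    have := hedge _ _ h
    rw [hlift] at this
    simpa [natDist, hu, hv] using this
  · obtain ⟨u, hu, h⟩ := hpred ⟨v, hv⟩ fun h => hvs (congrArg Fin.val h)
    refine ⟨u, ⟨u.2, hv, hu⟩, ?_⟩
    have h1 := (hlift _ _).1 (hedge _ _ hu)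
    have h2 := (hlift' _ _).1 h
    rw [natDist_val]
    simp only [natDist, hv, dif_pos]
    omega

theorem AdjLists.Lists.len_eq {i : ι} {v : Fin n} {S : Set (Fin n)} (h : A.Lists i v S) :
    A.len i v = S.ncard := by
  have h1 := h.injOn.ncard_image
  rw [h.image_eq, ncard_image_of_injective _ Fin.val_injective] at h1
  rw [h1]
  simp [Set.ncard_eq_toFinset_card']

theorem AdjLists.Lists.len_le {i : ι} {v : Fin n} {S : Set (Fin n)} (h : A.Lists i v S) :
    A.len i v ≤ n := by
  rw [h.len_eq]
  exact (Set.ncard_le_card S).trans (by simp)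

/-- Words of `Nat.log 2 n + 5` bits leave room for `16 * n + 16`. There are at most `2 * n ^ 2`
nodes, so a pointer takes at most `2 * Nat.log 2 n + 3` bits. -/
theorem extraBits_le [Fintype ι] (hι : Fintype.card ι ≤ 2) (hlen : ∀ i, ∀ v < n, A.len i v ≤ n) :
    extraBits 24 8 (Nat.log 2 n + 5) (A.nodes n) ≤ 144 * (Nat.log 2 n + 1) := by
  have h1 : A.nodes n ≤ 2 * (n * n) := by
    unfold AdjLists.nodes
    refine (Finset.sum_le_sum (g := fun _ => n * n) fun i _ => ?_).trans ?_
    · refine (Finset.sum_le_sum fun v hv => hlen i v (Finset.mem_range.1 hv)).trans ?_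
      simp
    · simpa using Nat.mul_le_mul_right _ hι
  have h2 : n < 2 ^ (Nat.log 2 n + 1) := Nat.lt_pow_succ_log_self (by omega) n
  have h3 : Nat.size (A.nodes n) ≤ 2 * Nat.log 2 n + 3 := by
    rw [Nat.size_le]
    refine h1.trans_lt ?_
    have := Nat.mul_lt_mul'' h2 h2
    rw [show 2 * Nat.log 2 n + 3 = (Nat.log 2 n + 1) + (Nat.log 2 n + 1) + 1 by ring, pow_succ,
      pow_add]
    omega
  unfold extraBits
  omega

theorem two_pow_log_add (n : ℕ) : 16 * n + 16 ≤ 2 ^ (Nat.log 2 n + 5) := by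
  have h2 : n < 2 ^ (Nat.log 2 n + 1) := Nat.lt_pow_succ_log_self (by omega) n
  have : 2 ^ (Nat.log 2 n + 5) = 2 ^ (Nat.log 2 n + 1) * 16 := by ring
  omega

theorem outputsBFS_of_runs [Fintype ι] (hι : Fintype.card ι ≤ 2)
    (hlen : ∀ i, ∀ v < n, A.len i v ≤ n) (hfin : ∀ v, d v ≠ ⊤) {P : Code ι} {T c : ℕ} (hc : 144 ≤ c)
    (h : Runs n (Nat.log 2 n + 5) P (MachineState.init 24 8 A s) fun σ t => σ.out.Nodup ∧
      (∀ y, y ∈ σ.out ↔ y < n) ∧ (σ.out.Pairwise fun x y => natDist d x ≤ natDist d y) ∧ t ≤ T) :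
    P.OutputsBFS A s d T (c * (Nat.log 2 n + 1)) := by
  obtain ⟨σ, t, he, hnd, hmem, hsort, ht⟩ := h
  have hn : 0 < n := s.pos
  have hw := two_pow_log_add n
  set f : ℕ → Fin n := fun y => if h : y < n then ⟨y, h⟩ else s with hf
  have hval : ∀ y ∈ σ.out, (f y : ℕ) = y := fun y hy => by
    simp [hf, (hmem y).1 hy]
  have hout : (σ.out.map f).map Fin.val = σ.out := by
    rw [List.map_map]
    conv_rhs => rw [← List.map_id σ.out]
    exact List.map_congr_left hval
  refine ⟨Nat.log 2 n + 5, t, σ, σ.out.map f, by omega,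
    (extraBits_le hι hlen).trans (Nat.mul_le_mul_right _ hc), he, ht, hout.symm, ?_,
    fun v => ?_, ?_⟩
  · exact List.Nodup.of_map Fin.val (by rwa [hout])
  · simp only [hfin v, ne_eq, not_false_eq_true, iff_true, List.mem_map]
    exact ⟨v, (hmem v).2 v.2, by simp [hf]⟩
  · rw [List.pairwise_map]
    refine hsort.imp_of_mem fun {x y} hx hy hxy => ?_
    have ex : natDist d x = (d (f x)).toNat := by rw [← natDist_val, hval x hx]
    have ey : natDist d y = (d (f y)).toNat := by rw [← natDist_val, hval y hy]
    rw [ex, ey] at hxy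
    rw [← ENat.natCast_toNat (hfin (f x)), ← ENat.natCast_toNat (hfin (f y))]
    exact_mod_cast hxy

theorem Layout.outputsBFS [Fintype ι] (hι : Fintype.card ι ≤ 2)
    (hlen : ∀ i, ∀ v < n, A.len i v ≤ n) (hfin : ∀ v, d v ≠ ⊤) {off : ℕ}
    (hoff : a ≠ b ∧ off = 0 ∨ a = b ∧ off = 1) {E : ℕ → ℕ → Prop}
    (L : Layout A a b n s E (natDist d))
    {ℓ : ℕ} (hℓ : ∀ v, d v ≤ ℓ) :
    (Code.bfs a b off).OutputsBFS A s d
      (8800 * (∑ u ∈ Finset.range n, A.len a u + n * ℓ + 1)) (8800 * (Nat.log 2 n + 1)) := by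
  have hn : 0 < n := s.pos
  obtain ⟨y₀, hy₀, hmax⟩ := Finset.exists_max_image (Finset.range n) (natDist d)
    ⟨s, Finset.mem_range.2 s.2⟩
  rw [Finset.mem_range] at hy₀
  refine outputsBFS_of_runs hι hlen hfin (by omega) ?_
  refine (runs_bfs (D := natDist d y₀) hoff L (two_pow_log_add n) rfl rfl rfl rfl
    (fun y hy => hmax y (Finset.mem_range.2 hy)) ⟨y₀, hy₀, rfl⟩).mono ?_
  rintro σ t ⟨h1, h2, h3, ht⟩
  refine ⟨h1, h2, h3, ht.trans ?_⟩
  have hDℓ : natDist d y₀ ≤ ℓ := by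
    rw [natDist, dif_pos hy₀]
    have := hℓ ⟨y₀, hy₀⟩
    rw [← ENat.natCast_toNat (hfin _)] at this
    exact_mod_cast this
  -- `D + 1` phases have to be bounded by a multiple of `ℓ`. This works with `D + 1 ≤ 2 * ℓ` unless
  -- `D = 0`; then the source is the only vertex, and the summand `1` in the bound suffices.
  rcases Nat.eq_zero_or_pos (natDist d y₀) with h0 | hpos
  · have hn1 : n = 1 := by
      by_contra hne
      have : ∀ y < n, y = s := fun y hy =>
        L.eq_source hy (by have := hmax y (Finset.mem_range.2 hy); omega)
      have h1 := this 0 (by omega)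
      have h2 := this 1 (by omega)
      omega
    have : n * (natDist d y₀ + 1) = 1 := by rw [h0, hn1]
    omega
  · have e1 : n * (natDist d y₀ + 1) ≤ n * (2 * ℓ) := Nat.mul_le_mul_left _ (by omega)
    have e2 : n * (2 * ℓ) = 2 * (n * ℓ) := by ring
    omega

end Glue

section Undirected

variable {n : ℕ} {G : SimpleGraph (Fin n)} {A : AdjLists Unit} {s : Fin n} {ℓ : ℕ}

theorem ne_top_of_le {n ℓ : ℕ} {d : Fin n → ℕ∞} (h : ∀ v, d v ≤ ℓ) (v : Fin n) : d v ≠ ⊤ :=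
  ((h v).trans_lt (ENat.natCast_lt_top ℓ)).ne

theorem AdjLists.RepresentsGraph.layout (hA : A.RepresentsGraph G) (h : ∀ v, G.edist s v ≤ ℓ) :
    Layout A () () n s (natAdj G.Adj) (natDist (G.edist s)) := by
  refine layout_of_lists hA (fun v => ?_) (ne_top_of_le h) G.edist_self (fun u v huv => ?_)
    fun v hv => ?_
  · simpa only [G.adj_comm] using hA v
  · refine (G.edist_triangle (v := u)).trans ?_
    rw [SimpleGraph.edist_eq_one_iff_adj.2 huv]
  -- The shortest walk is taken from `v` to `s`, so that its first step exhibits the predecessor of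
  -- `v`.
  · have hne : G.edist v s ≠ ⊤ := by rw [G.edist_comm]; exact ne_top_of_le h v
    obtain ⟨p, hp⟩ := G.exists_walk_of_edist_ne_top hne
    cases p with
    | nil => exact absurd rfl hv
    | cons hadj q =>
      refine ⟨_, hadj.symm, ?_⟩
      rw [G.edist_comm, G.edist_comm (u := s), ← hp, SimpleGraph.Walk.length_cons, Nat.cast_add,
        Nat.cast_one]
      gcongr
      exact SimpleGraph.edist_le q

theorem AdjLists.RepresentsGraph.len_le (hA : A.RepresentsGraph G) (i : Unit) :
    ∀ v < n, A.len i v ≤ n := fun v hv => (hA ⟨v, hv⟩).len_le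

theorem AdjLists.RepresentsGraph.sum_len (hA : A.RepresentsGraph G) :
    ∑ u ∈ Finset.range n, A.len () u = 2 * G.edgeSet.ncard := by
  classical
  rw [Finset.sum_range, ← SimpleGraph.coe_edgeFinset, Set.ncard_coe_finset,
    ← G.sum_degrees_eq_twice_card_edges]
  refine Finset.sum_congr rfl fun v _ => ?_
  rw [(hA v).len_eq, ← SimpleGraph.card_neighborFinset_eq_degree, ← Set.ncard_coe_finset,
    SimpleGraph.coe_neighborFinset]
  rfl

end Undirected

section Directed

variable {n : ℕ} {G : Digraph (Fin n)} {A : AdjLists Dir} {s : Fin n} {ℓ : ℕ}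

theorem Digraph.edist_le {V : Type} {G : Digraph V} {u v : V} {k : ℕ} (h : G.StepsTo k u v) :
    G.edist u v ≤ k := iInf₂_le k h

theorem Digraph.exists_stepsTo {V : Type} {G : Digraph V} {u v : V} (h : G.edist u v ≠ ⊤) :
    ∃ k : ℕ, G.StepsTo k u v ∧ (k : ℕ∞) = G.edist u v := by
  have h1 : ∃ k : ℕ, G.StepsTo k u v := by
    by_contra! hno
    exact h (by simp [Digraph.edist, hno])
  classical
  refine ⟨Nat.find h1, Nat.find_spec h1, le_antisymm ?_ (edist_le (Nat.find_spec h1))⟩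
  exact le_iInf₂ fun k hk => by exact_mod_cast Nat.find_min' h1 hk

theorem AdjLists.RepresentsDigraph.layout (hA : A.RepresentsDigraph G)
    (h : ∀ v, G.edist s v ≤ ℓ) :
    Layout A Dir.outward Dir.inward n s (natAdj G.Adj) (natDist (G.edist s)) := by
  refine layout_of_lists (fun v => (hA v).1) (fun v => (hA v).2) (ne_top_of_le h) ?_
    (fun u v huv => ?_) fun v hv => ?_
  · exact nonpos_iff_eq_zero.1 (Digraph.edist_le (k := 0) rfl)
  · obtain ⟨k, hk, he⟩ := Digraph.exists_stepsTo (ne_top_of_le h u)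
    rw [← he]
    exact_mod_cast Digraph.edist_le (k := k + 1) ⟨u, hk, huv⟩
  · obtain ⟨k, hk, he⟩ := Digraph.exists_stepsTo (ne_top_of_le h v)
    cases k with
    | zero => exact absurd (Eq.symm hk) hv
    | succ k =>
      obtain ⟨u, hu, huv⟩ := hk
      refine ⟨u, huv, ?_⟩
      rw [← he, Nat.cast_add, Nat.cast_one]
      gcongr
      exact Digraph.edist_le hu

theorem AdjLists.RepresentsDigraph.len_le (hA : A.RepresentsDigraph G) (i : Dir) :
    ∀ v < n, A.len i v ≤ n := fun v hv => by
  cases i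
  · exact (hA ⟨v, hv⟩).1.len_le
  · exact (hA ⟨v, hv⟩).2.len_le

theorem AdjLists.RepresentsDigraph.sum_len (hA : A.RepresentsDigraph G) :
    ∑ u ∈ Finset.range n, A.len Dir.outward u = G.numEdges := by
  classical
  have h1 : {e : Fin n × Fin n | G.Adj e.1 e.2}.ncard =
      (Finset.univ.filter fun e : Fin n × Fin n => G.Adj e.1 e.2).card := by
    rw [← Set.ncard_coe_finset]
    simp
  rw [Digraph.numEdges, h1, Finset.sum_range, Finset.card_filter, ← Finset.univ_product_univ,
    Finset.sum_product]
  refine Finset.sum_congr rfl fun v _ => ?_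
  rw [(hA v).1.len_eq, ← Finset.card_filter, ← Set.ncard_coe_finset]
  simp

end Directed

/-! ### The time bound O(m + nℓ) for undirected and directed graphs. -/

theorem undirected_bfs {n : ℕ} {G : SimpleGraph (Fin n)} {A : AdjLists Unit} {s : Fin n} {ℓ : ℕ}
    (hA : A.RepresentsGraph G) (h : ∀ v, G.edist s v ≤ ℓ) {T : ℕ}
    (hT : 17600 * (G.edgeSet.ncard + n * ℓ + 1) ≤ T) :
    (Code.bfs () () 1).OutputsBFS A s (G.edist s) T (17600 * (Nat.log 2 n + 1)) := by
  obtain ⟨w, t, σ, l, h1, h2, h3, h4, h5⟩ := Layout.outputsBFS (by simp) hA.len_le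
    (ne_top_of_le h) (Or.inr ⟨rfl, rfl⟩) (hA.layout h) h
  -- Each edge occurs in two lists, which doubles the constant `8800`.
  rw [hA.sum_len] at h4
  exact ⟨w, t, σ, l, h1, by omega, h3, by omega, h5⟩

theorem directed_bfs {n : ℕ} {G : Digraph (Fin n)} {A : AdjLists Dir} {s : Fin n} {ℓ : ℕ}
    (hA : A.RepresentsDigraph G) (h : ∀ v, G.edist s v ≤ ℓ) {T : ℕ}
    (hT : 17600 * (G.numEdges + n * ℓ + 1) ≤ T) :
    (Code.bfs Dir.outward Dir.inward 0).OutputsBFS A s (G.edist s) T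
      (17600 * (Nat.log 2 n + 1)) := by
  obtain ⟨w, t, σ, l, h1, h2, h3, h4, h5⟩ := Layout.outputsBFS (by decide) hA.len_le
    (ne_top_of_le h) (Or.inl ⟨by decide, rfl⟩) (hA.layout h) h
  rw [hA.sum_len] at h4
  exact ⟨w, t, σ, l, h1, by omega, h3, by omega, h5⟩

/-! ### Numbers stored in a list -/

namespace AdjLists

variable {ι : Type} {M : AdjLists ι} {i i' : ι} {v v' p k x : ℕ} {S : Set ℕ}

/-- The number with the binary digits at positions `2, 3`, `4, 5`, …. -/
def number (M : AdjLists ι) (i : ι) (v k : ℕ) : ℕ :=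
  ∑ j ∈ Finset.range k, 2 ^ j * M.pairState i v (2 + 2 * j)

/-- Store the `k` last binary digits of `x` at positions `2, 3`, `4, 5`, …. -/
noncomputable def setNumber (M : AdjLists ι) (i : ι) (v x : ℕ) : ℕ → AdjLists ι
  | 0 => M
  | j + 1 => (M.setNumber i v x j).setPair i v (2 + 2 * j) (x / 2 ^ j % 2)

@[simp] theorem setNumber_len : (M.setNumber i v x k).len = M.len := by
  induction k with
  | zero => rfl
  | succ k ih => rw [setNumber, setPair_len, ih]

theorem setNumber_val_ne (h : i' ≠ i ∨ v' ≠ v) :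
    (M.setNumber i v x k).val i' v' = M.val i' v' := by
  induction k with
  | zero => rfl
  | succ k ih => rw [setNumber, setPair_val_ne h, ih]

theorem bijOn_setNumber (h : BijOn (M.val i' v') (Iio (M.len i' v')) S) :
    BijOn ((M.setNumber i v x k).val i' v') (Iio (M.len i' v')) S := by
  induction k with
  | zero => exact h
  | succ k ih =>
    have : BijOn ((M.setNumber i v x k).val i' v') (Iio ((M.setNumber i v x k).len i' v')) S := by
      rwa [setNumber_len]
    simpa [setNumber] using
      bijOn_setPair (i := i) (v := v) (p := 2 + 2 * k) (β := x / 2 ^ k % 2) this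

theorem pairState_setNumber_zero : (M.setNumber i v x k).pairState i v 0 = M.pairState i v 0 := by
  induction k with
  | zero => rfl
  | succ k ih => rw [setNumber, pairState_setPair_ne (by omega), ih]

theorem pairState_setNumber_ne (h : i' ≠ i ∨ v' ≠ v) :
    (M.setNumber i v x k).pairState i' v' p = M.pairState i' v' p :=
  pairState_congr (by simp) (by rw [setNumber_val_ne h]) (by rw [setNumber_val_ne h])

/-- Different digits use disjoint pairs of positions, so writing the later digits leaves digit `j`
intact. -/
theorem pairState_setNumber (hinj : InjOn (M.val i v) (Iio (M.len i v)))
    (hk : 2 * k + 2 ≤ M.len i v) {j : ℕ} (hj : j < k) :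
    (M.setNumber i v x k).pairState i v (2 + 2 * j) = x / 2 ^ j % 2 := by
  induction k with
  | zero => omega
  | succ k ih =>
    rw [setNumber]
    rcases Nat.lt_succ_iff_lt_or_eq.1 hj with h | rfl
    · rw [pairState_setPair_ne (by omega)]
      exact ih (by omega) h
    · refine pairState_setPair (by omega) (by rw [setNumber_len]; omega) ?_
      rw [setNumber_len]
      exact (bijOn_setNumber (hinj.bijOn_image)).injOn

theorem number_setNumber (hinj : InjOn (M.val i v) (Iio (M.len i v)))
    (hk : 2 * k + 2 ≤ M.len i v) (hx : x < 2 ^ k) : (M.setNumber i v x k).number i v k = x := by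
  have h1 : ∀ k, ∑ j ∈ Finset.range k, 2 ^ j * (x / 2 ^ j % 2) = x % 2 ^ k := by
    intro k
    induction k with
    | zero => simp [Nat.mod_one]
    | succ k ih => rw [Finset.sum_range_succ, ih, Nat.mod_pow_succ]
  rw [number, Finset.sum_congr rfl fun j hj => by
    rw [pairState_setNumber hinj hk (Finset.mem_range.1 hj)], h1, Nat.mod_eq_of_lt hx]

/-- The list is long enough for all the pairs, so no digit has the exceptional state `2`. -/
theorem number_lt (hk : 2 * k + 2 ≤ M.len i v) : M.number i v k < 2 ^ k := by
  unfold number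
  induction k with
  | zero => simp
  | succ k ih =>
    rw [Finset.sum_range_succ, pow_succ]
    have h1 := ih (by omega)
    have h2 : M.pairState i v (2 + 2 * k) ≤ 1 := by
      have := pairState_le (M := M) (i := i) (v := v) (p := 2 + 2 * k)
      have h3 := pairState_eq_two (M := M) (i := i) (v := v) (p := 2 + 2 * k)
      omega
    have h3 := Nat.mul_le_mul_left (2 ^ k) h2
    omega

end AdjLists

/-- Compute the number stored in the list `i` of the vertex in register `16`. -/
def Code.getNumber {ι : Type} (i : ι) : Code ι :=
  .instr (.const 18 0) ;; .instr (.const 19 1) ;; Code.nth i 2 ;;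
    .loop (.lt 19 0) (.instr (.load 20 4) ;; .instr (.next 5 4) ;; .instr (.load 21 5) ;;
      .ite (.lt 20 21) (.instr (.op .add 18 18 19)) .skip ;; .instr (.next 4 5) ;;
      .instr (.op .add 19 19 19))

/-- Store the number in register `17` in the list `i` of the vertex in register `16`. -/
def Code.setNumber {ι : Type} (i : ι) : Code ι :=
  .instr (.const 19 1) ;; Code.nth i 2 ;;
    .loop (.lt 19 0) (.instr (.op .land 20 17 2) ;; .instr (.load 21 4) ;; .instr (.next 5 4) ;;
      .instr (.load 22 5) ;;
      .ite (.lt 21 22) (.ite (.eq 20 2) .skip (.instr (.swap 4 5)))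
        (.ite (.eq 20 2) (.instr (.swap 4 5)) .skip) ;;
      .instr (.next 4 5) ;; .instr (.op .shr 17 17 2) ;; .instr (.op .add 19 19 19))

section Number

variable {ι : Type} {n w : ℕ} {σ : Mach ι}

theorem two_pow_clog_le {n : ℕ} (hn : 0 < n) : 2 ^ Nat.clog 2 n ≤ 2 * n := by
  rcases Nat.lt_or_ge 1 n with h | h
  · have := Nat.pow_pred_clog_lt_self (b := 2) (by omega) h
    have h2 : 0 < Nat.clog 2 n := Nat.clog_pos (by omega) h
    have h3 : 2 ^ Nat.clog 2 n = 2 * 2 ^ (Nat.clog 2 n).pred := by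
      rw [← pow_succ', ← Nat.succ_eq_add_one, Nat.succ_pred_eq_of_pos h2]
    omega
  · obtain rfl : n = 1 := by omega
    simp

/-- The loops over the digits double a register while it is less than `n`; this makes exactly
`Nat.clog 2 n` rounds without computing the logarithm. -/
theorem two_pow_lt_iff {n i : ℕ} : 2 ^ i < n ↔ i < Nat.clog 2 n := by
  have := Nat.clog_le_iff_le_pow (b := 2) (by omega) (x := n) (y := i)
  omega

theorem runs_getNumber {i : ι} {v : ℕ} (hw : 16 * n + 16 ≤ 2 ^ w) (h0 : σ.word 0 = n)
    (h16 : σ.word 16 = v) (hv : v < n) (hlen : 2 * Nat.clog 2 n + 2 ≤ σ.mem.len i v)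
    (hval : ∀ r < σ.mem.len i v, σ.mem.val i v r < 2 ^ w) :
    Runs n w (Code.getNumber i) σ fun σ' t => Keeps 18 4 σ σ' ∧ σ'.mem = σ.mem ∧
      σ'.word 18 = σ.mem.number i v (Nat.clog 2 n) ∧ t ≤ 8 * Nat.clog 2 n + 8 := by
  have hK := two_pow_clog_le (show 0 < n by omega)
  set K := Nat.clog 2 n with hKdef
  rw [Code.getNumber, runs_seq, runs_const]
  refine ⟨by omega, ?_⟩
  rw [runs_seq, runs_const]
  refine ⟨by omega, ?_⟩
  refine Runs.seq (runs_nth 2 (by simpa [h16] using hv)) ?_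
  rintro _ t ⟨rfl, ht⟩
  refine Runs.mono (Runs.count K (fun j σ' t => Keeps 18 4 σ σ' ∧ σ'.mem = σ.mem ∧
    σ'.word 18 = σ.mem.number i v j ∧ σ'.word 19 = 2 ^ j ∧
    σ'.ptr 4 = σ.mem.nodeAt i v (2 + 2 * j) ∧ t ≤ 8 * j) ?_ ?_ ?_) ?_
  · refine ⟨(((Keeps.refl σ).setWord (x := 18) (by decide)).setWord (x := 19) (by decide)).setPtr
      (x := 4) (by decide), rfl, by simp [AdjLists.number], by simp, ?_, by simp⟩
    simp [h16]
  · rintro j hj σ₁ t ⟨k1, m1, h18, h19, hp, ht⟩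
    have hpow : 2 ^ j < n := two_pow_lt_iff.2 hj
    refine ⟨?_, ?_⟩
    · simp only [Cond.Holds]
      rw [h19, k1.word 0 (by decide), h0]
      exact hpow
    have hl1 : 2 + 2 * j < σ.mem.len i v := by omega
    have hl2 : 2 + 2 * j + 1 < σ.mem.len i v := by omega
    have hnum : σ.mem.number i v (j + 1) = σ.mem.number i v j +
        2 ^ j * σ.mem.pairState i v (2 + 2 * j) := Finset.sum_range_succ _ _
    have hnl : σ.mem.number i v j < 2 ^ j := AdjLists.number_lt (by omega)
    rw [AdjLists.nodeAt, if_pos hl1] at hp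
    rw [runs_seq, runs_load]
    refine ⟨i, v, _, hp, by rw [m1]; exact hval _ hl1, ?_⟩
    rw [runs_seq, runs_next]
    refine ⟨i, v, _, hp, ?_⟩
    rw [runs_seq, runs_load]
    refine ⟨i, v, 2 + 2 * j + 1, by simp [AdjLists.nodeAt, m1, hl2], by
      simp only [m1]; exact hval _ hl2, ?_⟩
    refine Runs.seq (Q := fun σ' t => Keeps 18 4 σ σ' ∧ σ'.mem = σ.mem ∧
      σ'.word 18 = σ.mem.number i v (j + 1) ∧ σ'.word 19 = 2 ^ j ∧
      σ'.ptr 5 = some (i, v, 2 + 2 * j + 1) ∧ t ≤ 2) ?_ ?_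
    · have k2 := ((k1.setWord (x := 20) (a := σ₁.mem.val i v (2 + 2 * j)) (by decide)).setPtr
        (x := 5) (a := some (i, v, 2 + 2 * j + 1)) (by decide)).setWord (x := 21)
        (a := σ₁.mem.val i v (2 + 2 * j + 1)) (by decide)
      have hnode : σ₁.mem.nodeAt i v (2 + 2 * j + 1) = some (i, v, 2 + 2 * j + 1) := by
        rw [m1, AdjLists.nodeAt, if_pos hl2]
      rw [hnode]
      rw [← m1] at hnum h18
      by_cases hlt : σ₁.mem.val i v (2 + 2 * j) < σ₁.mem.val i v (2 + 2 * j + 1)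
      · apply Runs.iteTrue (by simpa [Cond.Holds] using hlt)
        rw [runs_op]
        simp only [WordOp.eval]
        have hst : σ₁.mem.pairState i v (2 + 2 * j) = 1 := by
          rw [AdjLists.pairState, if_pos (by rw [m1]; exact hl2), if_pos hlt]
        refine ⟨?_, k2.setWord (x := 18) (by decide), m1, ?_, ?_, by simp, by omega⟩
        · rw [m1] at h18
          simp [h18, h19]; omega
        · simp [h18, h19, ← m1, hnum, hst]
        · simp [h19]
      · apply Runs.iteFalse (by simpa [Cond.Holds] using hlt)
        rw [runs_skip]
        have hst : σ₁.mem.pairState i v (2 + 2 * j) = 0 := by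
          rw [AdjLists.pairState, if_pos (by rw [m1]; exact hl2), if_neg hlt]
        exact ⟨k2, m1, by simp [h18, ← m1, hnum, hst], by simp [h19], by simp, by omega⟩
    rintro σ₂ t₂ ⟨k2, m2, g18, g19, g5, ht2⟩
    rw [runs_seq, runs_next]
    refine ⟨i, v, _, g5, ?_⟩
    rw [runs_op]
    simp only [WordOp.eval, g19]
    refine ⟨by omega, (k2.setPtr (by decide)).setWord (by decide), m2, by simp [g18], ?_, ?_,
      by omega⟩
    · simp; ring
    · simp [m2, mul_add, add_assoc]
  · rintro σ₁ t ⟨k1, -, -, h19, -⟩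
    simp only [Cond.Holds]
    rw [h19, k1.word 0 (by decide), h0, two_pow_lt_iff]
    omega
  · rintro σ₁ t₁ ⟨t₂, rfl, k1, m1, h18, -, -, ht'⟩
    exact ⟨k1, m1, h18, by omega⟩

theorem runs_setNumber {i : ι} {v x : ℕ} {S : Set ℕ} (hw : 16 * n + 16 ≤ 2 ^ w)
    (h0 : σ.word 0 = n) (h2 : σ.word 2 = 1) (h16 : σ.word 16 = v) (h17 : σ.word 17 = x)
    (hv : v < n) (hx : x < 2 ^ w) (hlen : 2 * Nat.clog 2 n + 2 ≤ σ.mem.len i v)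
    (hS : BijOn (σ.mem.val i v) (Iio (σ.mem.len i v)) S) (hSw : ∀ y ∈ S, y < 2 ^ w) :
    Runs n w (Code.setNumber i) σ fun σ' t => Keeps 17 4 σ σ' ∧
      σ'.mem = σ.mem.setNumber i v x (Nat.clog 2 n) ∧ t ≤ 11 * Nat.clog 2 n + 7 := by
  have hK := two_pow_clog_le (show 0 < n by omega)
  set K := Nat.clog 2 n with hKdef
  rw [Code.setNumber, runs_seq, runs_const]
  refine ⟨by omega, ?_⟩
  refine Runs.seq (runs_nth 2 (by simpa [h16] using hv)) ?_
  rintro _ t ⟨rfl, ht⟩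
  refine Runs.mono (Runs.count K (fun j σ' t => Keeps 17 4 σ σ' ∧
    σ'.mem = σ.mem.setNumber i v x j ∧ σ'.word 17 = x / 2 ^ j ∧ σ'.word 19 = 2 ^ j ∧
    σ'.ptr 4 = σ.mem.nodeAt i v (2 + 2 * j) ∧ t ≤ 11 * j) ?_ ?_ ?_) ?_
  · refine ⟨((Keeps.refl σ).setWord (x := 19) (by decide)).setPtr
      (x := 4) (by decide), rfl, by simp [h17], by simp, ?_, by simp⟩
    simp [h16]
  · rintro j hj σ₁ t ⟨k1, m1, g17, h19, hp, ht⟩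
    have hpow : 2 ^ j < n := two_pow_lt_iff.2 hj
    refine ⟨?_, ?_⟩
    · simp only [Cond.Holds]
      rw [h19, k1.word 0 (by decide), h0]
      exact hpow
    have hl : σ₁.mem.len i v = σ.mem.len i v := by rw [m1, AdjLists.setNumber_len]
    have hl1 : 2 + 2 * j < σ₁.mem.len i v := by omega
    have hl2 : 2 + 2 * j + 1 < σ₁.mem.len i v := by omega
    have hval : ∀ r < σ₁.mem.len i v, σ₁.mem.val i v r < 2 ^ w := fun r hr => by
      rw [hl] at hr
      rw [m1]
      exact hSw _ ((AdjLists.bijOn_setNumber hS).mapsTo hr)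
    have e2 : σ₁.word 2 = 1 := (k1.word 2 (by decide)).trans h2
    rw [AdjLists.nodeAt, if_pos (by omega)] at hp
    have hxj : x / 2 ^ j ≤ x := Nat.div_le_self _ _
    have hdig : (x / 2 ^ j) &&& 1 = x / 2 ^ j % 2 := Nat.and_one_is_mod _
    have hmod : x / 2 ^ j % 2 < 2 := Nat.mod_lt _ (by omega)
    rw [runs_seq, runs_op]
    simp only [WordOp.eval, g17, e2, hdig]
    refine ⟨by omega, ?_⟩
    rw [runs_seq, runs_load]
    refine ⟨i, v, _, hp, hval _ hl1, ?_⟩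
    rw [runs_seq, runs_next]
    refine ⟨i, v, _, hp, ?_⟩
    rw [runs_seq, runs_load]
    refine ⟨i, v, 2 + 2 * j + 1, by simp [AdjLists.nodeAt, hl2], hval _ hl2, ?_⟩
    have hnode : σ₁.mem.nodeAt i v (2 + 2 * j + 1) = some (i, v, 2 + 2 * j + 1) := by
      rw [AdjLists.nodeAt, if_pos hl2]
    rw [hnode]
    have k2 := (((k1.setWord (x := 20) (a := x / 2 ^ j % 2) (by decide)).setWord (x := 21)
      (a := σ₁.mem.val i v (2 + 2 * j)) (by decide)).setPtr
        (x := 5) (a := some (i, v, 2 + 2 * j + 1)) (by decide)).setWord (x := 22)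
        (a := σ₁.mem.val i v (2 + 2 * j + 1)) (by decide)
    have hstep : σ.mem.setNumber i v x (j + 1) =
        σ₁.mem.setPair i v (2 + 2 * j) (x / 2 ^ j % 2) := by rw [m1]; rfl
    have hps : σ₁.mem.pairState i v (2 + 2 * j) =
        if σ₁.mem.val i v (2 + 2 * j) < σ₁.mem.val i v (2 + 2 * j + 1) then 1 else 0 := by
      rw [AdjLists.pairState, if_pos hl2]
    refine Runs.seq (Q := fun σ' t => Keeps 17 4 σ σ' ∧
      σ'.mem = σ.mem.setNumber i v x (j + 1) ∧ σ'.word 17 = x / 2 ^ j ∧ σ'.word 19 = 2 ^ j ∧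
      σ'.ptr 5 = some (i, v, 2 + 2 * j + 1) ∧ t ≤ 3) ?_ ?_
    · rw [hstep]
      by_cases hlt : σ₁.mem.val i v (2 + 2 * j) < σ₁.mem.val i v (2 + 2 * j + 1) <;>
        by_cases hβ : x / 2 ^ j % 2 = 1
      · rw [if_pos hlt] at hps
        apply Runs.iteTrue (by simpa [Cond.Holds] using hlt)
        apply Runs.iteTrue (by simp [Cond.Holds, hβ, e2])
        rw [runs_skip]
        refine ⟨k2, ?_, by simp [g17], by simp [h19], by simp, by omega⟩
        rw [AdjLists.setPair, if_neg (by omega)]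
      · rw [if_pos hlt] at hps
        apply Runs.iteTrue (by simpa [Cond.Holds] using hlt)
        apply Runs.iteFalse (by simp [Cond.Holds, hβ, e2])
        refine Runs.swap (i := i) (v := v) (r := 2 + 2 * j) (r' := 2 + 2 * j + 1)
          (by simp [hp]) (by simp) ?_
        refine ⟨k2.setMem, ?_, by simp [g17], by simp [h19], by simp, by omega⟩
        rw [AdjLists.setPair, if_pos (by omega)]
      · rw [if_neg hlt] at hps
        apply Runs.iteFalse (by simpa [Cond.Holds] using hlt)
        apply Runs.iteTrue (by simp [Cond.Holds, hβ, e2])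
        refine Runs.swap (i := i) (v := v) (r := 2 + 2 * j) (r' := 2 + 2 * j + 1)
          (by simp [hp]) (by simp) ?_
        refine ⟨k2.setMem, ?_, by simp [g17], by simp [h19], by simp, by omega⟩
        rw [AdjLists.setPair, if_pos (by omega)]
      · rw [if_neg hlt] at hps
        apply Runs.iteFalse (by simpa [Cond.Holds] using hlt)
        apply Runs.iteFalse (by simp [Cond.Holds, hβ, e2])
        rw [runs_skip]
        refine ⟨k2, ?_, by simp [g17], by simp [h19], by simp, by omega⟩
        rw [AdjLists.setPair, if_neg (by omega)]
    rintro σ₂ t₂ ⟨k2, m2, f17, f19, f5, ht2⟩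
    rw [runs_seq, runs_next]
    refine ⟨i, v, _, f5, ?_⟩
    rw [runs_seq, runs_op]
    have f2 : σ₂.word 2 = 1 := (k2.word 2 (by decide)).trans h2
    have hsh : (x / 2 ^ j) >>> 1 = x / 2 ^ (j + 1) := by
      rw [Nat.shiftRight_eq_div_pow, pow_one, Nat.div_div_eq_div_mul, ← pow_succ]
    simp only [WordOp.eval, f17, f2, hsh]
    have := Nat.div_le_self x (2 ^ (j + 1))
    refine ⟨by omega, ?_⟩
    rw [runs_op]
    simp only [WordOp.eval]
    rw [Function.update_of_ne (by decide), f19]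
    refine ⟨by omega, ((k2.setPtr (by decide)).setWord (x := 17) (by decide)).setWord
      (by decide), m2, by simp, ?_, ?_, by omega⟩
    · simp; ring
    · simp only [Function.update_self, m2]
      simp [AdjLists.nodeAt, mul_add, add_assoc]
  · rintro σ₁ t ⟨k1, -, -, h19, -⟩
    simp only [Cond.Holds]
    rw [h19, k1.word 0 (by decide), h0, two_pow_lt_iff]
    omega
  · rintro σ₁ t₁ ⟨t₂, rfl, k1, m1, -, -, -, ht'⟩
    exact ⟨k1, m1, by omega⟩

end Number

/-! ### Breadth-first search with linked lists -/

/-- The list `l` starts with `x`, and `f` maps each of its members to the next one. -/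
def Linked (f : ℕ → ℕ) : ℕ → List ℕ → Prop
  | _, [] => True
  | x, y :: l => x = y ∧ Linked f (f y) l

theorem Linked.congr {f g : ℕ → ℕ} {x : ℕ} {l : List ℕ} (h : Linked f x l)
    (hfg : ∀ y ∈ l, g y = f y) : Linked g x l := by
  induction l generalizing x with
  | nil => trivial
  | cons y l ih =>
    refine ⟨h.1, ?_⟩
    rw [hfg y (by simp)]
    exact ih h.2 fun z hz => hfg z (by simp [hz])

/-- Put the vertex in the node at pointer `0` on the stack of the next level if it is new. -/
def Code.push {ι : Type} (c : ι) : Code ι :=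
  .instr (.load 11 0) ;; .instr (.copy 16 11) ;; Code.testPair c 0 ;;
    .ite (.eq 18 3) (Code.setPair c 0 1 ;; .instr (.copy 17 8) ;; Code.setNumber c ;;
      .instr (.copy 8 11) ;; .instr (.op .add 7 7 2)) .skip

/-- Output a vertex from the stack of the present level and treat its successors. -/
def Code.pop {ι : Type} (a c : ι) : Code ι :=
  .ite (.eq 4 3) (.instr (.copy 6 8) ;; .instr (.copy 4 7) ;; .instr (.const 7 0)) .skip ;;
    .instr (.op .sub 4 4 2) ;; .instr (.copy 5 6) ;; .instr (.output 5) ;;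
    .instr (.op .add 9 9 2) ;; .instr (.copy 16 5) ;; Code.getNumber c ;; .instr (.copy 6 18) ;;
    Code.scan a 5 0 10 (Code.push c)

/-- Output the vertices in the order of their distances; the lists `c` are used as storage. -/
def Code.stackBfs {ι : Type} (a c : ι) : Code ι :=
  .instr (.const 2 1) ;; .instr (.const 3 0) ;; .instr (.const 5 0) ;;
    .loop (.lt 5 0) (.instr (.copy 16 5) ;; Code.setPair c 0 0 ;; .instr (.op .add 5 5 2)) ;;
    .instr (.copy 16 1) ;; Code.setPair c 0 1 ;; .instr (.copy 6 1) ;; .instr (.const 4 1) ;;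
    .instr (.const 7 0) ;; .instr (.const 8 0) ;; .instr (.const 9 0) ;;
    .loop (.lt 9 0) (Code.pop a c)

/-- The vertices in `O` have been output, those in `S` are the remaining vertices at distance `d`,
and those in `X` are the vertices at distance `d + 1` with property `T`. -/
structure Stacked {ι : Type} (A M : AdjLists ι) (a b c : ι) (n : ℕ) (E : ℕ → ℕ → Prop)
    (δ : ℕ → ℕ) (d : ℕ) (T : ℕ → Prop) (O S X : List ℕ) (cur nxt : ℕ) : Prop where
  arranged : Arranged A M a b n E
  nodup : (O ++ S ++ X).Nodup
  visited : ∀ v < n, (M.pairState c v 0 = 1 ↔ v ∈ O ++ S ++ X)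
  done : ∀ v, v ∈ O ∨ v ∈ S ↔ v < n ∧ δ v ≤ d
  level : ∀ v ∈ S, δ v = d
  next : ∀ v, v ∈ X ↔ v < n ∧ δ v = d + 1 ∧ T v
  sorted : O.Pairwise fun x y => δ x ≤ δ y
  link : Linked (fun v => M.number c v (Nat.clog 2 n)) cur S
  linkNext : Linked (fun v => M.number c v (Nat.clog 2 n)) nxt X
  nxt_lt : nxt < n

/-- The registers of the algorithm that uses stacks. -/
structure StackRegs {ι : Type} (n : ℕ) (O S X : List ℕ) (cur nxt : ℕ) (σ : Mach ι) : Prop where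
  w0 : σ.word 0 = n
  w2 : σ.word 2 = 1
  w3 : σ.word 3 = 0
  w4 : σ.word 4 = S.length
  w6 : σ.word 6 = cur
  w7 : σ.word 7 = X.length
  w8 : σ.word 8 = nxt
  w9 : σ.word 9 = O.length
  out : σ.out = O

section Stack

variable {ι : Type} {A M M' : AdjLists ι} {a b c : ι} {n s w d cur nxt : ℕ} {E : ℕ → ℕ → Prop}
  {δ : ℕ → ℕ} {T : ℕ → Prop} {O S X : List ℕ} {σ σ' : Mach ι}

theorem StackRegs.keep {lo plo : ℕ} (h : StackRegs n O S X cur nxt σ) (hk : Keeps lo plo σ σ')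
    (hlo : 10 ≤ lo := by decide) : StackRegs n O S X cur nxt σ' := by
  have : ∀ x : Fin 24, x.val < 10 → σ'.word x = σ.word x := fun x hx => hk.word x (by omega)
  obtain ⟨h0, h2, h3, h4, h6, h7, h8, h9, ho⟩ := h
  refine ⟨?_, ?_, ?_, ?_, ?_, ?_, ?_, ?_, hk.out.trans ho⟩ <;> rw [this _ (by decide)] <;>
    assumption

theorem Arranged.stored_inj (hR : Arranged A M a b n E) (hc : c = a ∨ c = b) {v : ℕ} (hv : v < n) :
    InjOn (M.val c v) (Iio (M.len c v)) := by
  rcases hc with rfl | rfl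
  · exact hR.out_inj hv
  · exact hR.inn_inj hv

theorem Arranged.stored_lt (hR : Arranged A M a b n E) (L : Layout A a b n s E δ)
    (hc : c = a ∨ c = b) {v : ℕ} (hv : v < n) {r : ℕ} (hr : r < M.len c v) : M.val c v r < n := by
  rcases hc with rfl | rfl
  · exact hR.out_val_lt L hv hr
  · exact hR.inn_val_lt L hv hr

theorem Arranged.setNumber (R : Arranged A M a b n E) {i : ι} {v x k : ℕ} :
    Arranged A (M.setNumber i v x k) a b n E where
  len := by rw [AdjLists.setNumber_len, R.len]
  out u hu := by
    have := R.out u hu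
    rw [← R.len] at this ⊢
    exact AdjLists.bijOn_setNumber this
  inn u hu := by
    have := R.inn u hu
    rw [← R.len] at this ⊢
    exact AdjLists.bijOn_setNumber this

theorem AdjLists.number_congr {i : ι} {v k : ℕ} (hl : M'.len i v = M.len i v)
    (h : M'.val i v = M.val i v) : M'.number i v k = M.number i v k := by
  refine Finset.sum_congr rfl fun j _ => ?_
  rw [AdjLists.pairState_congr hl (by rw [h]) (by rw [h])]

theorem Layout.exists_dist (L : Layout A a b n s E δ) {v k : ℕ} (hv : v < n) (hk : k ≤ δ v) :
    ∃ u < n, δ u = k := by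
  induction hj : δ v generalizing v with
  | zero => exact ⟨v, hv, by omega⟩
  | succ j ih =>
    by_cases h : k = j + 1
    · exact ⟨v, hv, by omega⟩
    · obtain ⟨u, hE, hu⟩ := L.dist_pred v hv (by rintro rfl; rw [L.dist_source] at hj; omega)
      exact ih (L.edge_lt hE).1 (by omega) (by omega)

theorem Stacked.lt (h : Stacked A M a b c n E δ d T O S X cur nxt) {v : ℕ} (hv : v ∈ O ++ S ++ X) :
    v < n := by
  rw [List.mem_append, List.mem_append, h.done, h.next] at hv
  tauto

theorem Stacked.length_le (h : Stacked A M a b c n E δ d T O S X cur nxt) :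
    O.length + S.length + X.length ≤ n := by
  have h1 : (O ++ S ++ X).toFinset ⊆ Finset.range n := fun v hv =>
    Finset.mem_range.2 (h.lt (List.mem_toFinset.1 hv))
  have h2 := Finset.card_le_card h1
  rwa [List.toFinset_card_of_nodup h.nodup, Finset.card_range, List.length_append,
    List.length_append] at h2

theorem Stacked.congr {T' : ℕ → Prop} (h : Stacked A M a b c n E δ d T O S X cur nxt)
    (hT : ∀ v < n, δ v = d + 1 → (T v ↔ T' v)) : Stacked A M a b c n E δ d T' O S X cur nxt := by
  refine { h with next := fun v => ?_ }
  rw [h.next]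
  exact and_congr_right fun hv => and_congr_right fun hd => hT v hv hd

/-- The new vertex `v` is put on the stack of the next level. -/
theorem Stacked.push (h : Stacked A M a b c n E δ d T O S X cur nxt) {v : ℕ} (hc : c = a ∨ c = b)
    (hv : v < n) (hvd : δ v = d + 1) (hnew : M.pairState c v 0 ≠ 1)
    (hlen : 2 * Nat.clog 2 n + 2 ≤ A.len c v) :
    Stacked A ((M.setPair c v 0 1).setNumber c v nxt (Nat.clog 2 n)) a b c n E δ d
      (fun u => T u ∨ u = v) O S (v :: X) cur v := by
  have hR1 : Arranged A (M.setPair c v 0 1) a b n E := h.arranged.setPair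
  have hvis := (h.visited v hv).not.1 hnew
  -- The new vertex is on neither stack, so the links already stored are unaffected.
  have hnum : ∀ u ∈ O ++ S ++ X, ((M.setPair c v 0 1).setNumber c v nxt (Nat.clog 2 n)).number c u
      (Nat.clog 2 n) = M.number c u (Nat.clog 2 n) := fun u hu => by
    have huv : u ≠ v := by rintro rfl; exact hvis hu
    refine AdjLists.number_congr (by simp) ?_
    rw [AdjLists.setNumber_val_ne (Or.inr huv), AdjLists.setPair_val_ne (Or.inr huv)]
  refine ⟨hR1.setNumber, ?_, fun u hu => ?_, h.done, h.level, fun u => ?_, h.sorted,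
    h.link.congr fun u hu => hnum u (by simp [hu]), ⟨rfl, ?_⟩, hv⟩
  · exact List.nodup_middle.2 (List.nodup_cons.2 ⟨hvis, h.nodup⟩)
  · by_cases huv : u = v
    · subst huv
      rw [AdjLists.pairState_setNumber_zero, AdjLists.pairState_setPair le_rfl
        (by rw [h.arranged.len]; omega) (h.arranged.stored_inj hc hv)]
      simp
    · rw [AdjLists.pairState_setNumber_ne (Or.inr huv), AdjLists.pairState_setPair_ne (by tauto),
        h.visited u hu]
      simp [huv]
  · rw [List.mem_cons, h.next]
    constructor
    · rintro (rfl | ⟨h1, h2, h3⟩)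
      · exact ⟨hv, hvd, Or.inr rfl⟩
      · exact ⟨h1, h2, Or.inl h3⟩
    · rintro ⟨h1, h2, h3 | rfl⟩
      · exact Or.inr ⟨h1, h2, h3⟩
      · exact Or.inl rfl
  · have := AdjLists.number_setNumber (x := nxt) (hR1.stored_inj hc hv) (k := Nat.clog 2 n)
      (by rw [hR1.len]; omega) (h.nxt_lt.trans_le (Nat.le_pow_clog (by omega) n))
    simp only [this]
    exact h.linkNext.congr fun u hu => hnum u (by simp [hu])

/-- The stack of the present level is empty. -/
theorem Stacked.rotate (h : Stacked A M a b c n E δ d (fun v => ∃ x ∈ O, E x v) O [] X cur nxt)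
    (L : Layout A a b n s E δ) (hO : O.length < n) : X ≠ [] ∧
      Stacked A M a b c n E δ (d + 1) (fun v => ∃ x ∈ O, E x v) O X [] nxt nxt := by
  have hdone : ∀ v, v ∈ O ↔ v < n ∧ δ v ≤ d := fun v => by simpa using h.done v
  -- All vertices up to level `d` have been output, so each vertex of level `d + 1` has a
  -- predecessor among them and has been put on the next stack.
  have hnext : ∀ v, v ∈ X ↔ v < n ∧ δ v = d + 1 := fun v => by
    rw [h.next]
    refine and_congr_right fun hv => and_iff_left_of_imp fun hd => ?_
    obtain ⟨u, hE, hu⟩ := L.dist_pred v hv (by rintro rfl; rw [L.dist_source] at hd; omega)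
    exact ⟨u, (hdone u).2 ⟨(L.edge_lt hE).1, by omega⟩, hE⟩
  constructor
  -- A vertex not yet output lies beyond level `d`. No distance below its own is skipped, so level
  -- `d + 1` is not empty.
  · have h1 : ∃ v < n, v ∉ O := by
      by_contra! hall
      have h2 : Finset.range n ⊆ O.toFinset := fun v hv =>
        List.mem_toFinset.2 (hall v (Finset.mem_range.1 hv))
      have h3 := (Finset.card_le_card h2).trans (List.toFinset_card_le O)
      rw [Finset.card_range] at h3
      omega
    obtain ⟨v, hv, hvO⟩ := h1
    have hvd : d + 1 ≤ δ v := by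
      by_contra hlt
      exact hvO ((hdone v).2 ⟨hv, by omega⟩)
    obtain ⟨u, hu, hud⟩ := L.exists_dist hv hvd
    exact List.ne_nil_of_mem ((hnext u).2 ⟨hu, hud⟩)
  · refine ⟨h.arranged, by simpa using h.nodup, by simpa using h.visited, fun v => ?_,
      fun v hv => ((hnext v).1 hv).2, fun v => ?_, h.sorted, h.linkNext, trivial, h.nxt_lt⟩
    · rw [hdone, hnext]
      constructor
      · rintro (⟨h1, h2⟩ | ⟨h1, h2⟩)
        · exact ⟨h1, by omega⟩
        · exact ⟨h1, by omega⟩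
      · rintro ⟨h1, h2⟩
        by_cases h3 : δ v ≤ d
        · exact Or.inl ⟨h1, h3⟩
        · exact Or.inr ⟨h1, by omega⟩
    · simp only [List.not_mem_nil, false_iff]
      rintro ⟨-, hd, x, hx, hE⟩
      have := ((hdone x).1 hx).2
      have := L.dist_edge hE
      omega

theorem Stacked.take {u : ℕ} (h : Stacked A M a b c n E δ d T O (u :: S) X cur nxt) :
    cur = u ∧ u < n ∧ δ u = d ∧
      Stacked A M a b c n E δ d T (O ++ [u]) S X (M.number c u (Nat.clog 2 n)) nxt := by
  have hu : δ u = d := h.level u (by simp)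
  refine ⟨h.link.1, h.lt (by simp), hu, h.arranged, by simpa using h.nodup,
    by simpa using h.visited, fun v => ?_, fun v hv => h.level v (by simp [hv]), h.next, ?_,
    h.link.2, h.linkNext, h.nxt_lt⟩
  · rw [← h.done]
    simp only [List.mem_append, List.mem_cons, List.not_mem_nil, or_false]
    tauto
  · rw [List.pairwise_append]
    refine ⟨h.sorted, by simp, fun x hx y hy => ?_⟩
    rw [List.mem_singleton] at hy
    rw [hy, hu]
    exact ((h.done x).1 (Or.inl hx)).2

/-- The traversal of the list of `u` is not disturbed even if `c = a`: only the list of a vertex of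
level `d + 1` is rewritten, while `u` has level `d`. The amount `11 * Nat.clog 2 n + 40` for each
vertex put on a stack covers the storing of its link. -/
theorem runs_push (L : Layout A a b n s E δ) (hw : 16 * n + 16 ≤ 2 ^ w) (hc : c = a ∨ c = b)
    (hlen : ∀ v < n, 2 * Nat.clog 2 n + 2 ≤ A.len c v)
    (h : Stacked A σ.mem a b c n E δ d T O S X cur nxt) (hr : StackRegs n O S X cur nxt σ)
    {u r : ℕ} (hp : σ.ptr 0 = some (a, u, r)) (hr' : r < A.len a u) (hu : u < n) (hud : δ u = d) :
    Runs n w (Code.push c) σ fun σ' t => ∃ X' nxt', Stacked A σ'.mem a b c n E δ d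
      (fun v => T v ∨ v = σ.mem.val a u r) O S X' cur nxt' ∧ StackRegs n O S X' cur nxt' σ' ∧
      σ'.mem.val a u = σ.mem.val a u ∧ σ'.ptr 0 = σ.ptr 0 ∧ σ'.word 10 = σ.word 10 ∧
      t + (11 * Nat.clog 2 n + 40) * X.length ≤ 30 + (11 * Nat.clog 2 n + 40) * X'.length := by
  have hl := h.arranged.len
  have hE : E u (σ.mem.val a u r) := h.arranged.out_mem hu (by rw [hl]; exact hr')
  set v := σ.mem.val a u r with hv
  have hvn := (L.edge_lt hE).2
  have hde := L.dist_edge hE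
  rw [Code.push, runs_seq, runs_load]
  refine ⟨a, u, r, hp, by omega, ?_⟩
  rw [← hv, runs_seq, runs_copy]
  refine ⟨by simp; omega, ?_⟩
  simp only [Function.update_self]
  refine Runs.seq (runs_testPair (p := 0) (v := v) (by omega) (by simp) hvn fun q hq => ?_) ?_
  · have := h.arranged.stored_lt L hc hvn hq
    simp only
    omega
  rintro σ₁ t₁ ⟨k1, m1, h18, -, ht1⟩
  simp only at m1 h18
  have K1 : Keeps 11 4 σ σ₁ := (((Keeps.refl σ).setWord (x := 11) (a := v) (by decide)).setWord
    (x := 16) (a := v) (by decide)).trans (k1.mono (by decide) (by decide))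
  have e11 : σ₁.word 11 = v := by rw [k1.word 11 (by decide)]; simp
  have e16 : σ₁.word 16 = v := by rw [k1.word 16 (by decide)]; simp
  have hr1 := hr.keep K1
  have hle : σ.mem.pairState c v 0 ≠ 2 := by
    intro h2
    rw [AdjLists.pairState_eq_two, hl] at h2
    have := hlen v hvn
    omega
  have hle' := AdjLists.pairState_le (M := σ.mem) (i := c) (v := v) (p := 0)
  by_cases hnew : σ.mem.pairState c v 0 = 0
  swap
  · apply Runs.iteFalse
    · simp only [Cond.Holds]
      rw [h18, hr1.w3]
      exact hnew
    rw [runs_skip]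
    refine ⟨X, nxt, ?_, hr1, by rw [m1], K1.ptr 0 (by decide), K1.word 10 (by decide), by omega⟩
    rw [m1]
    refine h.congr fun x hx hxd => ?_
    constructor
    · exact Or.inl
    · rintro (h1 | rfl)
      · exact h1
      · have := (h.visited _ hvn).1 (by omega)
        rw [List.mem_append, List.mem_append, h.done] at this
        rcases this with h1 | h1
        · omega
        · exact ((h.next _).1 h1).2.2
  apply Runs.iteTrue
  · simp only [Cond.Holds]
    rw [h18, hr1.w3]
    exact hnew
  have hvis := (h.visited v hvn).not.1 (by omega)
  have hvd : δ v = d + 1 := by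
    by_contra hne
    apply hvis
    rw [List.mem_append, List.mem_append, h.done]
    exact Or.inl ⟨hvn, by omega⟩
  have huv : u ≠ v := by rintro h1; rw [h1] at hud; omega
  have hR1 : Arranged A σ₁.mem a b n E := m1 ▸ h.arranged
  refine Runs.seq (runs_setPair (p := 0) (β := 1) (v := v) (by omega) le_rfl e16 hvn
    fun q hq => ?_) ?_
  · have := hR1.stored_lt L hc hvn hq
    omega
  rintro σ₂ t₂ ⟨k2, m2, ht2⟩
  have hr2 := hr1.keep k2
  have hR2 : Arranged A σ₂.mem a b n E := m2 ▸ hR1.setPair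
  have hnxt := h.nxt_lt
  rw [runs_seq, runs_copy, hr2.w8]
  refine ⟨by omega, ?_⟩
  refine Runs.seq (runs_setNumber (i := c) (v := v) (x := nxt) hw (by simpa using hr2.w0)
    (by simpa using hr2.w2) ?_ (by simp) hvn (by omega)
    (by simp only; rw [hR2.len]; exact hlen v hvn)
    (hR2.stored_inj hc hvn).bijOn_image ?_) ?_
  · simp [k2.word 16 (by decide), e16]
  · rintro y ⟨q, hq, rfl⟩
    have := hR2.stored_lt L hc hvn hq
    omega
  rintro σ₃ t₃ ⟨k3, m3, ht3⟩
  simp only [m2, m1] at m3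
  have k13 : Keeps 17 4 σ₁ σ₃ := (k2.mono (by decide) (by decide)).trans
    (((Keeps.refl σ₂).setWord (x := 17) (by decide)).trans k3)
  have hr3 := hr1.keep k13
  have K3 := K1.trans (k13.mono (by decide) (by decide))
  have g11 : σ₃.word 11 = v := (k13.word 11 (by decide)).trans e11
  rw [runs_seq, runs_copy, g11]
  refine ⟨by omega, ?_⟩
  have hlength := h.length_le
  rw [runs_op]
  simp only [WordOp.eval]
  rw [Function.update_of_ne (by decide), Function.update_of_ne (by decide), hr3.w7, hr3.w2]
  refine ⟨by omega, v :: X, v, ?_, ?_, ?_, K3.ptr 0 (by decide), ?_, ?_⟩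
  · simp only [m3]
    exact h.push hc hvn hvd (by omega) (hlen v hvn)
  · constructor <;>
      simp [hr3.w0, hr3.w2, hr3.w3, hr3.w4, hr3.w6, hr3.w9, hr3.out]
  · simp only [m3]
    rw [AdjLists.setNumber_val_ne (Or.inr huv), AdjLists.setPair_val_ne (Or.inr huv)]
  · have := K3.word 10 (by decide)
    simpa using this
  · rw [List.length_cons, mul_add]
    omega

/-- Bound on the time to treat `v`. -/
def popCost (A : AdjLists ι) (a : ι) (n v : ℕ) : ℕ := 35 * A.len a v + 8 * Nat.clog 2 n + 50

theorem runs_pop (L : Layout A a b n s E δ) (hw : 16 * n + 16 ≤ 2 ^ w) (hc : c = a ∨ c = b)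
    (hlen : ∀ v < n, 2 * Nat.clog 2 n + 2 ≤ A.len c v)
    (h : Stacked A σ.mem a b c n E δ d (fun v => ∃ x ∈ O, E x v) O S X cur nxt)
    (hr : StackRegs n O S X cur nxt σ) (hO : O.length < n) :
    Runs n w (Code.pop a c) σ fun σ' t => ∃ d' u S' X' cur' nxt',
      Stacked A σ'.mem a b c n E δ d' (fun v => ∃ x ∈ O ++ [u], E x v) (O ++ [u]) S' X' cur' nxt' ∧
      StackRegs n (O ++ [u]) S' X' cur' nxt' σ' ∧
      t + (11 * Nat.clog 2 n + 40) * (S.length + X.length) ≤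
        popCost A a n u + (11 * Nat.clog 2 n + 40) * (1 + S'.length + X'.length) := by
  have hnxt := h.nxt_lt
  rw [Code.pop]
  -- After the test, and possibly the exchange of the stacks, the stack of the present level is not
  -- empty.
  refine Runs.seq (Q := fun σ₁ t => ∃ d' u S' X' cur', Stacked A σ₁.mem a b c n E δ d'
    (fun v => ∃ x ∈ O, E x v) O (u :: S') X' cur' nxt ∧ StackRegs n O (u :: S') X' cur' nxt σ₁ ∧
    (u :: S').length + X'.length = S.length + X.length ∧ t ≤ 4) ?_ ?_
  · cases S with
    | nil =>
      obtain ⟨hX, hrot⟩ := h.rotate L hO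
      have hlX := h.length_le
      apply Runs.iteTrue
      · simp only [Cond.Holds]
        rw [hr.w4, hr.w3, List.length_nil]
      rw [runs_seq, runs_copy, hr.w8]
      refine ⟨by omega, ?_⟩
      rw [runs_seq, runs_copy]
      dsimp only
      rw [Function.update_of_ne (by decide), hr.w7]
      refine ⟨by omega, ?_⟩
      rw [runs_const]
      refine ⟨by omega, ?_⟩
      cases X with
      | nil => exact absurd rfl hX
      | cons u X =>
        refine ⟨d + 1, u, X, [], nxt, hrot, ?_, by simp, by omega⟩
        constructor <;> simp [hr.w0, hr.w2, hr.w3, hr.w8, hr.w9, hr.out]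
    | cons u S =>
      apply Runs.iteFalse
      · simp only [Cond.Holds]
        rw [hr.w4, hr.w3]
        simp
      rw [runs_skip]
      exact ⟨d, u, S, X, cur, h, hr, rfl, by omega⟩
  rintro σ₁ t₁ ⟨d, u, S', X', cur, h, hr, hSX, ht1⟩
  obtain ⟨rfl, hu, hud, htake⟩ := h.take
  have hll := h.length_le
  simp only [List.length_cons] at hll
  have hnum : σ₁.mem.number c cur (Nat.clog 2 n) < 2 ^ Nat.clog 2 n :=
    AdjLists.number_lt (by rw [h.arranged.len]; exact hlen _ hu)
  have hK := two_pow_clog_le (show 0 < n by omega)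
  rw [runs_seq, runs_op]
  simp only [WordOp.eval, hr.w4, hr.w2, List.length_cons, Nat.add_sub_cancel]
  refine ⟨by omega, ?_⟩
  rw [runs_seq, runs_copy]
  dsimp only
  rw [Function.update_of_ne (by decide), hr.w6]
  refine ⟨by omega, ?_⟩
  rw [runs_seq, runs_output, runs_seq, runs_op]
  simp only [WordOp.eval]
  rw [Function.update_of_ne (by decide), Function.update_of_ne (by decide),
    Function.update_of_ne (by decide), Function.update_of_ne (by decide), hr.w9, hr.w2,
    Function.update_self, hr.out]
  refine ⟨by omega, ?_⟩
  rw [runs_seq, runs_copy]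
  refine ⟨by simp; omega, ?_⟩
  refine Runs.seq (runs_getNumber (i := c) (v := cur) hw (by simp [hr.w0]) (by simp) hu
    (by simp only; rw [h.arranged.len]; exact hlen _ hu) fun q hq => ?_) ?_
  · have := h.arranged.stored_lt L hc hu hq
    simp only
    omega
  rintro σ₂ t₂ ⟨k2, m2, h18, ht2⟩
  simp only at m2 h18
  rw [runs_seq, runs_copy, h18]
  refine ⟨by omega, ?_⟩
  set σ₃ : Mach ι := ⟨Function.update σ₂.word 6 (σ₁.mem.number c cur (Nat.clog 2 n)), σ₂.ptr,
    σ₂.mem, σ₂.out⟩ with hσ₃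
  have hr3 : StackRegs n (O ++ [cur]) S' X' (σ₁.mem.number c cur (Nat.clog 2 n)) nxt σ₃ := by
    have e : ∀ x : Fin 24, x.val < 18 → σ₂.word x = _ := fun x hx => k2.word x hx
    constructor <;>
      simp [hσ₃, e _, k2.out, hr.w0, hr.w2, hr.w3, hr.w7, hr.w8]
  have h35 : σ₃.word 5 = cur := by
    have := k2.word 5 (by decide)
    simp [hσ₃, this]
  have h3 : Stacked A σ₃.mem a b c n E δ d (fun v => ∃ x ∈ O, E x v) (O ++ [cur]) S' X'
      (σ₁.mem.number c cur (Nat.clog 2 n)) nxt := by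
    simp only [hσ₃, m2]
    exact htake
  have hlen3 : σ₃.mem.len a cur = A.len a cur := by rw [h3.arranged.len]
  clear_value σ₃
  set cur' := σ₁.mem.number c cur (Nat.clog 2 n)
  set C := 11 * Nat.clog 2 n + 40 with hC
  let I : ℕ → Mach ι → ℕ → Prop := fun r σ' τ => ∃ X₁ nxt₁, Stacked A σ'.mem a b c n E δ d
    (fun v => (∃ x ∈ O, E x v) ∨ ∃ q < r, σ₃.mem.val a cur q = v) (O ++ [cur]) S' X₁ cur' nxt₁ ∧
    StackRegs n (O ++ [cur]) S' X₁ cur' nxt₁ σ' ∧ σ'.mem.val a cur = σ₃.mem.val a cur ∧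
    τ + C * X'.length ≤ 3 + 35 * r + C * X₁.length
  refine Runs.mono (runs_scan cur (A.len a cur) I (fun σ' τ => ∃ τ', τ = τ' + 1 ∧
    I (A.len a cur) σ' τ') (by omega) (by decide) h35 hu hr3.w2 hlen3 ?_ ?_ ?_ ?_) ?_
  · rintro r σ' τ p f ⟨X₁, nxt₁, g1, g2, g3, g4⟩
    refine ⟨X₁, nxt₁, g1, ?_, g3, g4⟩
    exact g2.keep (((Keeps.refl (lo := 10) (plo := 0) σ').setPtr (x := 0) (a := p)
      (by decide)).setWord (x := 10) (a := f) (by decide))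
  · exact ⟨X', nxt, h3.congr fun v _ _ => by simp, hr3, rfl, by omega⟩
  · rintro r hr' σ₄ τ ⟨X₁, nxt₁, g1, g2, g3, g4⟩ hp h10 - hl4
    refine Runs.mono (runs_push L hw hc hlen g1 g2 hp hr' hu hud) ?_
    rintro σ₅ t₅ ⟨X₂, nxt₂, f1, f2, f3, f4, f5, f6⟩
    rw [← hC] at f6
    refine ⟨f2.w2, by rw [f1.arranged.len], Or.inl ⟨f4.trans hp, f5.trans h10, X₂, nxt₂, ?_, f2,
      f3.trans g3, by omega⟩⟩
    refine f1.congr fun v _ _ => ?_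
    rw [g3]
    simp only [Nat.lt_succ_iff_lt_or_eq]
    constructor
    · rintro ((h1 | ⟨q, h1, h2⟩) | rfl)
      · exact Or.inl h1
      · exact Or.inr ⟨q, Or.inl h1, h2⟩
      · exact Or.inr ⟨r, Or.inr rfl, rfl⟩
    · rintro (h1 | ⟨q, h1 | rfl, h2⟩)
      · exact Or.inl (Or.inl h1)
      · exact Or.inl (Or.inr ⟨q, h1, h2⟩)
      · exact Or.inr h2.symm
  · exact fun σ' τ h => ⟨τ, rfl, h⟩
  rintro σ₄ t₄ ⟨τ, rfl, X₁, nxt₁, g1, g2, g3, g4⟩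
  refine ⟨d, cur, S', X₁, cur', nxt₁, ?_, g2, ?_⟩
  · refine g1.congr fun v _ _ => ?_
    have himg : (∃ q < A.len a cur, σ₃.mem.val a cur q = v) ↔ E cur v := by
      have hb := h3.arranged.out cur hu
      constructor
      · rintro ⟨q, hq, rfl⟩
        exact hb.mapsTo hq
      · intro hE
        obtain ⟨q, hq, h⟩ := hb.surjOn hE
        exact ⟨q, hq, h⟩
    rw [himg]
    simp [or_and_right, exists_or]
  · simp only [List.length_cons] at hSX
    rw [← hSX, popCost]
    have e1 : C * (S'.length + 1 + X'.length) = C * S'.length + C + C * X'.length := by ring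
    have e2 : C * (1 + S'.length + X₁.length) = C * S'.length + C + C * X₁.length := by ring
    rw [e1, e2]
    omega

/-- Every vertex is put on a stack and taken from it once, each time at a cost of O(lg n), and its
list `a` is read once. By `hlen` the lists are so long that `n * Nat.clog 2 n` is at most their
total length, so the logarithm disappears. -/
theorem runs_stackBfs (L : Layout A a b n s E δ) (hw : 16 * n + 16 ≤ 2 ^ w) (hc : c = a ∨ c = b)
    (hlen : ∀ v < n, 2 * Nat.clog 2 n + 2 ≤ A.len c v) (hm : σ.mem = A) (ho : σ.out = [])
    (h0 : σ.word 0 = n) (h1 : σ.word 1 = s) :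
    Runs n w (Code.stackBfs a c) σ fun σ' t => σ'.out.Nodup ∧ (∀ y, y ∈ σ'.out ↔ y < n) ∧
      (σ'.out.Pairwise fun x y => δ x ≤ δ y) ∧ t ≤ 150 * ∑ u ∈ Finset.range n, A.len a u := by
  have hs := L.source_lt
  rw [Code.stackBfs, runs_seq, runs_const]
  refine ⟨by omega, ?_⟩
  rw [runs_seq, runs_const]
  refine ⟨by omega, ?_⟩
  rw [runs_seq, runs_const]
  refine ⟨by omega, ?_⟩
  set σ₀ : Mach ι := ⟨Function.update (Function.update (Function.update σ.word 2 1) 3 0) 5 0,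
    σ.ptr, σ.mem, σ.out⟩ with hσ₀
  have p0 : σ₀.word 0 = n := by simp [hσ₀, h0]
  have p1 : σ₀.word 1 = s := by simp [hσ₀, h1]
  have p2 : σ₀.word 2 = 1 := by simp [hσ₀]
  have p3 : σ₀.word 3 = 0 := by simp [hσ₀]
  have p5 : σ₀.word 5 = 0 := by simp [hσ₀]
  have pm : σ₀.mem = A := hm
  have po : σ₀.out = [] := ho
  change Runs n w _ σ₀ _
  clear_value σ₀
  refine Runs.seq (Runs.count n (fun v σ' t => Keeps 5 4 σ₀ σ' ∧ Arranged A σ'.mem a b n E ∧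
    σ'.word 5 = v ∧ (∀ u < v, σ'.mem.pairState c u 0 ≠ 1) ∧ t ≤ 25 * v) ?_ ?_ ?_) ?_
  · exact ⟨Keeps.refl _, pm ▸ L.arranged, p5, by simp, by simp⟩
  · rintro v hv σ₁ t ⟨k1, hR1, g5, hp1, ht⟩
    refine ⟨by simp only [Cond.Holds]; rw [g5, k1.word 0 (by decide), p0]; exact hv, ?_⟩
    rw [runs_seq, runs_copy, g5]
    refine ⟨by omega, ?_⟩
    refine Runs.seq (runs_setPair (p := 0) (β := 0) (v := v) (by omega) (by omega) (by simp) hv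
      fun r hr => ?_) ?_
    · have := hR1.stored_lt L hc hv hr
      dsimp only
      omega
    rintro σ₂ t₂ ⟨k2, m2, ht2⟩
    simp only at m2
    have k12 : Keeps 16 4 σ₁ σ₂ := ((Keeps.refl σ₁).setWord (x := 16) (by decide)).trans
      (k2.mono (by decide) (by decide))
    rw [runs_op]
    simp only [WordOp.eval]
    rw [k12.word 5 (by decide), k12.word 2 (by decide), g5, k1.word 2 (by decide), p2]
    refine ⟨by omega, (k1.trans (k12.mono (by decide) (by decide))).setWord (by decide),
      by rw [m2]; exact hR1.setPair, by simp, fun u hu => ?_, by omega⟩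
    by_cases huv : u = v
    · subst huv
      rw [m2]
      exact AdjLists.pairState_setPair_zero (hR1.stored_inj hc hv)
    · rw [m2, AdjLists.pairState_setPair_ne (by tauto)]
      exact hp1 u (by omega)
  · rintro σ₁ t ⟨k1, -, g5, -⟩
    simp only [Cond.Holds]
    rw [g5, k1.word 0 (by decide), p0]
    omega
  rintro σ₁ _ ⟨t₁, rfl, k1, hR1, -, hp1, ht1⟩
  rw [runs_seq, runs_copy, k1.word 1 (by decide), p1]
  refine ⟨by omega, ?_⟩
  refine Runs.seq (runs_setPair (p := 0) (β := 1) (v := s) (by omega) le_rfl (by simp) hs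
    fun r hr => ?_) ?_
  · have := hR1.stored_lt L hc hs hr
    dsimp only
    omega
  rintro σ₂ t₂ ⟨k2, m2, ht2⟩
  simp only at m2
  have K2 : Keeps 5 4 σ₀ σ₂ := k1.trans (((Keeps.refl σ₁).setWord (x := 16) (by decide)).trans
    (k2.mono (by decide) (by decide)))
  have q0 : σ₂.word 0 = n := (K2.word 0 (by decide)).trans p0
  have q1 : σ₂.word 1 = s := (K2.word 1 (by decide)).trans p1
  have q2 : σ₂.word 2 = 1 := (K2.word 2 (by decide)).trans p2
  have q3 : σ₂.word 3 = 0 := (K2.word 3 (by decide)).trans p3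
  have qo : σ₂.out = [] := K2.out.trans po
  rw [runs_seq, runs_copy, q1]
  refine ⟨by omega, ?_⟩
  iterate 4
    rw [runs_seq, runs_const]
    refine ⟨by omega, ?_⟩
  -- The next stack is empty, so its head `0` has no meaning. The ends of the stacks carry no mark
  -- either; the counters in registers `4` and `7` tell their sizes.
  have hstart : Stacked A σ₂.mem a b c n E δ 0 (fun v => ∃ x ∈ ([] : List ℕ), E x v)
      [] [s] [] s 0 := by
    refine ⟨m2 ▸ hR1.setPair, by simp, fun v hv => ?_, fun v => ?_, by simp [L.dist_source],
      by simp, by simp, ⟨rfl, trivial⟩, trivial, by omega⟩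
    · by_cases hvs : v = s
      · subst hvs
        rw [m2, AdjLists.pairState_setPair le_rfl (by rw [hR1.len]; have := hlen v hv; omega)
          (hR1.stored_inj hc hv)]
        simp
      · rw [m2, AdjLists.pairState_setPair_ne (by tauto)]
        simp [hvs, hp1 v hv]
    · simp only [List.not_mem_nil, List.mem_singleton, false_or]
      constructor
      · rintro rfl
        exact ⟨hs, L.dist_source.le⟩
      · rintro ⟨h1, h2⟩
        exact L.eq_source h1 (by omega)
  -- The lengths of `O`, `S` and `X` add up to the number of vertices ever put on a stack, each of
  -- which carries the cost of one link.
  refine Runs.mono (Runs.count n (fun r σ' t => ∃ d O S X cur nxt, O.length = r ∧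
    Stacked A σ'.mem a b c n E δ d (fun v => ∃ x ∈ O, E x v) O S X cur nxt ∧
    StackRegs n O S X cur nxt σ' ∧ t ≤ (O.map fun v => popCost A a n v + 1).sum +
      (11 * Nat.clog 2 n + 40) * (O.length + S.length + X.length)) ?_ ?_ ?_) ?_
  · refine ⟨0, [], [s], [], s, 0, rfl, hstart, ?_, by simp⟩
    constructor <;> simp [q0, q2, q3, qo]
  · rintro r hr σ₃ t ⟨d, O, S, X, cur, nxt, rfl, hS, hg, ht⟩
    refine ⟨by simp only [Cond.Holds]; rw [hg.w9, hg.w0]; exact hr, ?_⟩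
    refine (runs_pop L hw hc hlen hS hg hr).mono ?_
    rintro σ₄ t₄ ⟨d', u, S', X', cur', nxt', f1, f2, f3⟩
    refine ⟨d', O ++ [u], S', X', cur', nxt', by simp, f1, f2, ?_⟩
    simp only [List.map_append, List.map_cons, List.map_nil, List.sum_append, List.sum_cons,
      List.sum_nil, List.length_append, List.length_cons, List.length_nil]
    set C := 11 * Nat.clog 2 n + 40
    have e1 : C * (S.length + X.length) + C * O.length = C * (O.length + S.length + X.length) := by
      ring
    have e2 : C * (1 + S'.length + X'.length) + C * O.length =
      C * (O.length + (0 + 1) + S'.length + X'.length) := by ring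
    omega
  · rintro σ₃ t ⟨d, O, S, X, cur, nxt, hO, hS, hg, -⟩
    simp only [Cond.Holds]
    rw [hg.w9, hg.w0]
    omega
  rintro σ₃ _ ⟨t₃, rfl, d, O, S, X, cur, nxt, hO, hS, hg, ht⟩
  have hnd : O.Nodup := (List.nodup_append.1 (List.nodup_append.1 hS.nodup).1).1
  have hall : O.toFinset = Finset.range n := by
    refine Finset.eq_of_subset_of_card_le (fun v hv => Finset.mem_range.2 (hS.lt ?_)) ?_
    · simp [List.mem_toFinset.1 hv]
    · rw [List.toFinset_card_of_nodup hnd, hO, Finset.card_range]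
  rw [hg.out]
  refine ⟨hnd, fun y => by rw [← List.mem_toFinset, hall, Finset.mem_range], hS.sorted, ?_⟩
  have hll := hS.length_le
  have h2 : (O.map fun v => popCost A a n v + 1).sum = 35 * ∑ u ∈ Finset.range n, A.len a u +
      n * (8 * Nat.clog 2 n + 51) := by
    rw [← List.sum_toFinset _ hnd, hall]
    simp only [popCost, Finset.sum_add_distrib, ← Finset.mul_sum]
    simp only [Finset.sum_const, Finset.card_range, smul_eq_mul]
    ring
  have h3 : n * (2 * Nat.clog 2 n + 2) ≤ ∑ u ∈ Finset.range n, A.len a u := by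
    have h4 : n * (2 * Nat.clog 2 n + 2) ≤ ∑ u ∈ Finset.range n, A.len c u := by
      have := Finset.sum_le_sum (s := Finset.range n) fun v hv => hlen v (Finset.mem_range.1 hv)
      simpa using this
    -- If the storage is the other family of lists, its total length is the same: both count the
    -- edges.
    rcases hc with rfl | rfl
    · exact h4
    · rwa [L.sum_len]
  have h5 : (11 * Nat.clog 2 n + 40) * (O.length + S.length + X.length) ≤
      n * (11 * Nat.clog 2 n + 40) := by
    rw [mul_comm]
    exact Nat.mul_le_mul_right _ hll
  have e1 : n * (2 * Nat.clog 2 n + 2) = 2 * (n * Nat.clog 2 n) + 2 * n := by ring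
  have e2 : n * (11 * Nat.clog 2 n + 40) = 11 * (n * Nat.clog 2 n) + 40 * n := by ring
  have e3 : n * (8 * Nat.clog 2 n + 51) = 8 * (n * Nat.clog 2 n) + 51 * n := by ring
  omega

end Stack

/-! ### Choice of the lists that are used as storage -/

/-- Let pointer `4` point to the next node, if it is not null. -/
def Code.advance {ι : Type} : Code ι := .ite (.isNull 4) .skip (.instr (.next 4 4))

/-- Put `1` into register `12` if the lists `i` of all vertices are so long that numbers can be
stored in them, and `0` otherwise. -/
def Code.allLong {ι : Type} (i : ι) : Code ι :=
  .instr (.const 2 1) ;; .instr (.const 12 1) ;; .instr (.const 5 0) ;;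
    .loop (.lt 5 0) (.instr (.head 4 i 5) ;; .instr (.const 19 1) ;;
      .loop (.lt 19 0) (Code.advance ;; Code.advance ;; .instr (.op .add 19 19 19)) ;;
      Code.advance ;; .ite (.isNull 4) (.instr (.const 12 0)) .skip ;; .instr (.op .add 5 5 2))

section Choice

variable {ι : Type} {n w : ℕ} {σ : Mach ι} {i : ι}

theorem runs_advance {v p : ℕ} (hp : σ.ptr 4 = σ.mem.nodeAt i v p) :
    Runs n w Code.advance σ fun σ' t => Keeps 24 4 σ σ' ∧ σ'.word = σ.word ∧ σ'.mem = σ.mem ∧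
      σ'.ptr 4 = σ.mem.nodeAt i v (p + 1) ∧ t ≤ 2 := by
  by_cases h : p < σ.mem.len i v
  · have hp' : σ.ptr 4 = some (i, v, p) := by rw [hp, AdjLists.nodeAt, if_pos h]
    apply Runs.iteFalse (by simp [Cond.Holds, hp'])
    rw [runs_next]
    exact ⟨i, v, p, hp', (Keeps.refl σ).setPtr (by decide), rfl, rfl, by simp, by omega⟩
  · have hp' : σ.ptr 4 = none := by rw [hp, AdjLists.nodeAt, if_neg h]
    apply Runs.iteTrue (by simpa [Cond.Holds] using hp')
    rw [runs_skip]
    refine ⟨Keeps.refl σ, rfl, rfl, ?_, by omega⟩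
    rw [hp', AdjLists.nodeAt, if_neg (by omega)]

open Classical in
-- For each vertex the pointer advances to position `2 * K + 1`, where it is null exactly if the
-- list has fewer than `2 * K + 2` nodes. The assertion with `Keeps 0 4` concerns pointers and
-- output only; the word registers that matter are listed separately.
theorem runs_allLong (hw : 16 * n + 16 ≤ 2 ^ w) (h0 : σ.word 0 = n) :
    Runs n w (Code.allLong i) σ fun σ' t => Keeps 0 4 { σ with word := σ'.word } σ' ∧
      σ'.word 0 = σ.word 0 ∧ σ'.word 1 = σ.word 1 ∧ σ'.word 2 = 1 ∧ σ'.mem = σ.mem ∧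
      σ'.word 12 = (if ∀ v < n, 2 * Nat.clog 2 n + 2 ≤ σ.mem.len i v then 1 else 0) ∧
      t ≤ n * (6 * Nat.clog 2 n + 12) + 4 := by
  set K := Nat.clog 2 n with hK
  rw [Code.allLong, runs_seq, runs_const]
  refine ⟨by omega, ?_⟩
  rw [runs_seq, runs_const]
  refine ⟨by omega, ?_⟩
  rw [runs_seq, runs_const]
  refine ⟨by omega, ?_⟩
  refine Runs.mono (Runs.count n (fun v σ' t => σ'.word 0 = n ∧ σ'.word 1 = σ.word 1 ∧
    σ'.word 2 = 1 ∧ σ'.word 5 = v ∧ σ'.mem = σ.mem ∧ (∀ p : Fin 8, p.val < 4 → σ'.ptr p = σ.ptr p) ∧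
    σ'.out = σ.out ∧ σ'.word 12 = (if ∀ u < v, 2 * K + 2 ≤ σ.mem.len i u then 1 else 0) ∧
    t ≤ v * (6 * K + 12)) ?_ ?_ ?_) ?_
  · simp [h0]
  · rintro v hv σ₁ t ⟨e0, e1, e2, e5, em, ep, eo, e12, ht⟩
    refine ⟨by simp only [Cond.Holds]; rw [e5, e0]; exact hv, ?_⟩
    rw [runs_seq, runs_head, e5]
    refine ⟨hv, ?_⟩
    rw [runs_seq, runs_const]
    refine ⟨by omega, ?_⟩
    refine Runs.seq (Runs.count K (fun j σ' t => Keeps 19 4 σ₁ σ' ∧ σ'.mem = σ.mem ∧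
      σ'.word 19 = 2 ^ j ∧ σ'.ptr 4 = σ.mem.nodeAt i v (2 * j) ∧ t ≤ 6 * j) ?_ ?_ ?_) ?_
    · exact ⟨((Keeps.refl σ₁).setPtr (x := 4) (by decide)).setWord (x := 19) (by decide), em,
        by simp, by simp [em], by simp⟩
    · rintro j hj σ₂ t' ⟨k2, m2, g19, gp, ht'⟩
      have hpow := two_pow_lt_iff.2 hj
      refine ⟨by simp only [Cond.Holds]; rw [g19, k2.word 0 (by decide), e0]; exact hpow, ?_⟩
      refine Runs.seq (runs_advance (i := i) (v := v) (by rw [m2]; exact gp)) ?_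
      rintro σ₃ t₃ ⟨k3, w3, m3, p3, ht3⟩
      refine Runs.seq (runs_advance (i := i) (v := v) (by rw [m3]; exact p3)) ?_
      rintro σ₄ t₄ ⟨k4, w4, m4, p4, ht4⟩
      rw [runs_op]
      have g : σ₄.word 19 = 2 ^ j := by rw [w4, w3, g19]
      simp only [WordOp.eval, g]
      refine ⟨by omega, (k2.trans ((k3.trans k4).mono (by decide) le_rfl)).setWord
        (x := 19) (by decide), ?_, ?_, ?_, by omega⟩
      · exact m4.trans (m3.trans m2)
      · simp; ring
      · rw [p4, m3, m2]
        rfl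
    · rintro σ₂ t' ⟨k2, -, g19, -⟩
      simp only [Cond.Holds]
      rw [g19, k2.word 0 (by decide), e0, two_pow_lt_iff]
      omega
    rintro σ₂ _ ⟨t₂, rfl, k2, m2, g19, gp, ht2⟩
    refine Runs.seq (runs_advance (i := i) (v := v) (by rw [m2]; exact gp)) ?_
    rintro σ₃ t₃ ⟨k3, w3, m3, p3, ht3⟩
    have k23 := k2.trans (k3.mono (by decide) le_rfl)
    have m3' : σ₃.mem = σ.mem := m3.trans m2
    have f12 : σ₃.word 12 = σ₁.word 12 := k23.word 12 (by decide)
    refine Runs.seq (Q := fun σ' t => (∀ x : Fin 24, x.val < 12 → σ'.word x = σ₁.word x) ∧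
      σ'.mem = σ.mem ∧ (∀ p : Fin 8, p.val < 4 → σ'.ptr p = σ.ptr p) ∧ σ'.out = σ.out ∧
      σ'.word 12 = (if ∀ u < v + 1, 2 * K + 2 ≤ σ.mem.len i u then 1 else 0) ∧ t ≤ 2) ?_ ?_
    · have hall : (∀ u < v + 1, 2 * K + 2 ≤ σ.mem.len i u) ↔
          (∀ u < v, 2 * K + 2 ≤ σ.mem.len i u) ∧ 2 * K + 2 ≤ σ.mem.len i v := by
        simp only [Nat.lt_succ_iff_lt_or_eq]
        exact ⟨fun h => ⟨fun u hu => h u (Or.inl hu), h v (Or.inr rfl)⟩,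
          fun h u hu => hu.elim (h.1 u) fun hu => hu ▸ h.2⟩
      have kp : ∀ p : Fin 8, p.val < 4 → σ₃.ptr p = σ.ptr p := fun p hp =>
        (k23.ptr p hp).trans (ep p hp)
      rw [m2, AdjLists.nodeAt] at p3
      by_cases hl : 2 * K + 1 < σ.mem.len i v
      · rw [if_pos hl] at p3
        apply Runs.iteFalse (by simp [Cond.Holds, p3])
        rw [runs_skip]
        refine ⟨fun x hx => k23.word x (by omega), m3', kp, k23.out.trans eo, ?_, by omega⟩
        rw [f12, e12]
        simp only [hall, show 2 * K + 2 ≤ σ.mem.len i v from hl, and_true]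
      · rw [if_neg hl] at p3
        apply Runs.iteTrue (by simpa [Cond.Holds] using p3)
        rw [runs_const]
        refine ⟨by omega, fun x hx => ?_, m3', kp, k23.out.trans eo, ?_, by omega⟩
        · have : x ≠ 12 := by rintro rfl; simp at hx
          simp only [Function.update_of_ne this]
          exact k23.word x (by omega)
        · rw [if_neg (by rw [hall]; omega)]
          simp
    rintro σ₄ t₄ ⟨k4, m4, p4, o4, g12, ht4⟩
    rw [runs_op]
    simp only [WordOp.eval, k4 5 (by decide), k4 2 (by decide), e5, e2]
    refine ⟨by omega, ?_, ?_, ?_, by simp, m4, p4, o4, by simpa using g12, ?_⟩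
    · simp [k4 0, e0]
    · simp [k4 1, e1]
    · simp [k4 2, e2]
    · rw [add_mul]
      omega
  · rintro σ₁ t ⟨e0, -, -, e5, -⟩
    simp only [Cond.Holds]
    rw [e5, e0]
    omega
  · rintro σ₁ _ ⟨t₁, rfl, e0, e1, e2, e5, em, ep, eo, e12, ht⟩
    exact ⟨⟨fun _ _ => rfl, ep, eo⟩, e0.trans h0.symm, e1, e2, em, e12, by omega⟩

end Choice

/-! ### Graphs of large degree. -/

/-- The algorithm for directed graphs with large in- or out-degrees. -/
def Code.chooseBfs : Code Dir :=
  Code.allLong Dir.outward ;; .ite (.eq 12 2) (Code.stackBfs Dir.outward Dir.outward)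
    (Code.stackBfs Dir.outward Dir.inward)

/-- From `Nat.clog 2 n < Real.logb 2 n + 1` the integer `k` exceeds `2 * Nat.clog 2 n + 1`. The
constant 3 in the degree condition thus leaves room for the visited bit. -/
theorem clog_le_of_logb_le {n k : ℕ} (hn : 0 < n) (h : 2 * Real.logb 2 n + 3 ≤ (k : ℝ)) :
    2 * Nat.clog 2 n + 2 ≤ k := by
  have h1 : (Nat.clog 2 n : ℝ) < Real.logb 2 n + 1 := by
    rcases Nat.lt_or_ge 1 n with h1 | h1
    · have h2 := Nat.pow_pred_clog_lt_self (b := 2) (by omega) h1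
      have h3 : 0 < Nat.clog 2 n := Nat.clog_pos (by omega) h1
      have h4 : ((Nat.clog 2 n).pred : ℝ) < Real.logb 2 n := by
        rw [Real.lt_logb_iff_rpow_lt (by norm_num) (by exact_mod_cast hn), Real.rpow_natCast]
        exact_mod_cast h2
      have h5 : (Nat.clog 2 n : ℝ) = ((Nat.clog 2 n).pred : ℝ) + 1 := by
        exact_mod_cast (Nat.succ_pred_eq_of_pos h3).symm
      linarith
    · obtain rfl : n = 1 := by omega
      simp
  have h2 : ((2 * Nat.clog 2 n + 1 : ℕ) : ℝ) < k := by
    push_cast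
    linarith
  exact_mod_cast h2

theorem undirected_stackBfs {n : ℕ} {G : SimpleGraph (Fin n)} {A : AdjLists Unit} {s : Fin n}
    {ℓ : ℕ} (hA : A.RepresentsGraph G) (h : ∀ v, G.edist s v ≤ ℓ)
    (hdeg : ∀ v, 2 * Real.logb 2 n + 3 ≤ ((G.neighborSet v).ncard : ℝ)) :
    (Code.stackBfs () ()).OutputsBFS A s (G.edist s) (300 * (G.edgeSet.ncard + 1))
      (300 * (Nat.log 2 n + 1)) := by
  refine outputsBFS_of_runs (by simp) hA.len_le (ne_top_of_le h) (by omega) ?_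
  refine (runs_stackBfs (hA.layout h) (two_pow_log_add n) (Or.inl rfl) (fun v hv => ?_) rfl
    rfl rfl rfl).mono ?_
  · rw [(hA ⟨v, hv⟩).len_eq]
    exact clog_le_of_logb_le s.pos (hdeg ⟨v, hv⟩)
  · rintro σ t ⟨h1, h2, h3, ht⟩
    rw [hA.sum_len] at ht
    exact ⟨h1, h2, h3, by omega⟩

theorem directed_chooseBfs {n : ℕ} {G : Digraph (Fin n)} {A : AdjLists Dir} {s : Fin n}
    {ℓ : ℕ} (hA : A.RepresentsDigraph G) (h : ∀ v, G.edist s v ≤ ℓ)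
    (hdeg : (∀ v, 2 * Real.logb 2 n + 3 ≤ (G.outDeg v : ℝ)) ∨
      ∀ v, 2 * Real.logb 2 n + 3 ≤ (G.inDeg v : ℝ)) :
    Code.chooseBfs.OutputsBFS A s (G.edist s) (300 * (G.numEdges + 1))
      (300 * (Nat.log 2 n + 1)) := by
  classical
  have hn := s.pos
  have hw := two_pow_log_add n
  have L := hA.layout h
  have hlong : (∀ v < n, 2 * Nat.clog 2 n + 2 ≤ A.len Dir.outward v) ∨
      ∀ v < n, 2 * Nat.clog 2 n + 2 ≤ A.len Dir.inward v := by
    refine hdeg.imp (fun hd v hv => ?_) fun hd v hv => ?_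
    · rw [(hA ⟨v, hv⟩).1.len_eq]
      exact clog_le_of_logb_le hn (hd ⟨v, hv⟩)
    · rw [(hA ⟨v, hv⟩).2.len_eq]
      exact clog_le_of_logb_le hn (hd ⟨v, hv⟩)
  -- Whichever lists are long, their total length is the number of edges; so the O(n lg n) time for
  -- the test is covered even if it fails.
  have hsum : n * (2 * Nat.clog 2 n + 2) ≤ G.numEdges := by
    rw [← hA.sum_len]
    have key : ∀ i, (∀ v < n, 2 * Nat.clog 2 n + 2 ≤ A.len i v) →
        n * (2 * Nat.clog 2 n + 2) ≤ ∑ v ∈ Finset.range n, A.len i v := fun i hi => by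
      have := Finset.sum_le_sum (s := Finset.range n) fun v hv => hi v (Finset.mem_range.1 hv)
      simpa using this
    rcases hlong with hl | hl
    · exact key _ hl
    · rw [L.sum_len]
      exact key _ hl
  refine outputsBFS_of_runs (by decide) hA.len_le (ne_top_of_le h) (by omega) ?_
  refine Runs.seq (runs_allLong hw rfl) ?_
  rintro σ t ⟨hk, e0, e1, e2, em, e12, ht⟩
  have e1' : n * (2 * Nat.clog 2 n + 2) = 2 * (n * Nat.clog 2 n) + 2 * n := by ring
  have e2' : n * (6 * Nat.clog 2 n + 12) = 6 * (n * Nat.clog 2 n) + 12 * n := by ring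
  change σ.word 12 = (if ∀ v < n, 2 * Nat.clog 2 n + 2 ≤ A.len Dir.outward v then 1 else 0) at e12
  by_cases hl : ∀ v < n, 2 * Nat.clog 2 n + 2 ≤ A.len Dir.outward v
  · rw [if_pos hl] at e12
    apply Runs.iteTrue
    · simp only [Cond.Holds]
      rw [e12, e2]
    refine (runs_stackBfs L hw (Or.inl rfl) hl em hk.out e0 e1).mono ?_
    rintro σ' t' ⟨h1, h2, h3, ht'⟩
    rw [hA.sum_len] at ht'
    exact ⟨h1, h2, h3, by omega⟩
  · rw [if_neg hl] at e12
    apply Runs.iteFalse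
    · simp only [Cond.Holds]
      rw [e12, e2]
      omega
    refine (runs_stackBfs L hw (Or.inr rfl) (hlong.resolve_left hl) em hk.out e0 e1).mono ?_
    rintro σ' t' ⟨h1, h2, h3, ht'⟩
    rw [hA.sum_len] at ht'
    exact ⟨h1, h2, h3, by omega⟩

theorem theorem4 :
    (∃ (k j : ℕ) (P : Prog Unit k j) (c : ℕ),
      ∀ (n : ℕ) (G : SimpleGraph (Fin n)) (A : AdjLists Unit) (s : Fin n) (ℓ : ℕ),
      A.RepresentsGraph G → (∀ v, G.edist s v ≤ ℓ) →
      P.OutputsBFS A s (G.edist s) (c * (G.edgeSet.ncard + n * ℓ ^ 2 + 1)) (c * (Nat.log 2 n + 1))) ∧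
    (∃ (k j : ℕ) (P : Prog Dir k j) (c : ℕ),
      ∀ (n : ℕ) (G : Digraph (Fin n)) (A : AdjLists Dir) (s : Fin n) (ℓ : ℕ),
      A.RepresentsDigraph G → (∀ v, G.edist s v ≤ ℓ) →
      P.OutputsBFS A s (G.edist s) (c * (G.numEdges + n * ℓ ^ 2 + 1)) (c * (Nat.log 2 n + 1))) ∧
    (∃ (k j : ℕ) (P : Prog Unit k j) (c : ℕ),
      ∀ (n : ℕ) (G : SimpleGraph (Fin n)) (A : AdjLists Unit) (s : Fin n) (ℓ : ℕ),
      A.RepresentsGraph G → (∀ v, G.edist s v ≤ ℓ) →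
      (∀ v, (G.neighborSet v).ncard ≠ 2) →
      P.OutputsBFS A s (G.edist s) (c * (G.edgeSet.ncard + n * ℓ + 1)) (c * (Nat.log 2 n + 1))) ∧
    (∃ (k j : ℕ) (P : Prog Dir k j) (c : ℕ),
      ∀ (n : ℕ) (G : Digraph (Fin n)) (A : AdjLists Dir) (s : Fin n) (ℓ : ℕ),
      A.RepresentsDigraph G → (∀ v, G.edist s v ≤ ℓ) →
      ((∀ v, G.outDeg v ≠ 2) ∨ (∀ v, G.inDeg v ≠ 2)) →
      P.OutputsBFS A s (G.edist s) (c * (G.numEdges + n * ℓ + 1)) (c * (Nat.log 2 n + 1))) ∧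
    (∃ (k j : ℕ) (P : Prog Unit k j) (c : ℕ),
      ∀ (n : ℕ) (G : SimpleGraph (Fin n)) (A : AdjLists Unit) (s : Fin n) (ℓ : ℕ),
      A.RepresentsGraph G → (∀ v, G.edist s v ≤ ℓ) →
      (∀ v, 2 * Real.logb 2 n + 3 ≤ ((G.neighborSet v).ncard : ℝ)) →
      P.OutputsBFS A s (G.edist s) (c * (G.edgeSet.ncard + 1)) (c * (Nat.log 2 n + 1))) ∧
    (∃ (k j : ℕ) (P : Prog Dir k j) (c : ℕ),
      ∀ (n : ℕ) (G : Digraph (Fin n)) (A : AdjLists Dir) (s : Fin n) (ℓ : ℕ),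
      A.RepresentsDigraph G → (∀ v, G.edist s v ≤ ℓ) →
      ((∀ v, 2 * Real.logb 2 n + 3 ≤ (G.outDeg v : ℝ)) ∨
        (∀ v, 2 * Real.logb 2 n + 3 ≤ (G.inDeg v : ℝ))) →
      P.OutputsBFS A s (G.edist s) (c * (G.numEdges + 1)) (c * (Nat.log 2 n + 1))) := by
  -- Since `ℓ ≤ ℓ ^ 2`, the bound O(m + nℓ) also yields (a).
  have hsq : ∀ n ℓ m : ℕ, 17600 * (m + n * ℓ + 1) ≤ 17600 * (m + n * ℓ ^ 2 + 1) := fun n ℓ m => by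
    have := Nat.mul_le_mul_left n (Nat.le_self_pow (n := 2) (by omega) ℓ)
    omega
  refine ⟨⟨24, 8, Code.bfs () () 1, 17600, fun n G A s ℓ hA h => ?_⟩,
    ⟨24, 8, Code.bfs Dir.outward Dir.inward 0, 17600, fun n G A s ℓ hA h => ?_⟩,
    ⟨24, 8, Code.bfs () () 1, 17600, fun n G A s ℓ hA h _ => undirected_bfs hA h le_rfl⟩,
    ⟨24, 8, Code.bfs Dir.outward Dir.inward 0, 17600, fun n G A s ℓ hA h _ =>
      directed_bfs hA h le_rfl⟩,
    ⟨24, 8, Code.stackBfs () (), 300, fun n G A s ℓ hA h hdeg => undirected_stackBfs hA h hdeg⟩,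
    ⟨24, 8, Code.chooseBfs, 300, fun n G A s ℓ hA h hdeg => directed_chooseBfs hA h hdeg⟩⟩
  · exact undirected_bfs hA h (hsq _ _ _)
  · exact directed_bfs hA h (hsq _ _ _)
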